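/- Let $\alpha,x>0$ and $\mu<\tfrac12$ be real. For complex $\mu,\nu$ and $z>0$, with neither $\mu+\nu$ nor $\mu-\nu$ an odd negative integer, put $$s_{\mu,\nu}(z)=\frac{z^{\mu+1}}{(\mu-\nu+1)(\mu+\nu+1)}\;{}_1F_2\!\left(1;\tfrac{\mu-\nu+3}{2},\tfrac{\mu+\nu+3}{2};-\tfrac14z^2\right),$$ and let $S_{\mu,\nu}(z)$ be the Lommel function $$S_{\mu,\nu}(z)=s_{\mu,\nu}(z)+\frac{2^{\mu-1}\Gamma\left(\frac{\mu-\nu+1}{2}\right)\Gamma\left(\frac{\mu+\nu+1}{2}\right)}{\sin(\pi\nu)}\left\{\cos\left(\tfrac{(\mu-\nu)\pi}{2}\right)J_{-\nu}(z)-\cos\left(\tfrac{(\mu+\nu)\pi}{2}\right)J_{\nu}(z)\right\}\quad(\nu\notin\mathbb Z),$$ $$S_{\mu,\nu}(z)=s_{\mu,\nu}(z)+2^{\mu-1}\Gamma\left(\tfrac{\mu-\nu+1}{2}\right)\Gamma\left(\tfrac{\mu+\nu+1}{2}\right)\left\{\sin\left(\tfrac{(\mu-\nu)\pi}{2}\right)J_{\nu}(z)-\cos\left(\tfrac{(\mu-\nu)\pi}{2}\right)Y_{\nu}(z)\right\}\quad(\nu\in\mathbb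 Z),$$ where $J_\nu$ and $Y_\nu$ are the Bessel functions of the first and second kind; if $\mu+\nu$ or $\mu-\nu$ is an odd negative integer, $S_{\mu,\nu}(z)$ denotes, as usual, the limit of $S_{m,\nu}(z)$ as $m\to\mu$, $m\neq\mu$. Then both series below converge absolutely, and $$\Gamma^{2}\left(\frac{1-\mu}{2}\right)S_{\mu,0}(x)+2\sum_{n=1}^{\infty}\left|\Gamma\left(\frac{1-\mu+i\alpha n}{2}\right)\right|^{2}S_{\mu,i\alpha n}(x)$$ $$=\frac{2^{\mu+1}\pi\,\Gamma(1-\mu)}{\alpha}\sqrt{x}\left\{S_{\mu-\frac12,\frac12}(x)+2\sum_{n=1}^{\infty}\cosh^{\frac12}\left(\frac{2\pi n}{\alpha}\right)S_{\mu-\frac12,\frac12}\left(x\cosh\left(\frac{2\pi n}{\alpha}\right)\right)\right\}.$$ -/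

import Mathlib

open Filter Topology

/-- The generalized hypergeometric function `₁F₂(a; b, c; z)`, for `b`, `c` not in `{0, -1, -2, …}`:
Mathlib's regularized function, whose coefficients are `(a)ₙ / (n! Γ(b+n) Γ(c+n))`, multiplied by
`Γ(b) Γ(c)`. -/
noncomputable def hyp1F2 (a b c z : ℂ) : ℂ :=
  Complex.Gamma b * Complex.Gamma c * Complex.regularizedHGFun {a} {b, c} z

/-- The Bessel function of the first kind
`J_ν(z) = (z/2)^ν ∑ₖ (-1)^k (z²/4)^k / (k! Γ(ν+k+1))`, with the principal branch of the power.
Since `Complex.Gamma` is `0` at its poles, and `0⁻¹ = 0`, the reciprocal of the Gamma function takes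
the right value `0` there. -/
noncomputable def besselJ (ν z : ℂ) : ℂ :=
  (z / 2) ^ ν *
    ∑' k : ℕ, (-1) ^ k * (z ^ 2 / 4) ^ k / ((k.factorial : ℂ) * Complex.Gamma (ν + k + 1))

/-- `(J_ν(z) cos(πν) - J_{-ν}(z)) / sin(πν)`, meaningful for `ν ∉ ℤ`. -/
noncomputable def besselYAux (ν z : ℂ) : ℂ :=
  (besselJ ν z * Complex.cos (Real.pi * ν) - besselJ (-ν) z) / Complex.sin (Real.pi * ν)

open Classical in
/-- The Bessel function of the second kind; for integer order it is the limit in the order. -/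
noncomputable def besselY (ν z : ℂ) : ℂ :=
  if ∃ n : ℤ, ν = n then limUnder (𝓝[≠] ν) (fun w => besselYAux w z) else besselYAux ν z

/-- The Lommel function `s_{μ,ν}(z)`, for `μ + ν` and `μ - ν` not odd negative integers. -/
noncomputable def lommels (μ ν z : ℂ) : ℂ :=
  z ^ (μ + 1) / ((μ - ν + 1) * (μ + ν + 1)) *
    hyp1F2 1 ((μ - ν + 3) / 2) ((μ + ν + 3) / 2) (-(1 / 4) * z ^ 2)

open Classical in
/-- The defining formulas of the Lommel function `S_{μ,ν}(z)`, for `μ + ν` and `μ - ν` not odd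
negative integers. -/
noncomputable def lommelSAux (μ ν z : ℂ) : ℂ :=
  if ∃ n : ℤ, ν = n then
    lommels μ ν z +
      2 ^ (μ - 1) * Complex.Gamma ((μ - ν + 1) / 2) * Complex.Gamma ((μ + ν + 1) / 2) *
        (Complex.sin ((μ - ν) * Real.pi / 2) * besselJ ν z -
          Complex.cos ((μ - ν) * Real.pi / 2) * besselY ν z)
  else
    lommels μ ν z +
      2 ^ (μ - 1) * Complex.Gamma ((μ - ν + 1) / 2) * Complex.Gamma ((μ + ν + 1) / 2) /
          Complex.sin (Real.pi * ν) *
        (Complex.cos ((μ - ν) * Real.pi / 2) * besselJ (-ν) z -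
          Complex.cos ((μ + ν) * Real.pi / 2) * besselJ ν z)

/-- `μ + ν` or `μ - ν` is an odd negative integer, so that the formulas for the Lommel functions
have poles in their coefficients. -/
def LommelExceptional (μ ν : ℂ) : Prop :=
  ∃ k : ℕ, μ + ν = -(2 * (k : ℂ) + 1) ∨ μ - ν = -(2 * (k : ℂ) + 1)

open Classical in
/-- The Lommel function `S_{μ,ν}(z)`: the defining formulas, and their limit in `μ` where `μ + ν` or
`μ - ν` is an odd negative integer (a removable singularity). -/
noncomputable def lommelS (μ ν z : ℂ) : ℂ :=
  if LommelExceptional μ ν then limUnder (𝓝[≠] μ) (fun m => lommelSAux m ν z)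
  else lommelSAux μ ν z

section

open MeasureTheory Set

/-! The theorem is Poisson summation for a single function. Put `G_p(c) = ∫₀^∞ t^(p-1) e^(-ct) /
(1+t²) dt` (`laplaceG`) and `p = 1-μ`. The key fact is the integral representation `lommelS_mul`:
for `|Re ν| < Re p`, and `ν` zero or not an integer, `S_{μ,ν}(z) Γ((p+ν)/2) Γ((p-ν)/2) = 2^μ ∫
e^(νu) G_p(z cosh u) du`. For `ν = iαn` the two Gamma factors are complex conjugates, so the left
series consists of Fourier coefficients of `u ↦ G_p(x cosh u)`. Poisson summation
(`tsum_coshTransform_laplaceG`) turns it into a sum of the values `G_p(x cosh(2πn/α))`. The case `ν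
= 1/2` of the representation, with parameter `p + 1/2`, has an elementary inner integral and
identifies these values with Lommel functions of order `1/2` (`lommelS_half`).

The representation is proved by an ODE argument in the variable `τ = log z`. The integral satisfies
an inhomogeneous Bessel equation (`coshTransform_eulerG_two_sub`), and so does the combination of
power series that defines `S` (`lommelComb_two`). For real `0 < ν < p < 1` their expansions at `τ →
-∞` agree up to `o(e^(ντ))`, and `eq_zero_of_bessel_equation` makes the difference vanish. Analytic
continuation in `p`, then in `ν`, gives `coshTransform_laplaceG_eq_lommelComb`. The order `ν = 0`
and the exceptional `μ` are reached by limits. -/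

/-! ### Gamma and beta integrals in exponential variables -/

theorem integral_exp_smul_comp_exp {E : Type*} [NormedAddCommGroup E] [NormedSpace ℝ E]
    (g : ℝ → E) : ∫ x : ℝ, Real.exp x • g (Real.exp x) = ∫ y in Ioi (0 : ℝ), g y := by
  have h := integral_image_eq_integral_abs_deriv_smul (MeasurableSet.univ (α := ℝ))
    (fun x _ ↦ (Real.hasDerivAt_exp x).hasDerivWithinAt)
    (fun x _ y _ hxy ↦ Real.exp_injective hxy) g
  rw [image_univ, Real.range_exp] at h
  simpa [abs_of_pos (Real.exp_pos _)] using h.symm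

theorem integrable_exp_smul_comp_exp {E : Type*} [NormedAddCommGroup E] [NormedSpace ℝ E]
    (g : ℝ → E) :
    Integrable (fun x : ℝ ↦ Real.exp x • g (Real.exp x)) ↔ IntegrableOn g (Ioi (0 : ℝ)) := by
  have h := integrableOn_image_iff_integrableOn_abs_deriv_smul (MeasurableSet.univ (α := ℝ))
    (fun x _ ↦ (Real.hasDerivAt_exp x).hasDerivWithinAt)
    (fun x _ y _ hxy ↦ Real.exp_injective hxy) g
  rw [image_univ, Real.range_exp] at h
  simpa [abs_of_pos (Real.exp_pos _)] using h.symm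

theorem norm_cexp_mul_ofReal (p : ℂ) (r : ℝ) : ‖Complex.exp (p * r)‖ = Real.exp (p.re * r) := by
  simp [Complex.norm_exp]

theorem integrable_exp_neg_mul_abs {δ : ℝ} (hδ : 0 < δ) :
    Integrable (fun u : ℝ ↦ Real.exp (-(δ * |u|))) := by
  have h1 : IntegrableOn (fun u : ℝ ↦ Real.exp (-(δ * |u|))) (Ioi 0) := by
    refine (exp_neg_integrableOn_Ioi 0 hδ).congr_fun (fun u hu ↦ ?_) measurableSet_Ioi
    simp [abs_of_pos (mem_Ioi.1 hu)]
  have h2 : IntegrableOn (fun u : ℝ ↦ Real.exp (-(δ * |u|))) (Iic 0) := by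
    rw [integrableOn_Iic_iff_integrableOn_Iio]
    refine (IntegrableOn.comp_neg_Iio (c := 0) (by simpa only [neg_zero] using h1)).congr_fun
      (fun u _ ↦ ?_) measurableSet_Iio
    simp only [abs_neg]
  simpa [Iic_union_Ioi] using h2.union h1

theorem integrable_exp_mul_exp_neg_exp {σ c : ℝ} (hσ : 0 < σ) (hc : 0 < c) :
    Integrable (fun r : ℝ ↦ Real.exp (σ * r) * Real.exp (-(c * Real.exp r))) := by
  have h := integrableOn_rpow_mul_exp_neg_mul_rpow (s := σ - 1) (p := 1) (b := c)
    (by linarith) one_pos hc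
  rw [← integrable_exp_smul_comp_exp] at h
  refine h.congr (Eventually.of_forall fun r ↦ ?_)
  simp only [smul_eq_mul, Real.rpow_one]
  rw [← Real.exp_mul, ← mul_assoc, ← Real.exp_add]
  ring_nf

theorem integrable_cexp_mul_exp_neg_exp {p : ℂ} {c : ℝ} (hp : 0 < p.re) (hc : 0 < c) :
    Integrable (fun r : ℝ ↦ Complex.exp (p * r) * (Real.exp (-(c * Real.exp r)) : ℝ)) := by
  refine (integrable_exp_mul_exp_neg_exp hp hc).mono' (by fun_prop) (Eventually.of_forall fun r ↦ ?_)
  rw [norm_mul, norm_cexp_mul_ofReal, Complex.norm_real, Real.norm_of_nonneg (Real.exp_pos _).le]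

/-- Euler's integral with `t = e^r`. Powers of positive reals are written as exponentials of real
logarithms throughout, so that no branch of a complex power intervenes. -/
theorem integral_cexp_mul_exp_neg_exp {p : ℂ} {c : ℝ} (hp : 0 < p.re) (hc : 0 < c) :
    ∫ r : ℝ, Complex.exp (p * r) * (Real.exp (-(c * Real.exp r)) : ℝ) =
      Complex.exp (-(p * Real.log c)) * Complex.Gamma p := by
  have h := Complex.integral_cpow_mul_exp_neg_mul_Ioi hp hc
  rw [← integral_exp_smul_comp_exp] at h
  have h2 : (1 / (c : ℂ)) ^ p = Complex.exp (-(p * Real.log c)) := by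
    rw [Complex.cpow_def_of_ne_zero (by simp [hc.ne']), one_div, ← Complex.ofReal_inv,
      ← Complex.ofReal_log (by positivity), Real.log_inv]
    push_cast; ring_nf
  rw [← h2, ← h]
  refine integral_congr_ae (Eventually.of_forall fun r ↦ ?_)
  simp only [Complex.real_smul]
  rw [Complex.cpow_def_of_ne_zero (by simp), ← Complex.ofReal_log (Real.exp_pos r).le,
    Real.log_exp, Complex.ofReal_exp, Complex.ofReal_exp, ← mul_assoc]
  push_cast
  rw [← Complex.exp_add, ← Complex.exp_add, ← Complex.exp_add]
  congr 1; ring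

theorem integral_exp_mul_exp_neg_exp {σ c : ℝ} (hσ : 0 < σ) (hc : 0 < c) :
    ∫ r : ℝ, Real.exp (σ * r) * Real.exp (-(c * Real.exp r)) =
      Real.exp (-(σ * Real.log c)) * Real.Gamma σ := by
  have h := integral_cexp_mul_exp_neg_exp (p := σ) (by simpa using hσ) hc
  rw [Complex.Gamma_ofReal] at h
  exact_mod_cast h

theorem exp_abs_le_two_mul_cosh (u : ℝ) : Real.exp |u| ≤ 2 * Real.cosh u := by
  rw [← Real.cosh_abs, Real.cosh_eq]
  have := Real.exp_pos (-|u|)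
  linarith

theorem abs_sub_log_two_le_log_cosh (u : ℝ) : |u| - Real.log 2 ≤ Real.log (Real.cosh u) := by
  have h := Real.log_le_log (Real.exp_pos _) (exp_abs_le_two_mul_cosh u)
  rw [Real.log_exp, Real.log_mul two_ne_zero (Real.cosh_pos u).ne'] at h
  linarith

/-- From `cosh u ≥ e^|u|/2`. This bound is the source of the strip `|Re ν| < Re p` in which all the
transforms converge. -/
theorem exp_mul_exp_neg_mul_log_cosh_le {s q : ℝ} (hq : 0 ≤ q) (u : ℝ) :
    Real.exp (s * u) * Real.exp (-(q * Real.log (Real.cosh u))) ≤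
      Real.exp (q * Real.log 2) * Real.exp (-((q - |s|) * |u|)) := by
  rw [← Real.exp_add, ← Real.exp_add]
  apply Real.exp_le_exp.2
  have h1 : s * u ≤ |s| * |u| := by rw [← abs_mul]; exact le_abs_self _
  nlinarith [mul_le_mul_of_nonneg_left (abs_sub_log_two_le_log_cosh u) hq]

@[fun_prop]
theorem continuous_log_cosh : Continuous fun u : ℝ ↦ Real.log (Real.cosh u) :=
  Real.continuous_cosh.log fun u ↦ (Real.cosh_pos u).ne'

theorem integrable_exp_mul_exp_neg_mul_log_cosh {s q : ℝ} (h : |s| < q) :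
    Integrable (fun u : ℝ ↦ Real.exp (s * u) * Real.exp (-(q * Real.log (Real.cosh u)))) := by
  refine ((integrable_exp_neg_mul_abs (sub_pos.2 h)).const_mul (Real.exp (q * Real.log 2))).mono'
    (by fun_prop) (Eventually.of_forall fun u ↦ ?_)
  rw [Real.norm_of_nonneg (by positivity)]
  exact exp_mul_exp_neg_mul_log_cosh_le ((abs_nonneg s).trans h.le) u

theorem norm_cexp_mul_cexp_neg_mul_ofReal (ν p : ℂ) (u v : ℝ) :
    ‖Complex.exp (ν * u) * Complex.exp (-(p * v))‖ =
      Real.exp (ν.re * u) * Real.exp (-(p.re * v)) := by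
  rw [norm_mul, norm_cexp_mul_ofReal, ← neg_mul, norm_cexp_mul_ofReal]
  simp

theorem log_one_add_exp_two_mul (s : ℝ) :
    Real.log (1 + Real.exp (2 * s)) = Real.log 2 + s + Real.log (Real.cosh s) := by
  rw [show 1 + Real.exp (2 * s) = 2 * Real.exp s * Real.cosh s by
      rw [Real.cosh_eq, two_mul, Real.exp_add]
      have : Real.exp s * Real.exp (-s) = 1 := by rw [← Real.exp_add]; simp
      linear_combination -this,
    Real.log_mul (by positivity) (Real.cosh_pos s).ne', Real.log_mul two_ne_zero (by positivity),
    Real.log_exp]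

/-- The beta integral in hyperbolic form. -/
theorem integral_cexp_mul_cexp_neg_mul_log_cosh {ν p : ℂ} (h : |ν.re| < p.re) :
    Complex.Gamma p * ∫ u : ℝ, Complex.exp (ν * u) * Complex.exp (-(p * Real.log (Real.cosh u))) =
      Complex.exp ((p - 1) * Real.log 2) *
        (Complex.Gamma ((p + ν) / 2) * Complex.Gamma ((p - ν) / 2)) := by
  obtain ⟨h1, h2⟩ := abs_lt.1 h
  have hp : 0 < p.re := (abs_nonneg _).trans_lt h
  set α := (p - ν) / 2 with hα
  set β := (p + ν) / 2 with hβ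
  have hα0 : 0 < α.re := by simp [hα]; linarith
  have hβ0 : 0 < β.re := by simp [hβ]; linarith
  have hαβ : α + β = p := by rw [hα, hβ]; ring
  have hg : ∀ {q : ℂ}, 0 < q.re →
      ∫ r : ℝ, Complex.exp (q * r) * (Real.exp (-Real.exp r) : ℝ) = Complex.Gamma q := by
    intro q hq
    simpa using integral_cexp_mul_exp_neg_exp hq one_pos
  -- A double integral computed in both orders. The `x`-integral gives `Γ(p) (1+e^(2s))^(-p)`, which
  -- is a power of `cosh s` times an exponential. In the other order, the substitution `y = 2s + x`
  -- separates the variables because `α + β = p`, and yields `Γ(α) Γ(β) / 2`.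
  set K : ℝ → ℝ → ℂ := fun s x ↦ Complex.exp (2 * β * s) *
    (Complex.exp (p * x) * (Real.exp (-((1 + Real.exp (2 * s)) * Real.exp x)) : ℝ)) with hK
  have hpos : ∀ s : ℝ, 0 < 1 + Real.exp (2 * s) := fun s ↦ by positivity
  have hin : ∀ s : ℝ, ∫ x : ℝ, K s x = Complex.exp (2 * β * s) *
      (Complex.exp (-(p * Real.log (1 + Real.exp (2 * s)))) * Complex.Gamma p) := by
    intro s
    rw [hK]
    simp only
    rw [integral_const_mul, integral_cexp_mul_exp_neg_exp hp (hpos s)]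
  have hout : ∀ s : ℝ, Complex.exp (2 * β * s) *
      (Complex.exp (-(p * Real.log (1 + Real.exp (2 * s)))) * Complex.Gamma p) =
      Complex.exp (-(p * Real.log 2)) * Complex.Gamma p *
        (Complex.exp (ν * s) * Complex.exp (-(p * Real.log (Real.cosh s)))) := by
    intro s
    rw [log_one_add_exp_two_mul]
    have : Complex.exp (2 * β * s) *
        Complex.exp (-(p * ((Real.log 2 + s + Real.log (Real.cosh s) : ℝ) : ℂ))) =
        Complex.exp (-(p * Real.log 2)) *
        (Complex.exp (ν * s) * Complex.exp (-(p * Real.log (Real.cosh s)))) := by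
      rw [← Complex.exp_add, ← Complex.exp_add, ← Complex.exp_add]
      congr 1; push_cast; rw [hβ]; ring
    linear_combination Complex.Gamma p * this
  have hintK : Integrable (Function.uncurry K) (volume.prod volume) := by
    rw [integrable_prod_iff (by rw [hK]; fun_prop)]
    refine ⟨Eventually.of_forall fun s ↦ ?_, ?_⟩
    · simpa only [Function.uncurry, hK] using
        (integrable_cexp_mul_exp_neg_exp hp (hpos s)).const_mul (Complex.exp (2 * β * s))
    · have : ∀ s : ℝ, ∫ x : ℝ, ‖Function.uncurry K (s, x)‖ = Real.exp (-(p.re * Real.log 2)) *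
          Real.Gamma p.re * (Real.exp (ν.re * s) * Real.exp (-(p.re * Real.log (Real.cosh s)))) := by
        intro s
        have e1 : ∀ x : ℝ, ‖Function.uncurry K (s, x)‖ = Real.exp (2 * β.re * s) *
            (Real.exp (p.re * x) * Real.exp (-((1 + Real.exp (2 * s)) * Real.exp x))) := by
          intro x
          simp only [Function.uncurry, hK, norm_mul, norm_cexp_mul_ofReal, Complex.norm_real,
            Real.norm_of_nonneg (Real.exp_pos _).le]
          simp
        simp_rw [e1]
        rw [integral_const_mul, integral_exp_mul_exp_neg_exp hp (hpos s), log_one_add_exp_two_mul]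
        have : Real.exp (2 * β.re * s) *
            Real.exp (-(p.re * (Real.log 2 + s + Real.log (Real.cosh s)))) =
            Real.exp (-(p.re * Real.log 2)) *
            (Real.exp (ν.re * s) * Real.exp (-(p.re * Real.log (Real.cosh s)))) := by
          rw [← Real.exp_add, ← Real.exp_add, ← Real.exp_add]
          congr 1; simp [hβ]; ring
        linear_combination Real.Gamma p.re * this
      simp_rw [this]
      exact (integrable_exp_mul_exp_neg_mul_log_cosh h).const_mul _
  have hswap := integral_integral_swap hintK
  simp_rw [hin, hout] at hswap
  rw [integral_const_mul] at hswap
  have hinner : ∀ x : ℝ, ∫ s : ℝ, K s x =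
      Complex.exp (α * x) * (Real.exp (-Real.exp x) : ℝ) * (2⁻¹ * Complex.Gamma β) := by
    intro x
    have e1 : ∀ s : ℝ, K s x = Complex.exp (α * x) * (Real.exp (-Real.exp x) : ℝ) *
        (fun y : ℝ ↦ Complex.exp (β * y) * (Real.exp (-Real.exp y) : ℝ)) (2 * s + x) := by
      intro s
      simp only [hK]
      have e2 : Real.exp (-((1 + Real.exp (2 * s)) * Real.exp x)) =
          Real.exp (-Real.exp x) * Real.exp (-Real.exp (2 * s + x)) := by
        rw [← Real.exp_add, Real.exp_add (2 * s)]; ring_nf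
      have e3 : Complex.exp (2 * β * s) * Complex.exp (p * x) =
          Complex.exp (α * x) * Complex.exp (β * ((2 * s + x : ℝ) : ℂ)) := by
        rw [← Complex.exp_add, ← Complex.exp_add, ← hαβ]; congr 1; push_cast; ring
      rw [e2, Complex.ofReal_mul, ← mul_assoc, e3]; ring
    simp_rw [e1]
    rw [integral_const_mul]
    congr 1
    rw [← hg hβ0]
    have e4 := Measure.integral_comp_mul_left
      (fun s : ℝ ↦ (fun y : ℝ ↦ Complex.exp (β * y) * (Real.exp (-Real.exp y) : ℝ)) (s + x)) 2
    rw [e4, integral_add_right_eq_self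
      (fun y : ℝ ↦ Complex.exp (β * y) * (Real.exp (-Real.exp y) : ℝ))]
    simp
  simp_rw [hinner] at hswap
  rw [integral_mul_const, hg hα0] at hswap
  have e5 : Complex.exp (p * Real.log 2) * Complex.exp (-(p * Real.log 2)) = 1 := by
    rw [← Complex.exp_add]; simp
  have e6 : Complex.exp ((p - 1) * Real.log 2) = Complex.exp (p * Real.log 2) * 2⁻¹ := by
    rw [sub_mul, one_mul, Complex.exp_sub, ← Complex.ofReal_exp, Real.exp_log two_pos]
    push_cast; ring
  rw [e6]
  linear_combination Complex.exp (p * Real.log 2) * hswap -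
    Complex.Gamma p * (∫ u : ℝ, Complex.exp (ν * u) * Complex.exp (-(p * Real.log (Real.cosh u)))) * e5

theorem inv_one_add_exp_two_mul (r : ℝ) :
    (1 + Real.exp (2 * r))⁻¹ = 2⁻¹ * (Real.exp (-r) * Real.exp (-(1 * Real.log (Real.cosh r)))) := by
  rw [← Real.exp_log (show 0 < 1 + Real.exp (2 * r) by positivity), ← Real.exp_neg,
    log_one_add_exp_two_mul, ← Real.exp_add,
    show -(Real.log 2 + r + Real.log (Real.cosh r)) =
      -Real.log 2 + (-r + -(1 * Real.log (Real.cosh r))) by ring, Real.exp_add, Real.exp_neg,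
    Real.exp_log two_pos]

theorem integrable_exp_mul_inv_one_add_exp {σ : ℝ} (h0 : 0 < σ) (h2 : σ < 2) :
    Integrable (fun r : ℝ ↦ Real.exp (σ * r) * (1 + Real.exp (2 * r))⁻¹) := by
  have h := (integrable_exp_mul_exp_neg_mul_log_cosh (s := σ - 1) (q := 1)
    (abs_lt.2 ⟨by linarith, by linarith⟩)).const_mul 2⁻¹
  refine h.congr (Eventually.of_forall fun r ↦ ?_)
  simp only
  rw [inv_one_add_exp_two_mul, mul_left_comm (Real.exp (σ * r)), ← mul_assoc (Real.exp (σ * r)),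
    ← Real.exp_add (σ * r)]
  ring_nf

/-- The beta integral with `p = 1`, `ν = q - 1`, where the product of Gammas collapses by the
reflection formula. -/
theorem integral_cexp_mul_inv_one_add_exp {q : ℂ} (h0 : 0 < q.re) (h2 : q.re < 2) :
    ∫ r : ℝ, Complex.exp (q * r) * ((1 + Real.exp (2 * r))⁻¹ : ℝ) =
      Real.pi / (2 * Complex.sin (Real.pi * (q / 2))) := by
  have h := integral_cexp_mul_cexp_neg_mul_log_cosh (ν := q - 1) (p := 1)
    (by simpa using abs_lt.2 ⟨by linarith, by linarith⟩)
  rw [show (1 + (q - 1)) / 2 = q / 2 by ring, show (1 - (q - 1)) / 2 = 1 - q / 2 by ring,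
    Complex.Gamma_mul_Gamma_one_sub, Complex.Gamma_one, sub_self, zero_mul, Complex.exp_zero,
    one_mul, one_mul] at h
  have e : ∀ r : ℝ, Complex.exp (q * r) * ((1 + Real.exp (2 * r))⁻¹ : ℝ) = 2⁻¹ *
      (Complex.exp ((q - 1) * r) * Complex.exp (-(1 * Real.log (Real.cosh r)))) := by
    intro r
    have e1 : Complex.exp ((q - 1) * r) = Complex.exp (q * r) * Complex.exp (-r) := by
      rw [← Complex.exp_add]; ring_nf
    rw [inv_one_add_exp_two_mul, e1]
    push_cast
    ring
  simp_rw [e]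
  rw [integral_const_mul, h]
  field_simp

/-! ### The function `G_p` and its Euler derivatives -/

/-- The Laplace-type integral `∫₀^∞ t^(p-1) e^(-ct) / (1 + t²) dt`, with `t = e^r`. -/
noncomputable def laplaceG (p : ℂ) (c : ℝ) : ℂ :=
  ∫ r : ℝ, Complex.exp (p * r) *
    ((1 + Real.exp (2 * r))⁻¹ * Real.exp (-(c * Real.exp r)) : ℝ)

@[fun_prop]
theorem continuous_inv_one_add_exp : Continuous fun r : ℝ ↦ (1 + Real.exp (2 * r))⁻¹ :=
  (by fun_prop : Continuous fun r : ℝ ↦ 1 + Real.exp (2 * r)).inv₀ fun r ↦ by positivity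

theorem inv_one_add_exp_pos (r : ℝ) : 0 < (1 + Real.exp (2 * r))⁻¹ := by positivity

theorem inv_one_add_exp_le_one (r : ℝ) : (1 + Real.exp (2 * r))⁻¹ ≤ 1 :=
  inv_le_one_of_one_le₀ (by linarith [Real.exp_pos (2 * r)])

theorem norm_laplaceG_integrand (p : ℂ) (c r : ℝ) :
    ‖Complex.exp (p * r) * ((1 + Real.exp (2 * r))⁻¹ * Real.exp (-(c * Real.exp r)) : ℝ)‖ =
      Real.exp (p.re * r) * ((1 + Real.exp (2 * r))⁻¹ * Real.exp (-(c * Real.exp r))) := by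
  rw [norm_mul, norm_cexp_mul_ofReal, Complex.norm_real, Real.norm_of_nonneg (by positivity)]

theorem integrable_laplaceG_integrand {p : ℂ} {c : ℝ} (hp : 0 < p.re) (hc : 0 < c) :
    Integrable fun r : ℝ ↦ Complex.exp (p * r) *
      ((1 + Real.exp (2 * r))⁻¹ * Real.exp (-(c * Real.exp r)) : ℝ) := by
  refine (integrable_exp_mul_exp_neg_exp hp hc).mono' (by fun_prop)
    (Eventually.of_forall fun r ↦ ?_)
  rw [norm_laplaceG_integrand]
  gcongr
  exact mul_le_of_le_one_left (Real.exp_pos _).le (inv_one_add_exp_le_one r)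

theorem norm_laplaceG_le {p : ℂ} {c : ℝ} (hp : 0 < p.re) (hc : 0 < c) :
    ‖laplaceG p c‖ ≤ Real.Gamma p.re * Real.exp (-(p.re * Real.log c)) := by
  rw [mul_comm, ← integral_exp_mul_exp_neg_exp hp hc]
  refine norm_integral_le_of_norm_le (integrable_exp_mul_exp_neg_exp hp hc)
    (Eventually.of_forall fun r ↦ ?_)
  rw [norm_laplaceG_integrand]
  gcongr
  exact mul_le_of_le_one_left (Real.exp_pos _).le (inv_one_add_exp_le_one r)

/-- The factor `1 + t²` cancels the denominator. This relation produces the inhomogeneous term of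
the Bessel equation. -/
theorem laplaceG_add_two {p : ℂ} {c : ℝ} (hp : 0 < p.re) (hc : 0 < c) :
    laplaceG p c + laplaceG (p + 2) c = Complex.exp (-(p * Real.log c)) * Complex.Gamma p := by
  rw [← integral_cexp_mul_exp_neg_exp hp hc, laplaceG, laplaceG,
    ← integral_add (integrable_laplaceG_integrand hp hc)
      (integrable_laplaceG_integrand (by simp; linarith) hc)]
  refine integral_congr_ae (Eventually.of_forall fun r ↦ ?_)
  simp only
  have h1 : Complex.exp ((p + 2) * r) = Complex.exp (p * r) * (Real.exp (2 * r) : ℝ) := by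
    rw [add_mul, Complex.exp_add]; push_cast; rfl
  have h2 : ((1 + Real.exp (2 * r) : ℝ) : ℂ) ≠ 0 := by
    exact_mod_cast (by positivity : (1 + Real.exp (2 * r)) ≠ 0)
  rw [h1, Complex.ofReal_mul, Complex.ofReal_inv]
  field_simp
  push_cast
  ring

theorem hasDerivAt_laplaceG {p : ℂ} {c : ℝ} (hp : 0 < p.re) (hc : 0 < c) :
    HasDerivAt (laplaceG p) (-laplaceG (p + 1) c) c := by
  have hc2 : 0 < c / 2 := by positivity
  have hp1 : 0 < (p + 1).re := by simp; linarith
  have key := (hasDerivAt_integral_of_dominated_loc_of_deriv_le (μ := volume)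
    (F := fun (x r : ℝ) ↦ Complex.exp (p * r) *
      ((1 + Real.exp (2 * r))⁻¹ * Real.exp (-(x * Real.exp r)) : ℝ))
    (F' := fun (x r : ℝ) ↦ -(Complex.exp ((p + 1) * r) *
      ((1 + Real.exp (2 * r))⁻¹ * Real.exp (-(x * Real.exp r)) : ℝ)))
    (bound := fun r ↦ Real.exp ((p + 1).re * r) * Real.exp (-(c / 2 * Real.exp r)))
    (x₀ := c) (s := Ioi (c / 2)) (Ioi_mem_nhds (by linarith))
    (Eventually.of_forall fun x ↦ by fun_prop) (integrable_laplaceG_integrand hp hc)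
    (by fun_prop) (Eventually.of_forall fun r x hx ↦ ?_)
    (integrable_exp_mul_exp_neg_exp hp1 hc2) (Eventually.of_forall fun r x hx ↦ ?_)).2
  · rw [integral_neg] at key
    exact key
  · rw [norm_neg, norm_laplaceG_integrand]
    have : Real.exp (-(x * Real.exp r)) ≤ Real.exp (-(c / 2 * Real.exp r)) := by
      gcongr; exact (mem_Ioi.1 hx).le
    exact mul_le_mul_of_nonneg_left ((mul_le_of_le_one_left (Real.exp_pos _).le
      (inv_one_add_exp_le_one r)).trans this) (Real.exp_pos _).le
  · have h1 : HasDerivAt (fun x : ℝ ↦ Real.exp (-(x * Real.exp r)))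
        (Real.exp (-(x * Real.exp r)) * -(1 * Real.exp r)) x :=
      (((hasDerivAt_id x).mul_const _).neg).exp
    have h2 := ((h1.const_mul ((1 + Real.exp (2 * r))⁻¹)).ofReal_comp).const_mul
      (Complex.exp (p * r))
    refine h2.congr_deriv ?_
    rw [add_mul, Complex.exp_add, one_mul]
    push_cast
    ring_nf

theorem continuousOn_laplaceG {p : ℂ} (hp : 0 < p.re) : ContinuousOn (laplaceG p) (Ioi 0) :=
  fun _ hc ↦ (hasDerivAt_laplaceG hp hc).continuousAt.continuousWithinAt

/-- The functions `c^k G_(p+k)(c)`, which span the Euler derivatives of `G_p`. -/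
noncomputable def eulerG (p : ℂ) (k : ℕ) (c : ℝ) : ℂ := (c : ℂ) ^ k * laplaceG (p + k) c

theorem continuousOn_eulerG {p : ℂ} (hp : 0 < p.re) (k : ℕ) :
    ContinuousOn (eulerG p k) (Ioi 0) := by
  refine ContinuousOn.mul (by fun_prop) (continuousOn_laplaceG ?_)
  simp; positivity

theorem eulerG_zero (p : ℂ) : eulerG p 0 = laplaceG p := by
  ext c; simp [eulerG]

theorem hasDerivAt_eulerG {p : ℂ} {c : ℝ} (hp : 0 < p.re) (hc : 0 < c) (k : ℕ) :
    HasDerivAt (eulerG p k) ((k * eulerG p k c - eulerG p (k + 1) c) / c) c := by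
  have hc' : (c : ℂ) ≠ 0 := by exact_mod_cast hc.ne'
  have h1 : HasDerivAt (fun x : ℝ ↦ (x : ℂ) ^ k) (k * (c : ℂ) ^ (k - 1)) c := by
    simpa using (hasDerivAt_pow k (c : ℂ)).comp_ofReal
  have h2 : HasDerivAt (laplaceG (p + k)) (-laplaceG (p + k + 1) c) c :=
    hasDerivAt_laplaceG (by simp; positivity) hc
  refine (h1.mul h2).congr_deriv ?_
  simp only [eulerG]
  rw [eq_div_iff hc']
  push_cast
  rw [← add_assoc]
  cases k with
  | zero => simp; ring
  | succ n => simp only [Nat.add_sub_cancel]; push_cast; ring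

/-- The factor `c^k` exactly compensates the faster decay of `G_(p+k)`, so all Euler derivatives
share the decay `c^(-p)`, hence the same strip of convergence. -/
theorem norm_eulerG_le {p : ℂ} {c : ℝ} (hp : 0 < p.re) (hc : 0 < c) (k : ℕ) :
    ‖eulerG p k c‖ ≤ Real.Gamma (p.re + k) * Real.exp (-(p.re * Real.log c)) := by
  have h := norm_laplaceG_le (p := p + k) (by simp; positivity) hc
  have e : c ^ k = Real.exp (k * Real.log c) := by
    rw [mul_comm, Real.exp_mul, Real.exp_log hc, Real.rpow_natCast]
  rw [eulerG, norm_mul, norm_pow, Complex.norm_real, Real.norm_of_nonneg hc.le]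
  calc c ^ k * ‖laplaceG (p + k) c‖ ≤
        c ^ k * (Real.Gamma (p + k).re * Real.exp (-((p + k).re * Real.log c))) := by gcongr
    _ = _ := by
      rw [e, mul_left_comm, ← Real.exp_add, Complex.add_re, Complex.natCast_re]
      congr 2
      ring

theorem pow_mul_exp_neg_le_factorial {x : ℝ} (hx : 0 ≤ x) (k : ℕ) :
    x ^ k * Real.exp (-x) ≤ k.factorial := by
  rw [Real.exp_neg, ← div_eq_mul_inv, div_le_iff₀ (Real.exp_pos _), ← div_le_iff₀' (by positivity)]
  exact Real.pow_div_factorial_le_exp x hx k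

/-- Bounding `(ct)^k e^(-ct)` by `k!` leaves `c ∫ t^p / (1+t²) dt`, which converges for `p.re < 1`.
`G_p` itself need not vanish at `0`, which is why the behaviour at the origin is studied on its
Euler derivatives. -/
theorem exists_norm_eulerG_succ_le_mul {p : ℂ} (hp : 0 < p.re) (hp1 : p.re < 1) (k : ℕ) :
    ∃ C, 0 < C ∧ ∀ c > 0, ‖eulerG p (k + 1) c‖ ≤ C * c := by
  have hint := integrable_exp_mul_inv_one_add_exp (σ := p.re + 1) (by linarith) (by linarith)
  set I := ∫ r : ℝ, Real.exp ((p.re + 1) * r) * (1 + Real.exp (2 * r))⁻¹ with hI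
  have hI0 : 0 ≤ I := integral_nonneg fun r ↦ by positivity
  refine ⟨k.factorial * I + 1, by positivity, fun c hc ↦ ?_⟩
  have hle : ‖eulerG p (k + 1) c‖ ≤ (k.factorial * I) * c := by
    rw [eulerG, laplaceG, ← integral_const_mul, hI, ← integral_const_mul, ← integral_mul_const]
    refine norm_integral_le_of_norm_le ((hint.const_mul _).mul_const _)
      (Eventually.of_forall fun r ↦ ?_)
    rw [norm_mul, norm_laplaceG_integrand, norm_pow, Complex.norm_real, Real.norm_of_nonneg hc.le]
    have h1 := pow_mul_exp_neg_le_factorial (x := c * Real.exp r) (by positivity) k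
    have h2 : Real.exp ((p + ((k + 1 : ℕ) : ℂ)).re * r) =
        Real.exp ((p.re + 1) * r) * Real.exp r ^ k := by
      rw [← Real.exp_nat_mul, ← Real.exp_add]; simp; ring
    rw [h2]
    calc c ^ (k + 1) * (Real.exp ((p.re + 1) * r) * Real.exp r ^ k *
          ((1 + Real.exp (2 * r))⁻¹ * Real.exp (-(c * Real.exp r)))) =
          ((c * Real.exp r) ^ k * Real.exp (-(c * Real.exp r))) *
            (Real.exp ((p.re + 1) * r) * (1 + Real.exp (2 * r))⁻¹) * c := by ring
      _ ≤ _ := by gcongr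
  exact hle.trans (by nlinarith)

/-! ### The cosh transform and its Bessel equation -/

/-- The integral transform `∫ e^(νu) g(e^τ cosh u) du`. -/
noncomputable def coshTransform (ν : ℂ) (g : ℝ → ℂ) (τ : ℝ) : ℂ :=
  ∫ u : ℝ, Complex.exp (ν * u) * g (Real.exp τ * Real.cosh u)

theorem integrable_cexp_mul_of_norm_le {ν : ℂ} {q C : ℝ} {h : ℝ → ℂ} (hq : |ν.re| < q)
    (hm : AEStronglyMeasurable h volume)
    (hle : ∀ u, ‖h u‖ ≤ C * Real.exp (-(q * Real.log (Real.cosh u)))) :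
    Integrable fun u : ℝ ↦ Complex.exp (ν * u) * h u := by
  refine ((integrable_exp_mul_exp_neg_mul_log_cosh hq).const_mul C).mono'
    (by fun_prop) (Eventually.of_forall fun u ↦ ?_)
  rw [norm_mul, norm_cexp_mul_ofReal, mul_left_comm]
  gcongr
  exact hle u

theorem continuous_comp_exp_mul_cosh {g : ℝ → ℂ} (hg : ContinuousOn g (Ioi 0)) (τ : ℝ) :
    Continuous fun u ↦ g (Real.exp τ * Real.cosh u) :=
  hg.comp_continuous (by fun_prop) fun u ↦ mul_pos (Real.exp_pos _) (Real.cosh_pos u)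

theorem log_exp_mul_cosh (τ u : ℝ) :
    Real.log (Real.exp τ * Real.cosh u) = τ + Real.log (Real.cosh u) := by
  rw [Real.log_mul (Real.exp_pos _).ne' (Real.cosh_pos u).ne', Real.log_exp]

theorem norm_comp_exp_mul_cosh_le {g : ℝ → ℂ} {C q : ℝ}
    (hg : ∀ c > 0, ‖g c‖ ≤ C * Real.exp (-(q * Real.log c))) (τ u : ℝ) :
    ‖g (Real.exp τ * Real.cosh u)‖ ≤
      C * Real.exp (-(q * τ)) * Real.exp (-(q * Real.log (Real.cosh u))) := by
  refine (hg _ (mul_pos (Real.exp_pos _) (Real.cosh_pos u))).trans_eq ?_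
  rw [log_exp_mul_cosh, mul_assoc, ← Real.exp_add]
  ring_nf

theorem integrable_coshTransform {ν : ℂ} {g : ℝ → ℂ} {C q : ℝ} (hq : |ν.re| < q)
    (hc : ContinuousOn g (Ioi 0)) (hg : ∀ c > 0, ‖g c‖ ≤ C * Real.exp (-(q * Real.log c)))
    (τ : ℝ) : Integrable fun u : ℝ ↦ Complex.exp (ν * u) * g (Real.exp τ * Real.cosh u) :=
  integrable_cexp_mul_of_norm_le hq (continuous_comp_exp_mul_cosh hc τ).aestronglyMeasurable
    (norm_comp_exp_mul_cosh_le hg τ)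

/-- Since `τ` enters as a dilation of the argument, `d/dτ` acts on `g` as the Euler operator `c
d/dc`; hence the form `g' c / c` of the hypothesis. -/
theorem hasDerivAt_coshTransform {ν : ℂ} {g g' : ℝ → ℂ} {C q : ℝ} (hq : |ν.re| < q)
    (hd : ∀ c > 0, HasDerivAt g (g' c / c) c) (hc' : ContinuousOn g' (Ioi 0))
    (hg : ∀ c > 0, ‖g c‖ ≤ C * Real.exp (-(q * Real.log c)))
    (hg' : ∀ c > 0, ‖g' c‖ ≤ C * Real.exp (-(q * Real.log c))) (τ : ℝ) :
    HasDerivAt (coshTransform ν g) (coshTransform ν g' τ) τ := by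
  have hc : ContinuousOn g (Ioi 0) := fun c h ↦ (hd c h).continuousAt.continuousWithinAt
  have hq0 : 0 < q := (abs_nonneg _).trans_lt hq
  have hC : 0 ≤ C := by
    have := (norm_nonneg _).trans (hg 1 one_pos)
    simpa using this
  refine (hasDerivAt_integral_of_dominated_loc_of_deriv_le (μ := volume)
    (F := fun (x u : ℝ) ↦ Complex.exp (ν * u) * g (Real.exp x * Real.cosh u))
    (F' := fun (x u : ℝ) ↦ Complex.exp (ν * u) * g' (Real.exp x * Real.cosh u))
    (bound := fun u ↦ C * Real.exp (-(q * (τ - 1))) *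
      (Real.exp (ν.re * u) * Real.exp (-(q * Real.log (Real.cosh u)))))
    (x₀ := τ) (s := Ioi (τ - 1)) (Ioi_mem_nhds (by linarith))
    (Eventually.of_forall fun x ↦ (integrable_coshTransform hq hc hg x).aestronglyMeasurable)
    (integrable_coshTransform hq hc hg τ)
    (integrable_coshTransform hq hc' hg' τ).aestronglyMeasurable
    (Eventually.of_forall fun u x hx ↦ ?_)
    ((integrable_exp_mul_exp_neg_mul_log_cosh hq).const_mul _)
    (Eventually.of_forall fun u x hx ↦ ?_)).2
  · rw [norm_mul, norm_cexp_mul_ofReal, mul_left_comm]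
    gcongr
    refine (norm_comp_exp_mul_cosh_le hg' x u).trans ?_
    gcongr
    exact (mem_Ioi.1 hx).le
  · have hpos : 0 < Real.exp x * Real.cosh u := mul_pos (Real.exp_pos _) (Real.cosh_pos u)
    have h1 : HasDerivAt (fun x ↦ Real.exp x * Real.cosh u) (Real.exp x * Real.cosh u) x :=
      (Real.hasDerivAt_exp x).mul_const _
    have h2 := HasDerivAt.scomp x (hd _ hpos) h1
    refine (h2.const_mul (Complex.exp (ν * u))).congr_deriv ?_
    rw [Complex.real_smul, mul_div_cancel₀]
    exact_mod_cast hpos.ne'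

theorem integral_cexp_mul_deriv_eq {ν : ℂ} {h h' : ℝ → ℂ} (hd : ∀ u, HasDerivAt h (h' u) u)
    (hi : Integrable fun u : ℝ ↦ Complex.exp (ν * u) * h u)
    (hi' : Integrable fun u : ℝ ↦ Complex.exp (ν * u) * h' u) :
    ∫ u : ℝ, Complex.exp (ν * u) * h' u = -(ν * ∫ u : ℝ, Complex.exp (ν * u) * h u) := by
  have he : ∀ u : ℝ, HasDerivAt (fun u : ℝ ↦ Complex.exp (ν * u)) (ν * Complex.exp (ν * u)) u := by
    intro u
    have : HasDerivAt (fun z : ℂ ↦ Complex.exp (ν * z)) (Complex.exp (ν * u) * (ν * 1)) u :=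
      ((hasDerivAt_id (u : ℂ)).const_mul ν).cexp
    exact this.comp_ofReal.congr_deriv (by ring)
  have key := integral_mul_deriv_eq_deriv_mul_of_integrable (fun u _ ↦ he u) (fun u _ ↦ hd u) hi'
    ((hi.const_mul ν).congr (Eventually.of_forall fun u ↦ by simp; ring)) hi
  rw [key, ← integral_const_mul]
  congr 2
  ext u
  ring

/-- Two integrations by parts in `u`: `h1` and `h2` are the first two `u`-derivatives of `G_p(e^τ
cosh u)`. It serves both the differential equation and the decay in `ν`. -/
theorem sq_mul_coshTransform_laplaceG {p ν : ℂ} (h : |ν.re| < p.re) (τ : ℝ) :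
    ν ^ 2 * coshTransform ν (laplaceG p) τ =
      ∫ u : ℝ, Complex.exp (ν * u) * (-eulerG p 1 (Real.exp τ * Real.cosh u) +
        (Real.exp τ * Real.sinh u : ℝ) ^ 2 * laplaceG (p + 2) (Real.exp τ * Real.cosh u)) := by
  have hp : 0 < p.re := (abs_nonneg _).trans_lt h
  have hp1 : 0 < (p + 1).re := by simp; linarith
  have hpos : ∀ u, 0 < Real.exp τ * Real.cosh u := fun u ↦
    mul_pos (Real.exp_pos _) (Real.cosh_pos u)
  have hch : ∀ u, HasDerivAt (fun u ↦ Real.exp τ * Real.cosh u) (Real.exp τ * Real.sinh u) u :=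
    fun u ↦ (Real.hasDerivAt_cosh u).const_mul _
  have hsh : ∀ u, HasDerivAt (fun u ↦ Real.exp τ * Real.sinh u) (Real.exp τ * Real.cosh u) u :=
    fun u ↦ (Real.hasDerivAt_sinh u).const_mul _
  have hlt : ∀ u, |Real.exp τ * Real.sinh u| ≤ Real.exp τ * Real.cosh u := by
    intro u
    rw [abs_mul, abs_of_pos (Real.exp_pos _)]
    gcongr
    rw [Real.abs_sinh, ← Real.cosh_abs]
    exact (Real.sinh_lt_cosh _).le
  set h1 : ℝ → ℂ := fun u ↦
    -((Real.exp τ * Real.sinh u : ℝ) * laplaceG (p + 1) (Real.exp τ * Real.cosh u)) with hh1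
  set h2 : ℝ → ℂ := fun u ↦ -eulerG p 1 (Real.exp τ * Real.cosh u) +
        (Real.exp τ * Real.sinh u : ℝ) ^ 2 * laplaceG (p + 2) (Real.exp τ * Real.cosh u) with hh2
  have hd0 : ∀ u, HasDerivAt (fun u ↦ laplaceG p (Real.exp τ * Real.cosh u)) (h1 u) u := by
    intro u
    refine (HasDerivAt.scomp u (hasDerivAt_laplaceG hp (hpos u)) (hch u)).congr_deriv ?_
    rw [hh1, Complex.real_smul]; ring
  have hd1 : ∀ u, HasDerivAt h1 (h2 u) u := by
    intro u
    have e1 := (hsh u).ofReal_comp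
    have e2 := HasDerivAt.scomp u (hasDerivAt_laplaceG hp1 (hpos u)) (hch u)
    refine (e1.mul e2).neg.congr_deriv ?_
    rw [hh2, Complex.real_smul]
    simp only [Function.comp, eulerG]
    rw [add_assoc p 1 1, one_add_one_eq_two]
    push_cast
    ring
  have hc2 : Continuous h2 := by
    have c1 := continuous_comp_exp_mul_cosh (continuousOn_eulerG hp 1) τ
    have c2 := continuous_comp_exp_mul_cosh
      (continuousOn_laplaceG (p := p + 2) (by simp; linarith)) τ
    exact c1.neg.add ((by fun_prop : Continuous fun u : ℝ ↦
      ((Real.exp τ * Real.sinh u : ℝ) : ℂ) ^ 2).mul c2)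
  have hb : ∀ k u, ‖eulerG p k (Real.exp τ * Real.cosh u)‖ ≤ _ := fun k u ↦
    norm_comp_exp_mul_cosh_le (fun c hc ↦ norm_eulerG_le hp hc k) τ u
  have i0 : Integrable fun u : ℝ ↦ Complex.exp (ν * u) * laplaceG p (Real.exp τ * Real.cosh u) :=
    integrable_coshTransform h (continuousOn_laplaceG hp) (fun c hc ↦ norm_laplaceG_le hp hc) τ
  have i1 : Integrable fun u : ℝ ↦ Complex.exp (ν * u) * h1 u := by
    refine integrable_cexp_mul_of_norm_le h
      (continuous_iff_continuousAt.2 fun u ↦ (hd1 u).continuousAt).aestronglyMeasurable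
      (fun u ↦ le_trans ?_ (hb 1 u))
    rw [hh1, norm_neg, eulerG, norm_mul, norm_mul, pow_one, Nat.cast_one, Complex.norm_real,
      Complex.norm_real, Real.norm_eq_abs, Real.norm_of_nonneg (hpos u).le]
    gcongr
    exact hlt u
  have i2 : Integrable fun u : ℝ ↦ Complex.exp (ν * u) * h2 u := by
    refine integrable_cexp_mul_of_norm_le h hc2.aestronglyMeasurable
      (fun u ↦ le_trans ?_ ((add_le_add (hb 1 u) (hb 2 u)).trans_eq (add_mul _ _ _).symm))
    refine (norm_add_le _ _).trans ?_
    rw [norm_neg]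
    gcongr
    rw [eulerG, norm_mul, norm_mul, norm_pow, norm_pow, Nat.cast_two, Complex.norm_real,
      Complex.norm_real, Real.norm_eq_abs, Real.norm_of_nonneg (hpos u).le]
    gcongr
    exact hlt u
  rw [coshTransform, integral_cexp_mul_deriv_eq hd1 i1 i2, integral_cexp_mul_deriv_eq hd0 i0 i1]
  ring

/-- On the imaginary axis `|e^(νu)| = 1`, so the bound does not depend on `ν`. The resulting
`O(ν⁻²)` decay makes the series of transforms converge. -/
theorem exists_norm_sq_mul_coshTransform_le {p : ℂ} (hp : 0 < p.re) (τ : ℝ) :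
    ∃ C, ∀ ν : ℂ, ν.re = 0 → ‖ν ^ 2 * coshTransform ν (laplaceG p) τ‖ ≤ C := by
  refine ⟨∫ u : ℝ, ‖-eulerG p 1 (Real.exp τ * Real.cosh u) +
    (Real.exp τ * Real.sinh u : ℝ) ^ 2 * laplaceG (p + 2) (Real.exp τ * Real.cosh u)‖,
    fun ν hν ↦ ?_⟩
  rw [sq_mul_coshTransform_laplaceG (by simpa [hν] using hp)]
  refine (norm_integral_le_integral_norm _).trans_eq ?_
  congr 1
  ext u
  rw [norm_mul, norm_cexp_mul_ofReal, hν, zero_mul, Real.exp_zero, one_mul]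

theorem hasDerivAt_coshTransform_laplaceG {p ν : ℂ} (h : |ν.re| < p.re) (τ : ℝ) :
    HasDerivAt (coshTransform ν (laplaceG p)) (-coshTransform ν (eulerG p 1) τ) τ := by
  have hp : 0 < p.re := (abs_nonneg _).trans_lt h
  have key := hasDerivAt_coshTransform h (g := laplaceG p) (g' := fun c ↦ -eulerG p 1 c)
    (C := max (Real.Gamma (p.re + (0 : ℕ))) (Real.Gamma (p.re + (1 : ℕ))))
    (fun c hc ↦ by simpa [eulerG_zero] using hasDerivAt_eulerG hp hc 0)
    (continuousOn_eulerG hp 1).neg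
    (fun c hc ↦ by
      rw [← eulerG_zero]
      refine (norm_eulerG_le hp hc 0).trans ?_
      gcongr; exact le_max_left _ _)
    (fun c hc ↦ by
      rw [norm_neg]
      refine (norm_eulerG_le hp hc 1).trans ?_
      gcongr; exact le_max_right _ _) τ
  refine key.congr_deriv ?_
  rw [coshTransform, coshTransform, ← integral_neg]
  congr 1
  ext u
  ring

theorem hasDerivAt_coshTransform_eulerG {p ν : ℂ} (h : |ν.re| < p.re) (k : ℕ) (τ : ℝ) :
    HasDerivAt (coshTransform ν (eulerG p k))
      (k * coshTransform ν (eulerG p k) τ - coshTransform ν (eulerG p (k + 1)) τ) τ := by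
  have hp : 0 < p.re := (abs_nonneg _).trans_lt h
  have hG0 : ∀ k : ℕ, 0 ≤ Real.Gamma (p.re + k) := fun k ↦
    (Real.Gamma_pos_of_pos (by positivity)).le
  have hint : ∀ k, Integrable fun u : ℝ ↦
      Complex.exp (ν * u) * eulerG p k (Real.exp τ * Real.cosh u) := fun k ↦
    integrable_coshTransform h (continuousOn_eulerG hp k) (fun c hc ↦ norm_eulerG_le hp hc k) τ
  have key := hasDerivAt_coshTransform h (g := eulerG p k)
    (g' := fun c ↦ k * eulerG p k c - eulerG p (k + 1) c)
    (C := (k + 1) * Real.Gamma (p.re + k) + Real.Gamma (p.re + (k + 1 : ℕ)))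
    (fun c hc ↦ hasDerivAt_eulerG hp hc k)
    ((continuousOn_const.mul (continuousOn_eulerG hp k)).sub (continuousOn_eulerG hp (k + 1)))
    (fun c hc ↦ by
      refine (norm_eulerG_le hp hc k).trans ?_
      gcongr
      nlinarith [hG0 k, hG0 (k + 1), mul_nonneg (Nat.cast_nonneg (α := ℝ) k) (hG0 k)])
    (fun c hc ↦ by
      refine (norm_sub_le _ _).trans ?_
      rw [norm_mul, Complex.norm_natCast, add_mul, add_mul (k : ℝ), add_mul, mul_assoc]
      have e1 := norm_eulerG_le hp hc k
      have e2 := norm_eulerG_le hp hc (k + 1)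
      have e3 := mul_le_mul_of_nonneg_left e1 (Nat.cast_nonneg (α := ℝ) k)
      have e4 := (norm_nonneg _).trans e1
      linarith) τ
  refine key.congr_deriv ?_
  rw [coshTransform, coshTransform, coshTransform, ← integral_const_mul,
    ← integral_sub ((hint k).const_mul _) (hint (k + 1))]
  congr 1
  ext u
  ring

/-- The inhomogeneous Bessel equation for the transform of `G_p`. -/
theorem coshTransform_eulerG_two_sub {p ν : ℂ} (h : |ν.re| < p.re) (τ : ℝ) :
    coshTransform ν (eulerG p 2) τ - coshTransform ν (eulerG p 1) τ =
      (ν ^ 2 - Complex.exp (2 * τ)) * coshTransform ν (laplaceG p) τ +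
        Complex.exp ((2 - p) * τ) * (Complex.exp ((p - 1) * Real.log 2) *
        (Complex.Gamma ((p + ν) / 2) * Complex.Gamma ((p - ν) / 2))) := by
  have hp : 0 < p.re := (abs_nonneg _).trans_lt h
  have hpos : ∀ u, 0 < Real.exp τ * Real.cosh u := fun u ↦
    mul_pos (Real.exp_pos _) (Real.cosh_pos u)
  have hint : ∀ k, Integrable fun u : ℝ ↦
      Complex.exp (ν * u) * eulerG p k (Real.exp τ * Real.cosh u) := fun k ↦
    integrable_coshTransform h (continuousOn_eulerG hp k) (fun c hc ↦ norm_eulerG_le hp hc k) τ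
  have hint0 : Integrable fun u : ℝ ↦
      Complex.exp (ν * u) * laplaceG p (Real.exp τ * Real.cosh u) := by
    simpa [eulerG_zero] using hint 0
  have hintc : Integrable fun u : ℝ ↦
      Complex.exp (ν * u) * Complex.exp (-(p * Real.log (Real.cosh u))) := by
    refine (integrable_exp_mul_exp_neg_mul_log_cosh h).mono' ?_ (Eventually.of_forall fun u ↦ ?_)
    · have : Continuous fun u : ℝ ↦ ((Real.log (Real.cosh u) : ℝ) : ℂ) :=
        Complex.continuous_ofReal.comp continuous_log_cosh
      fun_prop
    · rw [norm_cexp_mul_cexp_neg_mul_ofReal]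
  -- The left side is the second `τ`-derivative of the transform. Replacing `sinh²` by `cosh² - 1`
  -- and removing `G_(p+2)` by `laplaceG_add_two` leaves a pure power of `cosh u`, whose transform
  -- is the beta integral.
  have e0 := sq_mul_coshTransform_laplaceG h τ
  rw [← integral_cexp_mul_cexp_neg_mul_log_cosh h, sub_mul, e0]
  simp only [coshTransform]
  rw [← integral_const_mul (Complex.exp (2 * τ)), ← integral_const_mul (Complex.Gamma p),
    ← integral_const_mul (Complex.exp ((2 - p) * τ)), ← integral_sub (hint 2) (hint 1)]
  have hpt : ∀ u : ℝ, Complex.exp (ν * u) * (-eulerG p 1 (Real.exp τ * Real.cosh u) +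
        (Real.exp τ * Real.sinh u : ℝ) ^ 2 * laplaceG (p + 2) (Real.exp τ * Real.cosh u)) =
      (Complex.exp (ν * u) * eulerG p 2 (Real.exp τ * Real.cosh u) -
        Complex.exp (ν * u) * eulerG p 1 (Real.exp τ * Real.cosh u)) +
      (Complex.exp (2 * τ) * (Complex.exp (ν * u) * laplaceG p (Real.exp τ * Real.cosh u)) -
       Complex.exp ((2 - p) * τ) * (Complex.Gamma p * (Complex.exp (ν * u) *
        Complex.exp (-(p * Real.log (Real.cosh u)))))) := by
    intro u
    have e1 := laplaceG_add_two hp (hpos u)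
    rw [log_exp_mul_cosh] at e1
    have e2 : Complex.exp ((2 - p) * τ) * Complex.exp (-(p * Real.log (Real.cosh u))) =
        Complex.exp (2 * τ) *
          Complex.exp (-(p * ((τ + Real.log (Real.cosh u) : ℝ) : ℂ))) := by
      rw [← Complex.exp_add, ← Complex.exp_add]
      congr 1; push_cast; ring
    have e3 : ((Real.exp τ * Real.sinh u : ℝ) : ℂ) ^ 2 =
        ((Real.exp τ * Real.cosh u : ℝ) : ℂ) ^ 2 - Complex.exp (2 * τ) := by
      have : (Real.exp τ * Real.sinh u) ^ 2 =
          (Real.exp τ * Real.cosh u) ^ 2 - Real.exp (2 * τ) := by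
        rw [mul_pow, mul_pow, Real.cosh_sq, two_mul, Real.exp_add]; ring
      exact_mod_cast congrArg (Complex.ofReal) this
    have e4 : eulerG p 2 (Real.exp τ * Real.cosh u) =
        ((Real.exp τ * Real.cosh u : ℝ) : ℂ) ^ 2 * laplaceG (p + 2) (Real.exp τ * Real.cosh u) := by
      simp [eulerG]
    rw [e3, e4]
    linear_combination Complex.exp (ν * u) * Complex.Gamma p * e2 -
      Complex.exp (ν * u) * Complex.exp (2 * τ) * e1
  simp_rw [hpt]
  have i1 := hint0.const_mul (Complex.exp (2 * τ))
  have i2 := (hintc.const_mul (Complex.Gamma p)).const_mul (Complex.exp ((2 - p) * τ))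
  have k1 := integral_add ((hint 2).sub (hint 1)) (i1.sub i2)
  simp only [Pi.sub_apply] at k1
  rw [k1, integral_sub i1 i2]
  ring

/-! ### Holomorphy of the transform in `p` and `ν` -/

/-- Holomorphy of two-sided Laplace integrals in the exponent. -/
theorem differentiableAt_integral_cexp_mul {X : Type*} [MeasurableSpace X] {m : Measure X}
    {k : X → ℝ} {h : X → ℂ} {w : ℂ} {ε : ℝ} (hε : 0 < ε) (hk : AEMeasurable k m)
    (hh : AEStronglyMeasurable h m)
    (hi : ∀ s : ℝ, |s - w.re| ≤ ε → Integrable (fun x ↦ Real.exp (s * k x) * ‖h x‖) m) :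
    DifferentiableAt ℂ (fun w : ℂ ↦ ∫ x, Complex.exp (w * k x) * h x ∂m) w := by
  set δ := ε / 2 with hδ
  have hδ0 : 0 < δ := by positivity
  have hkc : AEStronglyMeasurable (fun x ↦ (k x : ℂ)) m :=
    Complex.continuous_ofReal.comp_aestronglyMeasurable hk.aestronglyMeasurable
  have hmeas : ∀ w : ℂ, AEStronglyMeasurable (fun x ↦ Complex.exp (w * k x) * h x) m := fun w ↦
    (Complex.continuous_exp.comp_aestronglyMeasurable (hkc.const_mul w)).mul hh
  refine (hasDerivAt_integral_of_dominated_loc_of_deriv_le (μ := m) (𝕜 := ℂ)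
    (F := fun (w : ℂ) x ↦ Complex.exp (w * k x) * h x)
    (F' := fun (w : ℂ) x ↦ k x * (Complex.exp (w * k x) * h x))
    (bound := fun x ↦ δ⁻¹ * (Real.exp ((w.re + ε) * k x) * ‖h x‖ +
      Real.exp ((w.re - ε) * k x) * ‖h x‖))
    (x₀ := w) (s := Metric.ball w δ) (Metric.ball_mem_nhds _ hδ0)
    (Eventually.of_forall hmeas) ?_ (hkc.mul (hmeas w)) (Eventually.of_forall fun x z hz ↦ ?_)
    (((hi _ ?_).add (hi _ ?_)).const_mul _) (Eventually.of_forall fun x z hz ↦ ?_)).2.differentiableAt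
  · refine (hi w.re (by simpa using hε.le)).mono' (hmeas w) (Eventually.of_forall fun x ↦ ?_)
    rw [norm_mul, norm_cexp_mul_ofReal]
  · rw [norm_mul, norm_mul, norm_cexp_mul_ofReal, Complex.norm_real, Real.norm_eq_abs, ← add_mul,
      ← mul_assoc, ← mul_assoc]
    refine mul_le_mul_of_nonneg_right ?_ (norm_nonneg _)
    -- Half of `ε` absorbs the factor `k x` created by differentiation, the other half the variation
    -- of `z` in the ball. The two endpoint exponentials then dominate according to the sign of `k
    -- x`.
    have h1 : |k x| ≤ δ⁻¹ * Real.exp (δ * |k x|) := by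
      rw [inv_mul_eq_div, le_div_iff₀ hδ0]
      linarith [Real.add_one_le_exp (δ * |k x|)]
    have h2 : Real.exp (z.re * k x) ≤ Real.exp (w.re * k x + δ * |k x|) := by
      apply Real.exp_le_exp.2
      have e1 : |z.re - w.re| ≤ δ := by
        rw [← Complex.sub_re]
        exact (Complex.abs_re_le_norm _).trans (by simpa [dist_eq_norm] using (Metric.mem_ball.1 hz).le)
      have e2 : (z.re - w.re) * k x ≤ δ * |k x| :=
        (le_abs_self _).trans (by rw [abs_mul]; gcongr)
      linarith
    calc |k x| * Real.exp (z.re * k x) ≤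
          (δ⁻¹ * Real.exp (δ * |k x|)) * Real.exp (w.re * k x + δ * |k x|) := by gcongr
      _ = δ⁻¹ * Real.exp (w.re * k x + ε * |k x|) := by
          rw [mul_assoc, ← Real.exp_add, hδ]; ring_nf
      _ ≤ _ := by
          gcongr
          rcases abs_cases (k x) with ⟨h, _⟩ | ⟨h, _⟩
          · rw [h]
            refine le_trans (Real.exp_le_exp.2 (by linarith)) (le_add_of_nonneg_right (Real.exp_pos _).le)
          · rw [h]
            refine le_trans (Real.exp_le_exp.2 (by linarith)) (le_add_of_nonneg_left (Real.exp_pos _).le)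
  · simp [abs_of_pos hε]
  · simp [abs_of_pos hε]
  · have : HasDerivAt (fun z : ℂ ↦ Complex.exp (z * k x)) (Complex.exp (z * k x) * (1 * k x)) z :=
      ((hasDerivAt_id z).mul_const _).cexp
    exact (this.mul_const _).congr_deriv (by ring)

/-- The kernel of the double integral representing the Lommel functions. -/
noncomputable def lommelKernel (τ : ℝ) (x : ℝ × ℝ) : ℝ :=
  (1 + Real.exp (2 * x.2))⁻¹ * Real.exp (-(Real.exp τ * Real.cosh x.1 * Real.exp x.2))

theorem lommelKernel_pos (τ : ℝ) (x : ℝ × ℝ) : 0 < lommelKernel τ x :=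
  mul_pos (inv_one_add_exp_pos _) (Real.exp_pos _)

@[fun_prop]
theorem continuous_lommelKernel (τ : ℝ) : Continuous (lommelKernel τ) :=
  (continuous_inv_one_add_exp.comp continuous_snd).mul (by fun_prop)

theorem integrable_lommelKernel {s q : ℝ} (h : |s| < q) (τ : ℝ) :
    Integrable fun x : ℝ × ℝ ↦ Real.exp (s * x.1) * (Real.exp (q * x.2) * lommelKernel τ x) := by
  have hq : 0 < q := (abs_nonneg _).trans_lt h
  have hpos : ∀ u, 0 < Real.exp τ * Real.cosh u := fun u ↦
    mul_pos (Real.exp_pos _) (Real.cosh_pos u)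
  rw [Measure.volume_eq_prod]
  have key : Integrable (fun x : ℝ × ℝ ↦ Real.exp (s * x.1) * (Real.exp (q * x.2) *
      Real.exp (-(Real.exp τ * Real.cosh x.1 * Real.exp x.2)))) (volume.prod volume) := by
    rw [integrable_prod_iff (by fun_prop)]
    refine ⟨Eventually.of_forall fun u ↦
      (integrable_exp_mul_exp_neg_exp hq (hpos u)).const_mul (Real.exp (s * u)), ?_⟩
    have : ∀ u : ℝ, ∫ r : ℝ, ‖Real.exp (s * u) * (Real.exp (q * r) *
        Real.exp (-(Real.exp τ * Real.cosh u * Real.exp r)))‖ =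
        Real.exp (-(q * τ)) * Real.Gamma q *
          (Real.exp (s * u) * Real.exp (-(q * Real.log (Real.cosh u)))) := by
      intro u
      simp_rw [fun r : ℝ ↦ Real.norm_of_nonneg (show 0 ≤ Real.exp (s * u) * (Real.exp (q * r) *
        Real.exp (-(Real.exp τ * Real.cosh u * Real.exp r))) by positivity)]
      rw [integral_const_mul, integral_exp_mul_exp_neg_exp hq (hpos u), log_exp_mul_cosh, mul_add,
        neg_add, Real.exp_add]
      ring
    simp_rw [this]
    exact (integrable_exp_mul_exp_neg_mul_log_cosh h).const_mul _
  refine key.mono' (by fun_prop) (Eventually.of_forall fun x ↦ ?_)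
  have h0 := lommelKernel_pos τ x
  rw [Real.norm_of_nonneg (by positivity), lommelKernel]
  gcongr
  exact mul_le_of_le_one_left (Real.exp_pos _).le (inv_one_add_exp_le_one _)

theorem integrable_cexp_mul_lommelKernel {p ν : ℂ} (h : |ν.re| < p.re) (τ : ℝ) :
    Integrable fun x : ℝ × ℝ ↦
      Complex.exp (ν * x.1) * (Complex.exp (p * x.2) * (lommelKernel τ x : ℝ)) := by
  refine (integrable_lommelKernel h τ).mono' ?_ (Eventually.of_forall fun x ↦ ?_)
  · have := Complex.continuous_ofReal.comp (continuous_lommelKernel τ)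
    exact Continuous.aestronglyMeasurable (by fun_prop)
  · rw [norm_mul, norm_mul, norm_cexp_mul_ofReal, norm_cexp_mul_ofReal, Complex.norm_real,
      Real.norm_of_nonneg (lommelKernel_pos τ x).le]

/-- As one absolutely convergent double integral, the transform is a Laplace integral in `ν` with
respect to the first coordinate and in `p` with respect to the second, so one holomorphy lemma
covers both parameters. -/
theorem coshTransform_laplaceG_eq_integral {p ν : ℂ} (h : |ν.re| < p.re) (τ : ℝ) :
    coshTransform ν (laplaceG p) τ = ∫ x : ℝ × ℝ,
      Complex.exp (ν * x.1) * (Complex.exp (p * x.2) * (lommelKernel τ x : ℝ)) := by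
  rw [Measure.volume_eq_prod, integral_prod _ (integrable_cexp_mul_lommelKernel h τ)]
  simp only [coshTransform, laplaceG, lommelKernel]
  congr 1
  ext u
  rw [← integral_const_mul]

theorem differentiableAt_coshTransform_right {p ν : ℂ} (h : |ν.re| < p.re) (τ : ℝ) :
    DifferentiableAt ℂ (fun ν ↦ coshTransform ν (laplaceG p) τ) ν := by
  have hev : ∀ᶠ w in 𝓝 ν, |w.re| < p.re :=
    (by fun_prop : Continuous fun w : ℂ ↦ |w.re|).continuousAt.eventually_lt
      continuousAt_const h
  refine DifferentiableAt.congr_of_eventuallyEq (f := fun ν ↦ ∫ x : ℝ × ℝ,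
      Complex.exp (ν * x.1) * (Complex.exp (p * x.2) * (lommelKernel τ x : ℝ))) ?_
    (hev.mono fun w hw ↦ coshTransform_laplaceG_eq_integral hw τ)
  have hc := Complex.continuous_ofReal.comp (continuous_lommelKernel τ)
  refine differentiableAt_integral_cexp_mul (ε := (p.re - |ν.re|) / 2) (by linarith)
    measurable_fst.aemeasurable (Continuous.aestronglyMeasurable (by fun_prop)) fun s hs ↦ ?_
  have hs' : |s| < p.re := by
    have := abs_sub_abs_le_abs_sub s ν.re
    linarith
  refine (integrable_lommelKernel hs' τ).congr (Eventually.of_forall fun x ↦ ?_)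
  simp only
  rw [norm_mul, norm_cexp_mul_ofReal, Complex.norm_real,
      Real.norm_of_nonneg (lommelKernel_pos τ x).le]

theorem differentiableAt_coshTransform_left {p ν : ℂ} (h : |ν.re| < p.re) (τ : ℝ) :
    DifferentiableAt ℂ (fun p ↦ coshTransform ν (laplaceG p) τ) p := by
  have hev : ∀ᶠ w in 𝓝 p, |ν.re| < w.re :=
    continuousAt_const.eventually_lt Complex.continuous_re.continuousAt h
  refine DifferentiableAt.congr_of_eventuallyEq (f := fun p ↦ ∫ x : ℝ × ℝ,
      Complex.exp (p * x.2) * (Complex.exp (ν * x.1) * (lommelKernel τ x : ℝ))) ?_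
    (hev.mono fun w hw ↦ (coshTransform_laplaceG_eq_integral hw τ).trans
      (by congr 1; ext x; ring))
  have hc := Complex.continuous_ofReal.comp (continuous_lommelKernel τ)
  refine differentiableAt_integral_cexp_mul (ε := (p.re - |ν.re|) / 2) (by linarith)
    measurable_snd.aemeasurable (Continuous.aestronglyMeasurable (by fun_prop)) fun s hs ↦ ?_
  have hs' : |ν.re| < s := by
    have := (abs_le.1 hs).1
    linarith
  refine (integrable_lommelKernel hs' τ).congr (Eventually.of_forall fun x ↦ ?_)
  simp only
  rw [norm_mul, norm_cexp_mul_ofReal, Complex.norm_real,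
      Real.norm_of_nonneg (lommelKernel_pos τ x).le]
  ring

/-! ### Mellin transforms and behaviour at the origin -/

theorem log_exp_div_two (r : ℝ) : Real.log (Real.exp r / 2) = r - Real.log 2 := by
  rw [Real.log_div (Real.exp_pos _).ne' two_ne_zero, Real.log_exp]

/-- Fubini separates the Mellin integral into a Gamma integral in `v` and the integral of
`e^((p-s)r)/(1+e^(2r))`. Only `s + k` needs positive real part, so with `k ≥ 1` the value `s = -ν`
is admissible for `0 < ν < 1`. -/
theorem integral_cexp_mul_eulerG {p s : ℂ} {k : ℕ} (hs : 0 < (s + k).re) (h0 : 0 < (p - s).re)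
    (h2 : (p - s).re < 2) :
    ∫ v : ℝ, Complex.exp (s * v) * eulerG p k (Real.exp v / 2) =
      Complex.exp (s * Real.log 2) * Complex.Gamma (s + k) *
        (Real.pi / (2 * Complex.sin (Real.pi * ((p - s) / 2)))) := by
  set K : ℝ → ℝ → ℂ := fun v r ↦ Complex.exp (-(k * Real.log 2)) * (Complex.exp ((p + k) * r) *
    ((1 + Real.exp (2 * r))⁻¹ : ℝ)) *
    (Complex.exp ((s + k) * v) * (Real.exp (-(Real.exp r / 2 * Real.exp v)) : ℝ)) with hK
  have hpos : ∀ r : ℝ, 0 < Real.exp r / 2 := fun r ↦ by positivity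
  have e2 : Complex.exp (-(k * Real.log 2)) = ((2 : ℂ) ^ k)⁻¹ := by
    rw [Complex.exp_neg, Complex.exp_nat_mul, ← Complex.ofReal_exp, Real.exp_log two_pos]
    norm_num
  have hv : ∀ v : ℝ, Complex.exp (s * v) * eulerG p k (Real.exp v / 2) = ∫ r : ℝ, K v r := by
    intro v
    rw [eulerG, laplaceG, ← mul_assoc, ← integral_const_mul]
    congr 1
    ext r
    have e1 : Complex.exp (s * v) * ((Real.exp v / 2 : ℝ) : ℂ) ^ k =
        Complex.exp (-(k * Real.log 2)) * Complex.exp ((s + k) * v) := by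
      rw [add_mul, Complex.exp_add, e2, Complex.exp_nat_mul]
      push_cast
      rw [div_pow]
      ring
    rw [e1, hK]
    simp only
    rw [show Real.exp v / 2 * Real.exp r = Real.exp r / 2 * Real.exp v by ring]
    push_cast
    ring
  have hr : ∀ r : ℝ, ∫ v : ℝ, K v r = Complex.exp (s * Real.log 2) * Complex.Gamma (s + k) *
      (Complex.exp ((p - s) * r) * ((1 + Real.exp (2 * r))⁻¹ : ℝ)) := by
    intro r
    simp only [hK]
    rw [integral_const_mul, integral_cexp_mul_exp_neg_exp hs (hpos r), log_exp_div_two]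
    have : Complex.exp (-(k * Real.log 2)) * Complex.exp ((p + k) * r) *
        Complex.exp (-((s + k) * ((r - Real.log 2 : ℝ) : ℂ))) =
        Complex.exp (s * Real.log 2) * Complex.exp ((p - s) * r) := by
      rw [← Complex.exp_add, ← Complex.exp_add, ← Complex.exp_add]
      congr 1; push_cast; ring
    linear_combination ((1 + Real.exp (2 * r))⁻¹ : ℝ) * Complex.Gamma (s + k) * this
  have hint : Integrable (Function.uncurry K) (volume.prod volume) := by
    have hcont := Complex.continuous_ofReal.comp continuous_inv_one_add_exp
    have hmeas : Continuous (Function.uncurry K) := by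
      have : Continuous fun x : ℝ × ℝ ↦ (((1 + Real.exp (2 * x.2))⁻¹ : ℝ) : ℂ) :=
        hcont.comp continuous_snd
      simp only [Function.uncurry_def, hK]
      fun_prop
    rw [integrable_prod_iff' hmeas.aestronglyMeasurable]
    refine ⟨Eventually.of_forall fun r ↦ ?_, ?_⟩
    · exact (integrable_cexp_mul_exp_neg_exp hs (hpos r)).const_mul (Complex.exp (-(k * Real.log 2)) *
        (Complex.exp ((p + k) * r) * ((1 + Real.exp (2 * r))⁻¹ : ℝ)))
    · have : ∀ r : ℝ, ∫ v : ℝ, ‖Function.uncurry K (v, r)‖ =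
          Real.exp (s.re * Real.log 2) * Real.Gamma (s + k).re *
            (Real.exp ((p - s).re * r) * (1 + Real.exp (2 * r))⁻¹) := by
        intro r
        have e1 : ∀ v : ℝ, ‖Function.uncurry K (v, r)‖ = Real.exp (-(k * Real.log 2)) *
            (Real.exp ((p + k).re * r) * (1 + Real.exp (2 * r))⁻¹) *
            (Real.exp ((s + k).re * v) * Real.exp (-(Real.exp r / 2 * Real.exp v))) := by
          intro v
          simp only [Function.uncurry, hK, norm_mul, norm_cexp_mul_ofReal, Complex.norm_real,
            Real.norm_of_nonneg (Real.exp_pos _).le,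
            Real.norm_of_nonneg (inv_one_add_exp_pos _).le]
          congr 2
          rw [← neg_mul, norm_cexp_mul_ofReal]
          simp
        simp_rw [e1]
        rw [integral_const_mul, integral_exp_mul_exp_neg_exp hs (hpos r), log_exp_div_two]
        have : Real.exp (-(k * Real.log 2)) * Real.exp ((p + k).re * r) *
            Real.exp (-((s + k).re * (r - Real.log 2))) =
            Real.exp (s.re * Real.log 2) * Real.exp ((p - s).re * r) := by
          rw [← Real.exp_add, ← Real.exp_add, ← Real.exp_add]
          congr 1; simp; ring
        linear_combination (1 + Real.exp (2 * r))⁻¹ * Real.Gamma (s + k).re * this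
      simp_rw [this]
      exact (integrable_exp_mul_inv_one_add_exp h0 h2).const_mul _
  simp_rw [hv]
  rw [integral_integral_swap hint]
  simp_rw [hr]
  rw [integral_const_mul, integral_cexp_mul_inv_one_add_exp h0 h2]

/-- This is the expansion `A e^(-ντ) + B e^(ντ) + o(e^(ντ))`, where each of the ends `u → ±∞`
contributes one Mellin integral. With `u = τ - w` the argument becomes `e^w/2 + e^(2τ-w)/2`.
Subtracting the `A` term removes `g(e^(2τ-w)/2)`, and dominated convergence gives `B`. -/
theorem tendsto_coshTransform_atBot {ν q C : ℝ} {g : ℝ → ℂ} (hν0 : 0 < ν) (hν1 : ν < 1)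
    (hνq : ν < q) (hc : ContinuousOn g (Ioi 0)) (h1 : ∀ c > 0, ‖g c‖ ≤ C * c)
    (h2 : ∀ c > 0, ‖g c‖ ≤ C) (h3 : ∀ c > 0, ‖g c‖ ≤ C * Real.exp (-(q * Real.log c)))
    (h4 : ∀ x > 0, ∀ y > 0, ‖g (x + y) - g x‖ ≤ C * y) :
    Tendsto (fun τ : ℝ ↦ Complex.exp (-(ν * τ)) * (coshTransform ν g τ - Complex.exp (-(ν * τ)) *
      ∫ v : ℝ, Complex.exp (ν * v) * g (Real.exp v / 2))) atBot
      (𝓝 (∫ w : ℝ, Complex.exp (-ν * w) * g (Real.exp w / 2))) := by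
  have hC : 0 ≤ C := (norm_nonneg _).trans (h2 1 one_pos)
  have hpos : ∀ r : ℝ, 0 < Real.exp r / 2 := fun r ↦ by positivity
  have hgc : Continuous fun v : ℝ ↦ g (Real.exp v / 2) :=
    hc.comp_continuous (by fun_prop) fun v ↦ hpos v
  have hintA : Integrable fun v : ℝ ↦ Complex.exp (ν * v) * g (Real.exp v / 2) := by
    set δ := min ν (q - ν) with hδ
    have hδ0 : 0 < δ := lt_min hν0 (by linarith)
    have hq2 : 1 ≤ Real.exp (q * Real.log 2) :=
      Real.one_le_exp (mul_nonneg (by linarith) (Real.log_nonneg one_le_two))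
    refine ((integrable_exp_neg_mul_abs hδ0).const_mul (C * Real.exp (q * Real.log 2))).mono'
      ((by fun_prop : Continuous fun v : ℝ ↦ Complex.exp (ν * v)).mul hgc).aestronglyMeasurable
      (Eventually.of_forall fun v ↦ ?_)
    rw [norm_mul, norm_cexp_mul_ofReal, Complex.ofReal_re]
    rcases le_total v 0 with hv | hv
    · have e1 : Real.exp (ν * v) ≤ Real.exp (-(δ * |v|)) := by
        apply Real.exp_le_exp.2
        rw [abs_of_nonpos hv]
        nlinarith [min_le_left ν (q - ν)]
      calc _ ≤ Real.exp (-(δ * |v|)) * C := mul_le_mul e1 (h2 _ (hpos v)) (norm_nonneg _) (by positivity)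
        _ = C * 1 * Real.exp (-(δ * |v|)) := by ring
        _ ≤ _ := by gcongr
    · have e1 := h3 _ (hpos v)
      rw [log_exp_div_two] at e1
      calc _ ≤ Real.exp (ν * v) * (C * Real.exp (-(q * (v - Real.log 2)))) := by gcongr
        _ = C * Real.exp (q * Real.log 2) * Real.exp (-((q - ν) * v)) := by
          rw [mul_left_comm, mul_assoc, ← Real.exp_add, ← Real.exp_add]; ring_nf
        _ ≤ _ := by
          gcongr
          · exact min_le_right _ _
          · exact (abs_of_nonneg hv).le
  have hform : ∀ τ : ℝ, Complex.exp (-(ν * τ)) * (coshTransform ν g τ - Complex.exp (-(ν * τ)) *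
      ∫ v : ℝ, Complex.exp (ν * v) * g (Real.exp v / 2)) =
      ∫ w : ℝ, Complex.exp (-ν * w) *
        (g (Real.exp w / 2 + Real.exp (2 * τ - w) / 2) - g (Real.exp (2 * τ - w) / 2)) := by
    intro τ
    have i1 : Integrable fun u : ℝ ↦ Complex.exp (ν * u) * g (Real.exp τ * Real.cosh u) :=
      integrable_coshTransform (q := q)
        (by rw [Complex.ofReal_re, abs_of_pos hν0]; exact hνq) hc h3 τ
    have i1' := (i1.comp_sub_left τ).const_mul (Complex.exp (-(ν * τ)))
    have i2' := (hintA.comp_sub_left (2 * τ)).const_mul (Complex.exp (-(ν * τ)) * Complex.exp (-(ν * τ)))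
    have e1 := integral_sub_left_eq_self
      (fun u : ℝ ↦ Complex.exp (ν * u) * g (Real.exp τ * Real.cosh u)) volume τ
    have e2 := integral_sub_left_eq_self
      (fun v : ℝ ↦ Complex.exp (ν * v) * g (Real.exp v / 2)) volume (2 * τ)
    rw [coshTransform, ← e1, ← e2, mul_sub, ← mul_assoc, ← integral_const_mul, ← integral_const_mul,
      ← integral_sub i1' i2']
    congr 1
    ext w
    have f1 : Real.exp τ * Real.cosh (τ - w) = Real.exp w / 2 + Real.exp (2 * τ - w) / 2 := by
      rw [Real.cosh_eq, mul_div_assoc', mul_add, ← Real.exp_add, ← Real.exp_add]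
      ring_nf
    have f2 : Complex.exp (-(ν * τ)) * Complex.exp (ν * ((τ - w : ℝ) : ℂ)) = Complex.exp (-ν * w) := by
      rw [← Complex.exp_add]; congr 1; push_cast; ring
    have f3 : Complex.exp (-(ν * τ)) * Complex.exp (-(ν * τ)) *
        Complex.exp (ν * ((2 * τ - w : ℝ) : ℂ)) = Complex.exp (-ν * w) := by
      rw [← Complex.exp_add, ← Complex.exp_add]; congr 1; push_cast; ring
    rw [f1, ← mul_assoc, f2, ← mul_assoc, f3, mul_sub]
  simp_rw [hform]
  set δ := min ν (1 - ν) with hδ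
  have hδ0 : 0 < δ := lt_min hν0 (by linarith)
  refine tendsto_integral_filter_of_dominated_convergence
    (fun w ↦ 2 * C * Real.exp (-(δ * |w|))) (Eventually.of_forall fun τ ↦ ?_)
    (Eventually.of_forall fun τ ↦ Eventually.of_forall fun w ↦ ?_)
    ((integrable_exp_neg_mul_abs hδ0).const_mul _) (Eventually.of_forall fun w ↦ ?_)
  · have c1 : Continuous fun w : ℝ ↦ g (Real.exp w / 2 + Real.exp (2 * τ - w) / 2) :=
      hc.comp_continuous (by fun_prop) fun w ↦ by simp only [mem_Ioi]; positivity
    have c2 : Continuous fun w : ℝ ↦ g (Real.exp (2 * τ - w) / 2) :=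
      hc.comp_continuous (by fun_prop) fun w ↦ by simp only [mem_Ioi]; positivity
    exact ((by fun_prop : Continuous fun w : ℝ ↦ Complex.exp (-ν * w)).mul
      (c1.sub c2)).aestronglyMeasurable
  · rw [norm_mul, ← Complex.ofReal_neg, norm_cexp_mul_ofReal, Complex.ofReal_re]
    -- For `w ≤ 0` the Lipschitz bound supplies a factor `e^w`, enough because `ν < 1`; for `w ≥ 0`
    -- boundedness suffices because `ν > 0`.
    rcases le_total w 0 with hw | hw
    · have e0 : ‖g (Real.exp w / 2 + Real.exp (2 * τ - w) / 2) - g (Real.exp (2 * τ - w) / 2)‖ ≤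
          C * (Real.exp w / 2) := by
        rw [add_comm]; exact h4 _ (hpos _) _ (hpos _)
      calc _ ≤ Real.exp (-ν * w) * (C * (Real.exp w / 2)) := by gcongr
        _ = C / 2 * Real.exp ((1 - ν) * w) := by
          rw [show (1 - ν) * w = -ν * w + w by ring, Real.exp_add]; ring
        _ ≤ 2 * C * Real.exp (-(δ * |w|)) := by
          have : Real.exp ((1 - ν) * w) ≤ Real.exp (-(δ * |w|)) := by
            apply Real.exp_le_exp.2
            rw [abs_of_nonpos hw]
            nlinarith [min_le_right ν (1 - ν)]
          gcongr
          linarith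
    · calc _ ≤ Real.exp (-ν * w) * (C + C) := by
            gcongr
            refine (norm_sub_le _ _).trans (add_le_add (h2 _ ?_) (h2 _ (hpos _)))
            positivity
        _ = 2 * C * Real.exp (-ν * w) := by ring
        _ ≤ _ := by
          gcongr
          rw [abs_of_nonneg hw]
          nlinarith [min_le_left ν (1 - ν)]
  · have t0 : Tendsto (fun τ : ℝ ↦ Real.exp (2 * τ - w) / 2) atBot (𝓝 0) := by
      have : Tendsto (fun τ : ℝ ↦ 2 * τ - w) atBot atBot :=
        tendsto_atBot_add_const_right _ _ (tendsto_id.const_mul_atBot two_pos)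
      simpa using (Real.tendsto_exp_atBot.comp this).div_const 2
    have t1 : Tendsto (fun τ : ℝ ↦ g (Real.exp w / 2 + Real.exp (2 * τ - w) / 2)) atBot
        (𝓝 (g (Real.exp w / 2))) := by
      have hca : ContinuousAt g (Real.exp w / 2) := hc.continuousAt (Ioi_mem_nhds (hpos w))
      have := t0.const_add (Real.exp w / 2)
      rw [add_zero] at this
      exact hca.tendsto.comp this
    have t2 : Tendsto (fun τ : ℝ ↦ g (Real.exp (2 * τ - w) / 2)) atBot (𝓝 0) := by
      refine squeeze_zero_norm (fun τ ↦ h1 _ (hpos _)) ?_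
      simpa using t0.const_mul C
    simpa using (t1.sub t2).const_mul (Complex.exp (-ν * w))

/-- The behaviour at `0` of the transforms of the Euler derivatives of `G_p`. -/
theorem tendsto_coshTransform_eulerG_atBot {p ν : ℝ} (hν0 : 0 < ν) (hνp : ν < p) (hp1 : p < 1)
    (k : ℕ) :
    Tendsto (fun τ : ℝ ↦ Complex.exp (-(ν * τ)) *
      (coshTransform ν (eulerG p (k + 1)) τ - Complex.exp (-(ν * τ)) *
        (Complex.exp (ν * Real.log 2) * Complex.Gamma (ν + (k + 1 : ℕ)) *
          (Real.pi / (2 * Complex.sin (Real.pi * ((p - ν) / 2))))))) atBot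
      (𝓝 (Complex.exp (-ν * Real.log 2) * Complex.Gamma (-ν + (k + 1 : ℕ)) *
          (Real.pi / (2 * Complex.sin (Real.pi * ((p + ν) / 2)))))) := by
  have hp0 : 0 < p := hν0.trans hνp
  have hpre : 0 < (p : ℂ).re := by simpa using hp0
  obtain ⟨C₁, hC₁, hb₁⟩ := exists_norm_eulerG_succ_le_mul hpre (by simpa using hp1) k
  obtain ⟨C₂, hC₂, hb₂⟩ := exists_norm_eulerG_succ_le_mul hpre (by simpa using hp1) (k + 1)
  have hb₃ : ∀ c > 0, ‖eulerG p (k + 1) c‖ ≤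
      Real.Gamma (p + (k + 1 : ℕ)) * Real.exp (-(p * Real.log c)) := fun c hc ↦ by
    simpa using norm_eulerG_le hpre hc (k + 1)
  have hG : 0 < Real.Gamma (p + (k + 1 : ℕ)) := Real.Gamma_pos_of_pos (by positivity)
  -- One constant for all four hypotheses: the linear bound, the uniform bound, the decay at
  -- infinity, and the Lipschitz bound obtained from the derivative formula.
  set C := C₁ + Real.Gamma (p + (k + 1 : ℕ)) + ((k + 1) * C₁ + C₂) with hC
  have hA := integral_cexp_mul_eulerG (p := p) (s := ν) (k := k + 1) (by simp; positivity)
    (by simpa using hνp) (by simp; linarith)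
  have hB := integral_cexp_mul_eulerG (p := p) (s := -ν) (k := k + 1)
    (by
      simp only [Complex.add_re, Complex.neg_re, Complex.ofReal_re, Complex.natCast_re]
      push_cast
      linarith [Nat.cast_nonneg (α := ℝ) k])
    (by simp; linarith) (by simp; linarith)
  rw [sub_neg_eq_add] at hB
  rw [← hA, ← hB]
  have hkC : 0 ≤ (k + 1) * C₁ + C₂ := by positivity
  refine tendsto_coshTransform_atBot (C := C) (q := p) hν0 (by linarith) hνp
    (continuousOn_eulerG hpre (k + 1)) (fun c hc ↦ (hb₁ c hc).trans ?_) (fun c hc ↦ ?_)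
    (fun c hc ↦ (hb₃ c hc).trans ?_) (fun x hx y hy ↦ ?_)
  · gcongr; linarith
  · rcases le_total c 1 with h | h
    · refine (hb₁ c hc).trans ?_
      nlinarith
    · refine (hb₃ c hc).trans ?_
      have : Real.exp (-(p * Real.log c)) ≤ 1 :=
        Real.exp_le_one_iff.2 (by nlinarith [Real.log_nonneg h])
      nlinarith
  · gcongr; linarith
  · have hd : ∀ z ∈ Ioi (0 : ℝ), HasDerivWithinAt (eulerG p (k + 1))
        (((k + 1 : ℕ) * eulerG p (k + 1) z - eulerG p (k + 1 + 1) z) / z) (Ioi 0) z := fun z hz ↦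
      (hasDerivAt_eulerG hpre hz (k + 1)).hasDerivWithinAt
    have hbd : ∀ z ∈ Ioi (0 : ℝ),
        ‖((k + 1 : ℕ) * eulerG p (k + 1) z - eulerG p (k + 1 + 1) z) / (z : ℂ)‖ ≤ C := by
      intro z hz
      have hz' : 0 < z := hz
      rw [norm_div, Complex.norm_real, Real.norm_of_nonneg hz'.le, div_le_iff₀ hz']
      refine (norm_sub_le _ _).trans ?_
      rw [norm_mul, Complex.norm_natCast]
      have e1 := hb₁ z hz'
      have e2 := hb₂ z hz'
      have e3 := mul_le_mul_of_nonneg_left e1 (Nat.cast_nonneg (α := ℝ) (k + 1))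
      push_cast at e3 ⊢
      have e4 : 0 ≤ (C₁ + Real.Gamma (p + (k + 1 : ℕ))) * z := by positivity
      push_cast at e4
      rw [hC]
      push_cast
      nlinarith
    have := (convex_Ioi (0 : ℝ)).norm_image_sub_le_of_norm_hasDerivWithin_le hd hbd
      (mem_Ioi.2 hx) (mem_Ioi.2 (add_pos hx hy))
    simpa [abs_of_pos hy] using this

/-! ### Frobenius series -/

/-- Once `k ≥ 2R`, one has `|w+k+1| ≥ (k+1)/2`, so the functional equation gains at least `2/(k+1)`
at each step. The finitely many smaller `k` are handled by compactness, `1/Γ` being entire. -/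
theorem exists_norm_inv_Gamma_le (R : ℝ) :
    ∃ C, 0 ≤ C ∧ ∀ w : ℂ, ‖w‖ ≤ R → ∀ k : ℕ,
      ‖(Complex.Gamma (w + k + 1))⁻¹‖ ≤ C * 2 ^ k / k.factorial := by
  have hbd : ∀ k : ℕ, ∃ B, 0 ≤ B ∧ ∀ w : ℂ, ‖w‖ ≤ R → ‖(Complex.Gamma (w + k + 1))⁻¹‖ ≤ B := by
    intro k
    have hc : Continuous fun w : ℂ ↦ (Complex.Gamma (w + k + 1))⁻¹ :=
      Complex.differentiable_one_div_Gamma.continuous.comp (by fun_prop)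
    obtain ⟨B, hB⟩ := (isCompact_closedBall (0 : ℂ) R).exists_bound_of_continuousOn hc.continuousOn
    exact ⟨max B 0, le_max_right _ _, fun w hw ↦
      (hB w (by simpa using hw)).trans (le_max_left _ _)⟩
  choose B hB0 hB using hbd
  obtain ⟨N, hN⟩ := exists_nat_ge (2 * R)
  set C := ∑ k ∈ Finset.range (N + 1), B k * k.factorial with hC
  have hC0 : 0 ≤ C := Finset.sum_nonneg fun k _ ↦ by have := hB0 k; positivity
  refine ⟨C, hC0, fun w hw k ↦ ?_⟩
  have hsmall : ∀ k ≤ N, ‖(Complex.Gamma (w + k + 1))⁻¹‖ ≤ C * 2 ^ k / k.factorial := by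
    intro k hk
    have h1 : B k * k.factorial ≤ C := Finset.single_le_sum
      (f := fun k : ℕ ↦ B k * (k.factorial : ℝ)) (fun i _ ↦ by have := hB0 i; positivity)
      (Finset.mem_range.2 (by omega))
    rw [le_div_iff₀ (by positivity)]
    calc _ ≤ B k * k.factorial := by gcongr; exact hB k w hw
      _ ≤ C * 1 := by linarith
      _ ≤ _ := by gcongr; exact one_le_pow₀ one_le_two
  rcases le_total k N with hk | hk
  · exact hsmall k hk
  · induction k, hk using Nat.le_induction with
    | base => exact hsmall N le_rfl
    | succ k hk ih =>
      have hkR : 2 * R ≤ k := hN.trans (by exact_mod_cast hk)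
      have h1 := Complex.one_div_Gamma_eq_self_mul_one_div_Gamma_add_one (w + k + 1)
      have h2 : ((k : ℝ) + 1) / 2 ≤ ‖w + k + 1‖ := by
        have : ‖((k : ℂ) + 1)‖ ≤ ‖w + k + 1‖ + ‖w‖ := by
          have := norm_sub_le (w + k + 1) w
          rwa [show w + k + 1 - w = (k : ℂ) + 1 by ring] at this
        have e : ‖((k : ℂ) + 1)‖ = k + 1 := by
          rw [← Nat.cast_succ, Complex.norm_natCast]; push_cast; ring
        linarith
      rw [h1, norm_mul] at ih
      rw [Nat.factorial_succ]
      push_cast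
      have e : w + ((k : ℂ) + 1) + 1 = w + k + 1 + 1 := by ring
      rw [e]
      have h3 : ((k : ℝ) + 1) / 2 * ‖(Complex.Gamma (w + k + 1 + 1))⁻¹‖ ≤ C * 2 ^ k / k.factorial :=
        (mul_le_mul_of_nonneg_right h2 (norm_nonneg _)).trans ih
      rw [le_div_iff₀ (by positivity)] at h3 ⊢
      rw [pow_succ]
      nlinarith

/-- The coefficients of the Frobenius solution of exponent `a + b` of the Bessel equation of
order `b - a`. -/
noncomputable def frobeniusCoeff (a b : ℂ) (k : ℕ) : ℂ :=
  (-1) ^ k * ((Complex.Gamma (a + k + 1))⁻¹ * (Complex.Gamma (b + k + 1))⁻¹)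

/-- The terms of the `j`-th logarithmic derivative of the Frobenius solution. -/
noncomputable def frobeniusTerm (j : ℕ) (a b t : ℂ) (k : ℕ) : ℂ :=
  (a + b + 2 * k) ^ j * frobeniusCoeff a b k * Complex.exp ((a + b + 2 * k) * (t - Real.log 2))

/-- The `j`-th logarithmic derivative of
`(z/2)^(a+b) ∑ₖ (-z²/4)^k / (Γ(a+k+1) Γ(b+k+1))`, where `z = e^t`. -/
noncomputable def frobeniusSeries (j : ℕ) (a b t : ℂ) : ℂ := ∑' k, frobeniusTerm j a b t k

/-- A majorant locally uniform in `a`, `b` and `t` together, so that the Weierstrass theorem applies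
in each variable. One of the two factorials is given up; the other already makes the majorant an
exponential series. -/
theorem exists_summable_frobeniusTerm_le (j : ℕ) (R T : ℝ) :
    ∃ u : ℕ → ℝ, Summable u ∧ ∀ a b t : ℂ, ‖a‖ ≤ R → ‖b‖ ≤ R → ‖t - Real.log 2‖ ≤ T →
      ∀ k, ‖frobeniusTerm j a b t k‖ ≤ u k := by
  obtain ⟨C, hC0, hC⟩ := exists_norm_inv_Gamma_le R
  set X := 4 * Real.exp (2 * (T + 1)) with hX
  refine ⟨fun k ↦ j.factorial * C ^ 2 * Real.exp (2 * R * (T + 1)) * (X ^ k / k.factorial),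
    (Real.summable_pow_div_factorial X).mul_left _, fun a b t ha hb ht k ↦ ?_⟩
  have hR : 0 ≤ R := (norm_nonneg _).trans ha
  have hab : ‖a + b + 2 * k‖ ≤ 2 * R + 2 * k := by
    refine (norm_add_le _ _).trans (add_le_add ((norm_add_le _ _).trans (by linarith)) ?_)
    simp
  have h1 : ‖a + b + 2 * k‖ ^ j ≤ j.factorial * Real.exp (2 * R + 2 * k) := by
    have := Real.pow_div_factorial_le_exp ‖a + b + 2 * k‖ (norm_nonneg _) j
    rw [div_le_iff₀' (by positivity)] at this
    exact this.trans (by gcongr)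
  have h2 : ‖Complex.exp ((a + b + 2 * k) * (t - Real.log 2))‖ ≤ Real.exp ((2 * R + 2 * k) * T) := by
    rw [Complex.norm_exp]
    apply Real.exp_le_exp.2
    refine (Complex.re_le_norm _).trans ?_
    rw [norm_mul]
    gcongr
  have h3 : ‖frobeniusCoeff a b k‖ ≤ C ^ 2 * 4 ^ k / k.factorial := by
    rw [frobeniusCoeff, norm_mul, norm_mul, norm_pow, norm_neg, norm_one, one_pow, one_mul]
    calc _ ≤ (C * 2 ^ k / k.factorial) * (C * 2 ^ k / k.factorial) := by
          gcongr
          · exact hC a ha k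
          · exact hC b hb k
      _ = C ^ 2 * 4 ^ k / k.factorial * (1 / k.factorial) := by
          rw [show (4 : ℝ) ^ k = 2 ^ k * 2 ^ k by rw [← mul_pow]; norm_num]; ring
      _ ≤ C ^ 2 * 4 ^ k / k.factorial * 1 := by
          gcongr
          rw [div_le_one (by positivity)]
          exact_mod_cast Nat.succ_le_of_lt k.factorial_pos
      _ = _ := mul_one _
  rw [frobeniusTerm, norm_mul, norm_mul, norm_pow]
  calc _ ≤ (j.factorial * Real.exp (2 * R + 2 * k)) * (C ^ 2 * 4 ^ k / k.factorial) *
        Real.exp ((2 * R + 2 * k) * T) := by gcongr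
    _ = j.factorial * C ^ 2 * 4 ^ k / k.factorial *
        (Real.exp (2 * R + 2 * k) * Real.exp ((2 * R + 2 * k) * T)) := by ring
    _ = j.factorial * C ^ 2 * 4 ^ k / k.factorial *
        (Real.exp (2 * R * (T + 1)) * Real.exp (2 * (T + 1)) ^ k) := by
        rw [← Real.exp_add, ← Real.exp_nat_mul, ← Real.exp_add]; ring_nf
    _ = _ := by simp only [hX, mul_pow]; ring

theorem summable_norm_frobeniusTerm (j : ℕ) (a b t : ℂ) :
    Summable fun k ↦ ‖frobeniusTerm j a b t k‖ := by
  obtain ⟨u, hu, h⟩ := exists_summable_frobeniusTerm_le j (max ‖a‖ ‖b‖) ‖t - Real.log 2‖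
  exact hu.of_nonneg_of_le (fun _ ↦ norm_nonneg _)
    (h a b t (le_max_left _ _) (le_max_right _ _) le_rfl)

theorem summable_frobeniusTerm (j : ℕ) (a b t : ℂ) : Summable (frobeniusTerm j a b t) :=
  (summable_norm_frobeniusTerm j a b t).of_norm

theorem hasDerivAt_frobeniusSeries (j : ℕ) (a b t : ℂ) :
    HasDerivAt (frobeniusSeries j a b) (frobeniusSeries (j + 1) a b t) t := by
  set T := ‖t - Real.log 2‖ + 1 with hT
  obtain ⟨u, hu, h⟩ := exists_summable_frobeniusTerm_le j (max ‖a‖ ‖b‖) T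
  have hd : ∀ k (s : ℂ), HasDerivAt (fun s ↦ frobeniusTerm j a b s k)
      (frobeniusTerm (j + 1) a b s k) s := by
    intro k s
    have := (((hasDerivAt_id s).sub_const (Real.log 2 : ℂ)).const_mul (a + b + 2 * k)).cexp.const_mul
      ((a + b + 2 * k) ^ j * frobeniusCoeff a b k)
    refine this.congr_deriv ?_
    simp only [frobeniusTerm, id]
    ring
  have hU : IsOpen (Metric.ball t 1) := Metric.isOpen_ball
  have ht : t ∈ Metric.ball t 1 := Metric.mem_ball_self one_pos
  have hdiff : ∀ k, DifferentiableOn ℂ (fun s ↦ frobeniusTerm j a b s k) (Metric.ball t 1) :=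
    fun k s _ ↦ (hd k s).differentiableAt.differentiableWithinAt
  have hle : ∀ k, ∀ s ∈ Metric.ball t 1, ‖frobeniusTerm j a b s k‖ ≤ u k := by
    intro k s hs
    refine h a b s (le_max_left _ _) (le_max_right _ _) ?_ k
    have h1 := norm_add_le (s - t) (t - Real.log 2)
    rw [sub_add_sub_cancel] at h1
    have h2 : ‖s - t‖ < 1 := by simpa [dist_eq_norm] using hs
    linarith
  have h1 := (Complex.differentiableOn_tsum_of_summable_norm hu hdiff hU hle).differentiableAt
    (hU.mem_nhds ht)
  have h2 := (Complex.hasSum_deriv_of_summable_norm hu hdiff hU hle ht).tsum_eq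
  have h3 := h1.hasDerivAt
  rw [← h2] at h3
  simp_rw [fun k ↦ (hd k t).deriv] at h3
  exact h3

/-- Normalizing by reciprocal Gammas makes the series entire in its parameters, which the analytic
continuation and the limits at special parameters rely on. -/
theorem differentiable_frobeniusSeries_param {a b : ℂ → ℂ} (ha : Differentiable ℂ a)
    (hb : Differentiable ℂ b) (t : ℂ) : Differentiable ℂ fun w ↦ frobeniusSeries 0 (a w) (b w) t := by
  intro w
  obtain ⟨A, hA⟩ := (isCompact_closedBall w 1).exists_bound_of_continuousOn
    ha.continuous.continuousOn
  obtain ⟨B, hB⟩ := (isCompact_closedBall w 1).exists_bound_of_continuousOn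
    hb.continuous.continuousOn
  obtain ⟨u, hu, h⟩ := exists_summable_frobeniusTerm_le 0 (max A B) ‖t - Real.log 2‖
  have hg : ∀ (c : ℂ → ℂ) (k : ℕ), Differentiable ℂ c →
      Differentiable ℂ fun w ↦ (Complex.Gamma (c w + k + 1))⁻¹ := fun c k hc ↦
    Complex.differentiable_one_div_Gamma.comp (by fun_prop)
  have hd : ∀ k, DifferentiableOn ℂ (fun w ↦ frobeniusTerm 0 (a w) (b w) t k) (Metric.ball w 1) := by
    intro k
    have h1 := hg a k ha
    have h2 := hg b k hb
    simp only [frobeniusTerm, frobeniusCoeff]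
    exact Differentiable.differentiableOn (by fun_prop)
  exact (Complex.differentiableOn_tsum_of_summable_norm hu hd Metric.isOpen_ball fun k s hs ↦
    h _ _ _ ((hA s (Metric.ball_subset_closedBall hs)).trans (le_max_left _ _))
      ((hB s (Metric.ball_subset_closedBall hs)).trans (le_max_right _ _)) le_rfl k).differentiableAt
    (Metric.isOpen_ball.mem_nhds (Metric.mem_ball_self one_pos))

/-- The inhomogeneous Bessel equation satisfied by Frobenius series. -/
theorem frobeniusSeries_two (a b t : ℂ) :
    frobeniusSeries 2 a b t = ((b - a) ^ 2 - Complex.exp (2 * t)) * frobeniusSeries 0 a b t +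
      4 * Complex.exp ((a + b) * (t - Real.log 2)) *
        ((Complex.Gamma a)⁻¹ * (Complex.Gamma b)⁻¹) := by
  have h2 : Complex.exp ((Real.log 2 : ℝ) : ℂ) = 2 := by
    rw [← Complex.ofReal_exp, Real.exp_log two_pos]; norm_num
  -- Since `(a+b+2k)² - (b-a)² = 4(a+k)(b+k)`, both Gamma arguments drop by one: `v (k+1)` is
  -- `-e^(2t)` times the `k`-th term, and `v 0` is the inhomogeneity. It vanishes if `a = 0` or `b =
  -- 0`, as `Complex.Gamma 0 = 0` and `0⁻¹ = 0`.
  set v : ℕ → ℂ := fun k ↦ frobeniusTerm 2 a b t k - (b - a) ^ 2 * frobeniusTerm 0 a b t k with hv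
  have hv' : ∀ k, v k = 4 * (-1) ^ k * ((Complex.Gamma (a + k))⁻¹ * (Complex.Gamma (b + k))⁻¹) *
      Complex.exp ((a + b + 2 * k) * (t - Real.log 2)) := by
    intro k
    simp only [hv, frobeniusTerm, frobeniusCoeff]
    rw [Complex.one_div_Gamma_eq_self_mul_one_div_Gamma_add_one (a + k),
      Complex.one_div_Gamma_eq_self_mul_one_div_Gamma_add_one (b + k)]
    ring
  have hsv : Summable v := (summable_frobeniusTerm 2 a b t).sub
    ((summable_frobeniusTerm 0 a b t).mul_left _)
  have hsum : ∑' k, v k = frobeniusSeries 2 a b t - (b - a) ^ 2 * frobeniusSeries 0 a b t := by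
    rw [frobeniusSeries, frobeniusSeries, ← tsum_mul_left]
    exact (summable_frobeniusTerm 2 a b t).tsum_sub ((summable_frobeniusTerm 0 a b t).mul_left _)
  have hsucc : ∀ k, v (k + 1) = -Complex.exp (2 * t) * frobeniusTerm 0 a b t k := by
    intro k
    rw [hv' (k + 1)]
    simp only [frobeniusTerm, frobeniusCoeff]
    have : Complex.exp ((a + b + 2 * ((k + 1 : ℕ) : ℂ)) * (t - Real.log 2)) =
        Complex.exp (2 * t) * 4⁻¹ * Complex.exp ((a + b + 2 * k) * (t - Real.log 2)) := by
      rw [show (4 : ℂ)⁻¹ = Complex.exp (-((Real.log 2 : ℝ) : ℂ) + -((Real.log 2 : ℝ) : ℂ)) by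
          rw [Complex.exp_add, Complex.exp_neg, h2]; norm_num,
        ← Complex.exp_add, ← Complex.exp_add]
      congr 1; push_cast; ring
    rw [this, pow_succ]
    push_cast
    rw [← add_assoc a, ← add_assoc b]
    ring
  rw [hsv.tsum_eq_zero_add, hv' 0] at hsum
  simp_rw [hsucc] at hsum
  rw [tsum_mul_left] at hsum
  change _ + -Complex.exp (2 * t) * frobeniusSeries 0 a b t = _ at hsum
  simp only [Nat.cast_zero, add_zero, pow_zero, mul_one, mul_zero] at hsum
  linear_combination -hsum

theorem frobeniusCoeff_zero (a b : ℂ) : frobeniusCoeff a b 0 =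
    (Complex.Gamma (a + 1))⁻¹ * (Complex.Gamma (b + 1))⁻¹ := by
  simp [frobeniusCoeff]

theorem tendsto_frobeniusSeries_sub_atBot (j : ℕ) {a b : ℂ} {κ : ℝ} (hκ : κ < (a + b).re + 2) :
    Tendsto (fun τ : ℝ ↦ Complex.exp (-(κ * τ)) * (frobeniusSeries j a b τ -
      (a + b) ^ j * frobeniusCoeff a b 0 * Complex.exp ((a + b) * (τ - Real.log 2)))) atBot
      (𝓝 0) := by
  -- The tail at `τ = 0`. For `τ ≤ 0` each later term is at most `e^((Re(a+b)+2)τ)` times its norm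
  -- at `τ = 0`.
  set S := ∑' k, ‖frobeniusTerm j a b 0 (k + 1)‖ with hS
  have hsS : Summable fun k ↦ ‖frobeniusTerm j a b 0 (k + 1)‖ :=
    (summable_nat_add_iff 1).2 (summable_norm_frobeniusTerm j a b 0)
  set δ := (a + b).re + 2 - κ with hδ
  have hδ0 : 0 < δ := by linarith
  have hb : Tendsto (fun τ : ℝ ↦ Real.exp (δ * τ) * S) atBot (𝓝 0) := by
    simpa using (Real.tendsto_exp_atBot.comp (tendsto_id.const_mul_atBot hδ0)).mul_const S
  refine squeeze_zero_norm' ?_ hb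
  filter_upwards [eventually_le_atBot 0] with τ hτ
  have e1 : frobeniusSeries j a b τ -
      (a + b) ^ j * frobeniusCoeff a b 0 * Complex.exp ((a + b) * (τ - Real.log 2)) =
      ∑' k, frobeniusTerm j a b τ (k + 1) := by
    rw [frobeniusSeries, (summable_frobeniusTerm j a b τ).tsum_eq_zero_add]
    simp [frobeniusTerm]
  rw [e1, ← tsum_mul_left, hS, ← tsum_mul_left]
  refine tsum_of_norm_bounded (hsS.mul_left _).hasSum fun k ↦ ?_
  simp only [frobeniusTerm, norm_mul]
  rw [mul_left_comm (Real.exp (δ * τ)), mul_left_comm ‖Complex.exp (-(κ * τ))‖]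
  refine mul_le_mul_of_nonneg_left ?_ (by positivity)
  rw [Complex.norm_exp, Complex.norm_exp, Complex.norm_exp, ← Real.exp_add, ← Real.exp_add]
  apply Real.exp_le_exp.2
  have hre : ((a + b + 2 * ((k + 1 : ℕ) : ℂ)) * (τ - Real.log 2)).re =
      ((a + b).re + 2 * (k + 1)) * τ +
        ((a + b + 2 * ((k + 1 : ℕ) : ℂ)) * (0 - Real.log 2)).re := by
    simp [Complex.mul_re]
    ring
  have hre2 : (-((κ : ℂ) * τ)).re = -(κ * τ) := by simp
  rw [hre, hre2]
  have : 0 ≤ 2 * (k : ℝ) * (-τ) := by have := neg_nonneg.2 hτ; positivity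
  rw [hδ]
  nlinarith

/-! ### Uniqueness for the Bessel equation -/

/-- Meant for Wronskians, which are constant in the logarithmic variable and can thus be read off at
`-∞`. -/
theorem eq_of_hasDerivAt_zero_of_tendsto_atBot {f : ℝ → ℂ} {L : ℂ} (hf : ∀ τ, HasDerivAt f 0 τ)
    (hL : Tendsto f atBot (𝓝 L)) (τ : ℝ) : f τ = L := by
  have hconst : ∀ s, f s = f τ := fun s ↦
    is_const_of_deriv_eq_zero (fun x ↦ (hf x).differentiableAt) (fun x ↦ (hf x).deriv) s τ
  exact tendsto_nhds_unique (tendsto_const_nhds.congr fun s ↦ (hconst s).symm) hL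

theorem tendsto_frobeniusSeries_atBot (j : ℕ) {a b : ℂ} {ρ : ℝ} (h : a + b = ρ) :
    Tendsto (fun τ : ℝ ↦ Complex.exp (-(ρ * τ)) * frobeniusSeries j a b τ) atBot
      (𝓝 (ρ ^ j * frobeniusCoeff a b 0 * Complex.exp (-(ρ * Real.log 2)))) := by
  have key := (tendsto_frobeniusSeries_sub_atBot j (a := a) (b := b) (κ := ρ) (by simp [h])).add_const
    (ρ ^ j * frobeniusCoeff a b 0 * Complex.exp (-(ρ * Real.log 2)))
  rw [zero_add] at key
  refine key.congr fun τ ↦ ?_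
  have e : Complex.exp (-(ρ * τ)) * Complex.exp (ρ * (τ - Real.log 2)) =
      Complex.exp (-(ρ * Real.log 2)) := by
    rw [← Complex.exp_add]; congr 1; ring
  rw [h, ← e]
  ring

theorem hasDerivAt_frobeniusSeries_ofReal (j : ℕ) (a b : ℂ) (τ : ℝ) :
    HasDerivAt (fun τ : ℝ ↦ frobeniusSeries j a b τ) (frobeniusSeries (j + 1) a b τ) τ :=
  (hasDerivAt_frobeniusSeries j a b τ).comp_ofReal

theorem frobeniusCoeff_zero_ne_zero {a b : ℂ} (ha : 0 < (a + 1).re) (hb : 0 < (b + 1).re) :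
    frobeniusCoeff a b 0 ≠ 0 := by
  rw [frobeniusCoeff_zero]
  exact mul_ne_zero (inv_ne_zero (Complex.Gamma_ne_zero_of_re_pos ha))
    (inv_ne_zero (Complex.Gamma_ne_zero_of_re_pos hb))

theorem tendsto_cexp_mul_ofReal_atBot {κ : ℝ} (hκ : 0 < κ) :
    Tendsto (fun τ : ℝ ↦ Complex.exp (κ * τ)) atBot (𝓝 0) := by
  refine squeeze_zero_norm (a := fun τ ↦ Real.exp (κ * τ)) (fun τ ↦ ?_)
    (Real.tendsto_exp_atBot.comp (tendsto_id.const_mul_atBot hκ))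
  rw [norm_cexp_mul_ofReal, Complex.ofReal_re]

/-- A solution of the Bessel equation which is `o(z^ν)` at `0`, along with its Euler derivatives,
vanishes identically. -/
theorem eq_zero_of_bessel_equation {ν : ℝ} (hν0 : 0 < ν) (hν1 : ν < 1) {y y' : ℝ → ℂ}
    (hy : ∀ τ, HasDerivAt y (y' τ) τ)
    (hy' : ∀ τ : ℝ, HasDerivAt y' ((ν ^ 2 - Complex.exp (2 * τ)) * y τ) τ)
    (h1 : Tendsto (fun τ : ℝ ↦ Complex.exp (-(ν * τ)) * y' τ) atBot (𝓝 0))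
    (h2 : Tendsto (fun τ : ℝ ↦ Complex.exp (-(ν * τ)) * ((ν ^ 2 - Complex.exp (2 * τ)) * y τ))
      atBot (𝓝 0)) (τ : ℝ) : y τ = 0 := by
  have hνc : (ν : ℂ) ≠ 0 := by exact_mod_cast hν0.ne'
  -- The equation bounds `y` by its second derivative, since `ν² - e^(2τ)` tends to `ν² ≠ 0`.
  have h0 : Tendsto (fun τ : ℝ ↦ Complex.exp (-(ν * τ)) * y τ) atBot (𝓝 0) := by
    have t1 : Tendsto (fun τ : ℝ ↦ (ν : ℂ) ^ 2 - Complex.exp (2 * τ)) atBot (𝓝 ((ν : ℂ) ^ 2)) := by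
      have := tendsto_cexp_mul_ofReal_atBot two_pos
      simpa using this.const_sub ((ν : ℂ) ^ 2)
    have t2 := (t1.inv₀ (pow_ne_zero 2 hνc)).mul h2
    rw [mul_zero] at t2
    refine t2.congr' ?_
    filter_upwards [t1.eventually_ne (pow_ne_zero 2 hνc)] with τ hτ
    field_simp
  -- `P` and `N` are the solutions `J_ν` and `J_(-ν)`, of sizes `e^(ντ)` and `e^(-ντ)` at `-∞`. The
  -- Wronskian of `y` with each of them tends to `0`, while that of `P` and `N` does not.
  set P : ℕ → ℝ → ℂ := fun j τ ↦ frobeniusSeries j 0 ν τ with hP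
  set N : ℕ → ℝ → ℂ := fun j τ ↦ frobeniusSeries j (-ν) 0 τ with hN
  have dP : ∀ j τ, HasDerivAt (P j) (P (j + 1) τ) τ := fun j τ ↦
    hasDerivAt_frobeniusSeries_ofReal j _ _ τ
  have dN : ∀ j τ, HasDerivAt (N j) (N (j + 1) τ) τ := fun j τ ↦
    hasDerivAt_frobeniusSeries_ofReal j _ _ τ
  have eP : ∀ τ : ℝ, P 2 τ = (ν ^ 2 - Complex.exp (2 * τ)) * P 0 τ := fun τ ↦ by
    simp [hP, frobeniusSeries_two]
  have eN : ∀ τ : ℝ, N 2 τ = (ν ^ 2 - Complex.exp (2 * τ)) * N 0 τ := fun τ ↦ by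
    simp [hN, frobeniusSeries_two]
  have lP := fun j ↦ tendsto_frobeniusSeries_atBot j (a := 0) (b := ν) (ρ := ν) (by simp)
  have lN := fun j ↦ tendsto_frobeniusSeries_atBot j (a := -ν) (b := 0) (ρ := -ν) (by simp)
  have hPN : ∀ τ : ℝ, Complex.exp (-(ν * τ)) * Complex.exp (-(((-ν : ℝ) : ℂ) * τ)) = 1 := by
    intro τ; rw [← Complex.exp_add]; simp
  have hPP : ∀ τ : ℝ, Complex.exp (((2 * ν : ℝ) : ℂ) * τ) *
      (Complex.exp (-(ν * τ)) * Complex.exp (-(ν * τ))) = 1 := by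
    intro τ; rw [← Complex.exp_add, ← Complex.exp_add, Complex.exp_eq_one_iff]
    exact ⟨0, by push_cast; ring⟩
  have wP : ∀ τ, y τ * P 1 τ - y' τ * P 0 τ = 0 := by
    refine eq_of_hasDerivAt_zero_of_tendsto_atBot (fun τ ↦ ?_) ?_
    · refine (((hy τ).mul (dP 1 τ)).sub ((hy' τ).mul (dP 0 τ))).congr_deriv ?_
      simp only [zero_add, one_add_one_eq_two]
      rw [eP τ]
      ring
    · have t := ((tendsto_cexp_mul_ofReal_atBot (mul_pos two_pos hν0)).mul
        ((h0.mul (lP 1)).sub (h1.mul (lP 0))))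
      simp only [zero_mul, sub_zero, mul_zero] at t
      refine t.congr fun τ ↦ ?_
      simp only [hP]
      linear_combination (y τ * frobeniusSeries 1 0 ν τ - y' τ * frobeniusSeries 0 0 ν τ) * hPP τ
  have wN : ∀ τ, y τ * N 1 τ - y' τ * N 0 τ = 0 := by
    refine eq_of_hasDerivAt_zero_of_tendsto_atBot (fun τ ↦ ?_) ?_
    · refine (((hy τ).mul (dN 1 τ)).sub ((hy' τ).mul (dN 0 τ))).congr_deriv ?_
      simp only [zero_add, one_add_one_eq_two]
      rw [eN τ]
      ring
    · have t := (h0.mul (lN 1)).sub (h1.mul (lN 0))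
      simp only [zero_mul, sub_zero] at t
      refine t.congr fun τ ↦ ?_
      simp only [hN]
      linear_combination (y τ * frobeniusSeries 1 (-ν) 0 τ - y' τ * frobeniusSeries 0 (-ν) 0 τ) *
        hPN τ
  have wPN : ∀ τ, P 1 τ * N 0 τ - P 0 τ * N 1 τ =
      2 * ν * (frobeniusCoeff 0 ν 0 * frobeniusCoeff (-ν) 0 0) := by
    refine eq_of_hasDerivAt_zero_of_tendsto_atBot (fun τ ↦ ?_) ?_
    · refine (((dP 1 τ).mul (dN 0 τ)).sub ((dP 0 τ).mul (dN 1 τ))).congr_deriv ?_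
      simp only [zero_add, one_add_one_eq_two]
      rw [eN τ, eP τ]
      ring
    · have t := ((lP 1).mul (lN 0)).sub ((lP 0).mul (lN 1))
      have e1 := hPN (Real.log 2)
      have e2 : (ν : ℂ) ^ 1 * frobeniusCoeff 0 ν 0 * Complex.exp (-(ν * Real.log 2)) *
          (((-ν : ℝ) : ℂ) ^ 0 * frobeniusCoeff (-ν) 0 0 *
            Complex.exp (-(((-ν : ℝ) : ℂ) * Real.log 2))) -
          (ν : ℂ) ^ 0 * frobeniusCoeff 0 ν 0 * Complex.exp (-(ν * Real.log 2)) *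
          (((-ν : ℝ) : ℂ) ^ 1 * frobeniusCoeff (-ν) 0 0 *
            Complex.exp (-(((-ν : ℝ) : ℂ) * Real.log 2))) =
          2 * ν * (frobeniusCoeff 0 ν 0 * frobeniusCoeff (-ν) 0 0) := by
        push_cast at e1 ⊢
        linear_combination (2 * ν * (frobeniusCoeff 0 ν 0 * frobeniusCoeff (-ν) 0 0)) * e1
      rw [e2] at t
      refine t.congr fun τ ↦ ?_
      simp only [hP, hN]
      linear_combination (frobeniusSeries 1 0 ν τ * frobeniusSeries 0 (-ν) 0 τ -
        frobeniusSeries 0 0 ν τ * frobeniusSeries 1 (-ν) 0 τ) * hPN τ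
  have hW : 2 * ν * (frobeniusCoeff 0 ν 0 * frobeniusCoeff (-ν) 0 0) ≠ 0 := by
    refine mul_ne_zero (mul_ne_zero two_ne_zero hνc) (mul_ne_zero ?_ ?_)
    · exact frobeniusCoeff_zero_ne_zero (by simp) (by simp; linarith)
    · exact frobeniusCoeff_zero_ne_zero (by simp; linarith) (by simp)
  -- Eliminating `y'` between the two vanishing Wronskians leaves `y` times the Wronskian of `P` and
  -- `N`.
  refine (mul_eq_zero.1 ?_).resolve_right hW
  rw [← wPN τ]
  linear_combination N 0 τ * wP τ - P 0 τ * wN τ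

/-! ### The transform as a combination of Frobenius series -/

/-- The combination of Frobenius series which gives the Lommel function `S_{1-p,ν}`, up to
normalization. -/
noncomputable def lommelComb (j : ℕ) (p ν t : ℂ) : ℂ :=
  Complex.sin (Real.pi * ν) * frobeniusSeries j ((2 - p - ν) / 2) ((2 - p + ν) / 2) t +
    Complex.sin (Real.pi * ((p + ν) / 2)) * frobeniusSeries j (-ν) 0 t -
    Complex.sin (Real.pi * ((p - ν) / 2)) * frobeniusSeries j 0 ν t

theorem hasDerivAt_lommelComb (j : ℕ) (p ν : ℂ) (τ : ℝ) :
    HasDerivAt (fun τ : ℝ ↦ lommelComb j p ν τ) (lommelComb (j + 1) p ν τ) τ :=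
  (((hasDerivAt_frobeniusSeries_ofReal j _ _ τ).const_mul _).add
    ((hasDerivAt_frobeniusSeries_ofReal j _ _ τ).const_mul _)).sub
    ((hasDerivAt_frobeniusSeries_ofReal j _ _ τ).const_mul _)

theorem lommelComb_two (p ν t : ℂ) :
    lommelComb 2 p ν t = (ν ^ 2 - Complex.exp (2 * t)) * lommelComb 0 p ν t +
      Complex.sin (Real.pi * ν) * (4 * Complex.exp ((2 - p) * (t - Real.log 2)) *
        ((Complex.Gamma ((2 - p - ν) / 2))⁻¹ * (Complex.Gamma ((2 - p + ν) / 2))⁻¹)) := by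
  simp only [lommelComb, frobeniusSeries_two, Complex.Gamma_zero, inv_zero, mul_zero, zero_mul,
    add_zero, sub_zero]
  ring_nf

theorem sin_pi_mul_Gamma {z : ℂ} (h0 : 0 < z.re) (h1 : z.re < 1) :
    Complex.sin (Real.pi * z) * Complex.Gamma z = Real.pi * (Complex.Gamma (1 - z))⁻¹ := by
  have h := Complex.Gamma_mul_Gamma_one_sub z
  have hg : Complex.Gamma z ≠ 0 := Complex.Gamma_ne_zero_of_re_pos h0
  have hg' : Complex.Gamma (1 - z) ≠ 0 :=
    Complex.Gamma_ne_zero_of_re_pos (by simpa using h1)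
  have hs : Complex.sin (Real.pi * z) ≠ 0 := by
    intro hs
    rw [hs, div_zero] at h
    exact mul_ne_zero hg hg' h
  rw [eq_div_iff hs] at h
  field_simp
  linear_combination h

theorem sin_pi_mul_ofReal_ne_zero {x : ℝ} (h0 : 0 < x) (h1 : x < 1) :
    Complex.sin (Real.pi * (x : ℂ)) ≠ 0 := by
  rw [← Complex.ofReal_mul, ← Complex.ofReal_sin]
  exact_mod_cast (Real.sin_pos_of_pos_of_lt_pi (by positivity)
    (by nlinarith [Real.pi_pos])).ne'

/-- Both sides satisfy the same inhomogeneous equation, so the difference `y` satisfies the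
homogeneous one. The range `0 < ν < p < 1` is the one in which the expansion at the origin is
available; there `y'` and `y''` turn out to be `o(e^(ντ))`. -/
theorem coshTransform_laplaceG_eq_lommelComb_of_real {p ν : ℝ} (hν0 : 0 < ν) (hνp : ν < p)
    (hp1 : p < 1) (τ : ℝ) :
    2 * (Complex.sin (Real.pi * ν) * Complex.sin (Real.pi * ((p + ν) / 2)) *
      Complex.sin (Real.pi * ((p - ν) / 2))) * coshTransform ν (laplaceG p) τ =
      Real.pi ^ 2 * lommelComb 0 p ν τ := by
  have hν1 : ν < 1 := hνp.trans hp1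
  have hre : |(ν : ℂ).re| < (p : ℂ).re := by
    rw [Complex.ofReal_re, Complex.ofReal_re, abs_of_pos hν0]; exact hνp
  set s := Complex.sin (Real.pi * ν) with hs
  set sp := Complex.sin (Real.pi * (((p : ℂ) + ν) / 2)) with hsp
  set sm := Complex.sin (Real.pi * (((p : ℂ) - ν) / 2)) with hsm
  have hsp0 : sp ≠ 0 := by
    have := sin_pi_mul_ofReal_ne_zero (x := (p + ν) / 2) (by linarith) (by linarith)
    rw [hsp]; exact_mod_cast this
  have hsm0 : sm ≠ 0 := by
    have := sin_pi_mul_ofReal_ne_zero (x := (p - ν) / 2) (by linarith) (by linarith)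
    rw [hsm]; exact_mod_cast this
  have hνc : (ν : ℂ) ≠ 0 := by exact_mod_cast hν0.ne'
  have hG1 : Complex.Gamma (1 + ν) ≠ 0 := Complex.Gamma_ne_zero_of_re_pos (by simp; linarith)
  have hG2 : Complex.Gamma (1 - ν) ≠ 0 := Complex.Gamma_ne_zero_of_re_pos (by simp; linarith)
  -- This identity matches the coefficients of both `e^(-ντ)` and `e^(ντ)` in the two expansions.
  have hrefl : s * (Complex.Gamma (1 + ν) * Complex.Gamma (1 - ν)) = Real.pi * ν := by
    have h1 := sin_pi_mul_Gamma (z := ν) (by simpa using hν0) (by simpa using hν1)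
    have h2 := Complex.Gamma_add_one (ν : ℂ) hνc
    rw [add_comm] at h2
    rw [h2]
    have : s * Complex.Gamma ν * Complex.Gamma (1 - ν) = Real.pi := by
      rw [h1]; field_simp
    linear_combination ν * this
  set y : ℝ → ℂ := fun τ ↦ 2 * (s * sp * sm) * coshTransform ν (laplaceG p) τ -
    Real.pi ^ 2 * lommelComb 0 p ν τ with hy
  set y' : ℝ → ℂ := fun τ ↦ 2 * (s * sp * sm) * -coshTransform ν (eulerG p 1) τ -
    Real.pi ^ 2 * lommelComb 1 p ν τ with hy'
  -- The reflection formula, applied to each Gamma factor of the beta integral, converts it into the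
  -- reciprocal Gammas of the forced Frobenius series.
  have hode : ∀ τ : ℝ, 2 * (s * sp * sm) *
      (coshTransform ν (eulerG p 2) τ - coshTransform ν (eulerG p 1) τ) -
      Real.pi ^ 2 * lommelComb 2 p ν τ = (ν ^ 2 - Complex.exp (2 * τ)) * y τ := by
    intro τ
    have g1 := sin_pi_mul_Gamma (z := ((p : ℂ) + ν) / 2)
      (by simp; linarith) (by simp; linarith)
    have g2 := sin_pi_mul_Gamma (z := ((p : ℂ) - ν) / 2)
      (by simp; linarith) (by simp; linarith)
    rw [show 1 - ((p : ℂ) + ν) / 2 = (2 - p - ν) / 2 by ring] at g1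
    rw [show 1 - ((p : ℂ) - ν) / 2 = (2 - p + ν) / 2 by ring] at g2
    have e1 : Complex.exp ((2 - p) * τ) * Complex.exp ((p - 1) * Real.log 2) =
        2 * Complex.exp ((2 - p) * (τ - Real.log 2)) := by
      have : (2 : ℂ) = Complex.exp (Real.log 2 : ℝ) := by
        rw [← Complex.ofReal_exp, Real.exp_log two_pos]; norm_num
      nth_rewrite 2 [this]
      rw [← Complex.exp_add, ← Complex.exp_add]
      congr 1; ring
    rw [coshTransform_eulerG_two_sub hre, lommelComb_two, hy]
    have g12 : (sp * Complex.Gamma (((p : ℂ) + ν) / 2)) * (sm * Complex.Gamma (((p : ℂ) - ν) / 2)) =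
        (Real.pi * (Complex.Gamma ((2 - p - ν) / 2))⁻¹) *
          (Real.pi * (Complex.Gamma ((2 - p + ν) / 2))⁻¹) := by rw [g1, g2]
    linear_combination 2 * s * Complex.exp ((2 - p) * τ) * Complex.exp ((p - 1) * Real.log 2) * g12 +
      2 * s * ((Real.pi * (Complex.Gamma ((2 - p - ν) / 2))⁻¹) *
          (Real.pi * (Complex.Gamma ((2 - p + ν) / 2))⁻¹)) * e1
  have hdy : ∀ τ, HasDerivAt y (y' τ) τ := fun τ ↦
    ((hasDerivAt_coshTransform_laplaceG hre τ).const_mul _).sub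
      ((hasDerivAt_lommelComb 0 p ν τ).const_mul _)
  have hdy' : ∀ τ : ℝ, HasDerivAt y' ((ν ^ 2 - Complex.exp (2 * τ)) * y τ) τ := fun τ ↦ by
    refine (((hasDerivAt_coshTransform_eulerG hre 1 τ).neg.const_mul _).sub
      ((hasDerivAt_lommelComb 1 p ν τ).const_mul _)).congr_deriv ?_
    rw [← hode τ]
    push_cast
    ring
  have hlead : ∀ τ : ℝ, Complex.exp ((-ν + 0 : ℂ) * (τ - Real.log 2)) =
      Complex.exp (ν * Real.log 2) * Complex.exp (-(ν * τ)) := fun τ ↦ by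
    rw [← Complex.exp_add]; congr 1; ring
  -- The forced series has size `e^((2-p)τ)`, and `2 - p > ν`, so it does not enter the comparison.
  have hF0 : ∀ j, Tendsto (fun τ : ℝ ↦ Complex.exp (-(ν * τ)) *
      frobeniusSeries j ((2 - p - ν) / 2) ((2 - p + ν) / 2) τ) atBot (𝓝 0) := by
    intro j
    have t := (tendsto_cexp_mul_ofReal_atBot (κ := 2 - p - ν) (by linarith)).mul
      (tendsto_frobeniusSeries_atBot j (a := (2 - p - ν) / 2) (b := (2 - p + ν) / 2) (ρ := 2 - p)
        (by push_cast; ring))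
    rw [zero_mul] at t
    refine t.congr fun τ ↦ ?_
    rw [← mul_assoc, ← Complex.exp_add]
    congr 2; push_cast; ring
  -- For `J_(-ν)` the leading term exceeds `e^(ντ)` and must be kept explicitly; the next one is
  -- negligible because `2 - ν > ν`.
  have hF1 := fun j ↦ tendsto_frobeniusSeries_sub_atBot j (a := -ν) (b := 0) (κ := ν)
    (by simp; linarith)
  have hF2 := fun j ↦ tendsto_frobeniusSeries_atBot j (a := 0) (b := ν) (ρ := ν) (by simp)
  simp_rw [hlead] at hF1
  have hM := fun k ↦ tendsto_coshTransform_eulerG_atBot hν0 hνp hp1 k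
  rw [← hsp, ← hsm] at hM
  have hcN : frobeniusCoeff (-ν) 0 0 = (Complex.Gamma (1 - ν))⁻¹ := by
    rw [frobeniusCoeff_zero, zero_add, Complex.Gamma_one, inv_one, mul_one]; ring_nf
  have hcP : frobeniusCoeff 0 ν 0 = (Complex.Gamma (1 + ν))⁻¹ := by
    rw [frobeniusCoeff_zero, zero_add, Complex.Gamma_one, inv_one, one_mul]; ring_nf
  have hGm1 : Complex.Gamma (-ν + (0 + 1 : ℕ)) = Complex.Gamma (1 - ν) := by
    congr 1; push_cast; ring
  have hGp1 : Complex.Gamma (ν + (0 + 1 : ℕ)) = Complex.Gamma (1 + ν) := by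
    congr 1; push_cast; ring
  have hGm2 : Complex.Gamma (-ν + (1 + 1 : ℕ)) = (1 - ν) * Complex.Gamma (1 - ν) := by
    rw [← Complex.Gamma_add_one]
    · congr 1; push_cast; ring
    · intro h
      have := congrArg Complex.re h
      simp at this
      linarith
  have hGp2 : Complex.Gamma (ν + (1 + 1 : ℕ)) = (1 + ν) * Complex.Gamma (1 + ν) := by
    rw [← Complex.Gamma_add_one]
    · congr 1; push_cast; ring
    · intro h
      have := congrArg Complex.re h
      simp at this
      linarith
  have hM1 := hM 0
  have hM2 := hM 1
  rw [hGm1, hGp1] at hM1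
  rw [hGm2, hGp2] at hM2
  rw [hcN] at hF1
  rw [hcP] at hF2
  have l1 : Tendsto (fun τ : ℝ ↦ Complex.exp (-(ν * τ)) * y' τ) atBot (𝓝 0) := by
    have t := (((hM1.const_mul (-(2 * (s * sp * sm)))).sub ((hF0 1).const_mul (Real.pi ^ 2 * s))).sub
      ((hF1 1).const_mul (Real.pi ^ 2 * sp))).add ((hF2 1).const_mul (Real.pi ^ 2 * sm))
    refine (t.congr fun τ ↦ ?_).trans_eq ?_
    · rw [hy']
      simp only [lommelComb]
      rw [← hs, ← hsp, ← hsm]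
      field_simp
      linear_combination (sp * Complex.exp (-(ν * τ)) * Complex.exp (ν * Real.log 2) *
        Real.pi) * hrefl
    · congr 1
      field_simp
      linear_combination (-(Real.pi * sm * Complex.exp (-(ν * Real.log 2)))) * hrefl
  have l2 : Tendsto (fun τ : ℝ ↦ Complex.exp (-(ν * τ)) * ((ν ^ 2 - Complex.exp (2 * τ)) * y τ))
      atBot (𝓝 0) := by
    have t := ((((hM2.sub hM1).const_mul (2 * (s * sp * sm))).sub
      ((hF0 2).const_mul (Real.pi ^ 2 * s))).sub
      ((hF1 2).const_mul (Real.pi ^ 2 * sp))).add ((hF2 2).const_mul (Real.pi ^ 2 * sm))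
    refine (t.congr fun τ ↦ ?_).trans_eq ?_
    · rw [← hode τ]
      simp only [lommelComb]
      rw [← hs, ← hsp, ← hsm]
      field_simp
      linear_combination (-ν * sp * Complex.exp (-(ν * τ)) * Complex.exp (ν * Real.log 2) *
        Real.pi) * hrefl
    · congr 1
      field_simp
      linear_combination (-(Real.pi * sm * Complex.exp (-(ν * Real.log 2))) * ν) * hrefl
  have := eq_zero_of_bessel_equation hν0 hν1 hdy hdy' l1 l2 τ
  rw [hy] at this
  exact sub_eq_zero.1 this

theorem eqOn_of_eventually_eq_ofReal {f g : ℂ → ℂ} {U : Set ℂ} (hU : IsOpen U)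
    (hc : IsPreconnected U) (hf : DifferentiableOn ℂ f U) (hg : DifferentiableOn ℂ g U) {x₀ : ℝ}
    (hx₀ : (x₀ : ℂ) ∈ U) (h : ∀ᶠ x : ℝ in 𝓝 x₀, f x = g x) : EqOn f g U := by
  refine (hf.analyticOnNhd hU).eqOn_of_preconnected_of_frequently_eq (hg.analyticOnNhd hU) hc hx₀ ?_
  have ht : Tendsto (fun x : ℝ ↦ (x : ℂ)) (𝓝[≠] x₀) (𝓝[≠] (x₀ : ℂ)) := by
    refine tendsto_nhdsWithin_iff.2 ⟨(Complex.continuous_ofReal.tendsto x₀).mono_left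
      nhdsWithin_le_nhds, ?_⟩
    filter_upwards [self_mem_nhdsWithin] with x hx
    simpa using hx
  exact ht.frequently (h.filter_mono nhdsWithin_le_nhds).frequently

theorem differentiable_lommelComb_left (ν t : ℂ) : Differentiable ℂ fun p ↦ lommelComb 0 p ν t := by
  have h1 := differentiable_frobeniusSeries_param (a := fun p : ℂ ↦ (2 - p - ν) / 2)
    (b := fun p ↦ (2 - p + ν) / 2) (by fun_prop) (by fun_prop) t
  simp only [lommelComb]
  fun_prop

theorem differentiable_lommelComb_right (p t : ℂ) :
    Differentiable ℂ fun ν ↦ lommelComb 0 p ν t := by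
  have h1 := differentiable_frobeniusSeries_param (a := fun ν : ℂ ↦ (2 - p - ν) / 2)
    (b := fun ν ↦ (2 - p + ν) / 2) (by fun_prop) (by fun_prop) t
  have h2 := differentiable_frobeniusSeries_param (a := fun ν : ℂ ↦ -ν)
    (b := fun _ ↦ 0) (by fun_prop) (by fun_prop) t
  have h3 := differentiable_frobeniusSeries_param (a := fun _ : ℂ ↦ 0)
    (b := fun ν ↦ ν) (by fun_prop) (by fun_prop) t
  simp only [lommelComb]
  fun_prop

/-- The identity theorem is applied twice: in `p` on the half-plane `Re p > ν` for fixed real `ν` in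
`(0,1)`, starting from the segment `(ν,1)`, then in `ν` on the strip `|Re ν| < Re p`, starting from
`(0, min 1 (Re p))`. -/
theorem coshTransform_laplaceG_eq_lommelComb {p ν : ℂ} (h : |ν.re| < p.re) (τ : ℝ) :
    2 * (Complex.sin (Real.pi * ν) * Complex.sin (Real.pi * ((p + ν) / 2)) *
      Complex.sin (Real.pi * ((p - ν) / 2))) * coshTransform ν (laplaceG p) τ =
      Real.pi ^ 2 * lommelComb 0 p ν τ := by
  have hp : 0 < p.re := (abs_nonneg _).trans_lt h
  have step : ∀ ν : ℝ, 0 < ν → ν < 1 → ∀ p : ℂ, ν < p.re →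
      2 * (Complex.sin (Real.pi * ν) * Complex.sin (Real.pi * ((p + ν) / 2)) *
        Complex.sin (Real.pi * ((p - ν) / 2))) * coshTransform ν (laplaceG p) τ =
        Real.pi ^ 2 * lommelComb 0 p ν τ := by
    intro ν hν0 hν1 p hp
    refine eqOn_of_eventually_eq_ofReal (U := {p : ℂ | ν < p.re})
      (f := fun p ↦ 2 * (Complex.sin (Real.pi * ν) * Complex.sin (Real.pi * ((p + ν) / 2)) *
        Complex.sin (Real.pi * ((p - ν) / 2))) * coshTransform ν (laplaceG p) τ)
      (g := fun p ↦ Real.pi ^ 2 * lommelComb 0 p ν τ) (x₀ := (ν + 1) / 2)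
      (isOpen_lt continuous_const Complex.continuous_re) (convex_halfSpace_re_gt ν).isPreconnected
      (fun q hq ↦ ?_) ((differentiable_lommelComb_left ν τ).const_mul _).differentiableOn
      (by simp only [mem_ofPred_eq, Complex.ofReal_re]; linarith) ?_ hp
    · have hd := differentiableAt_coshTransform_left (p := q) (ν := ν)
        (by rw [Complex.ofReal_re, abs_of_pos hν0]; exact hq) τ
      exact DifferentiableAt.differentiableWithinAt (by fun_prop)
    · filter_upwards [Ioo_mem_nhds (show ν < (ν + 1) / 2 by linarith)
        (show (ν + 1) / 2 < 1 by linarith)] with q hq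
      exact coshTransform_laplaceG_eq_lommelComb_of_real hν0 hq.1 hq.2 τ
  have hconv : Convex ℝ {ν : ℂ | |ν.re| < p.re} := by
    have : {ν : ℂ | |ν.re| < p.re} = {ν : ℂ | -p.re < ν.re} ∩ {ν : ℂ | ν.re < p.re} := by
      ext z; simp [abs_lt]
    rw [this]
    exact (convex_halfSpace_re_gt _).inter (convex_halfSpace_re_lt _)
  set m := min 1 p.re with hm
  have hm0 : 0 < m := lt_min one_pos hp
  refine eqOn_of_eventually_eq_ofReal (U := {ν : ℂ | |ν.re| < p.re})
      (f := fun ν ↦ 2 * (Complex.sin (Real.pi * ν) * Complex.sin (Real.pi * ((p + ν) / 2)) *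
        Complex.sin (Real.pi * ((p - ν) / 2))) * coshTransform ν (laplaceG p) τ)
      (g := fun ν ↦ Real.pi ^ 2 * lommelComb 0 p ν τ) (x₀ := m / 2)
      (isOpen_lt (by fun_prop) continuous_const) hconv.isPreconnected
      (fun q hq ↦ ?_) ((differentiable_lommelComb_right p τ).const_mul _).differentiableOn ?_ ?_ h
  · have hd := differentiableAt_coshTransform_right (p := p) (ν := q) hq τ
    exact DifferentiableAt.differentiableWithinAt (by fun_prop)
  · simp only [mem_ofPred_eq, Complex.ofReal_re]
    rw [abs_of_pos (by positivity)]
    linarith [min_le_right 1 p.re]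
  · filter_upwards [Ioo_mem_nhds (show 0 < m / 2 by linarith) (show m / 2 < m by linarith)] with q hq
    exact step q hq.1 (hq.2.trans_le (min_le_left _ _)) p (hq.2.trans_le (min_le_right _ _))

/-! ### The elementary case of order one half -/

/-- By symmetry `e^(u/2)` may be replaced by `cosh(u/2)`. The substitution `v = sinh(u/2)`, with
`cosh u = 1 + 2v²`, then gives a Gaussian integral. -/
theorem integral_cexp_half_mul_exp_neg_mul_cosh {c : ℝ} (hc : 0 < c) :
    ∫ u : ℝ, Real.exp (u / 2) * Real.exp (-(c * Real.cosh u)) =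
      Real.sqrt (2 * Real.pi / c) * Real.exp (-c) := by
  have hsurj : range (fun u : ℝ ↦ Real.sinh (u / 2)) = univ := by
    rw [range_eq_univ]
    intro y
    obtain ⟨x, hx⟩ := Real.sinh_surjective y
    exact ⟨2 * x, by simp [hx]⟩
  have hinj : InjOn (fun u : ℝ ↦ Real.sinh (u / 2)) univ := by
    intro x _ y _ hxy
    have := Real.sinh_injective hxy
    linarith
  have hder : ∀ u ∈ (univ : Set ℝ), HasDerivWithinAt (fun u : ℝ ↦ Real.sinh (u / 2))
      (Real.cosh (u / 2) / 2) univ u := by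
    intro u _
    have := (Real.hasDerivAt_sinh (u / 2)).comp u ((hasDerivAt_id u).div_const 2)
    exact (this.congr_deriv (by ring)).hasDerivWithinAt
  have key := integral_image_eq_integral_abs_deriv_smul MeasurableSet.univ hder hinj
    (fun v ↦ 2 * Real.exp (-c) * Real.exp (-(2 * c) * v ^ 2))
  have hkint : Integrable fun v : ℝ ↦ 2 * Real.exp (-c) * Real.exp (-(2 * c) * v ^ 2) :=
    (integrable_exp_neg_mul_sq (by positivity)).const_mul _
  have hiint := integrableOn_image_iff_integrableOn_abs_deriv_smul MeasurableSet.univ hder hinj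
    (fun v ↦ 2 * Real.exp (-c) * Real.exp (-(2 * c) * v ^ 2))
  rw [image_univ, hsurj] at key hiint
  simp only [integrableOn_univ, Measure.restrict_univ, smul_eq_mul] at key hiint
  have hpt : ∀ u : ℝ, |Real.cosh (u / 2) / 2| *
      (2 * Real.exp (-c) * Real.exp (-(2 * c) * Real.sinh (u / 2) ^ 2)) =
      Real.cosh (u / 2) * Real.exp (-(c * Real.cosh u)) := by
    intro u
    have hch := Real.cosh_pos (u / 2)
    have e1 : Real.cosh u = 1 + 2 * Real.sinh (u / 2) ^ 2 := by
      have := Real.cosh_two_mul (u / 2)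
      rw [mul_div_cancel₀ u two_ne_zero, Real.cosh_sq] at this
      linarith
    rw [abs_of_pos (by positivity), e1,
      show -(c * (1 + 2 * Real.sinh (u / 2) ^ 2)) = -c + -(2 * c) * Real.sinh (u / 2) ^ 2 by ring,
      Real.exp_add]
    ring
  simp_rw [hpt] at key hiint
  have hsym : ∫ u : ℝ, Real.exp (u / 2) * Real.exp (-(c * Real.cosh u)) =
      ∫ u : ℝ, Real.cosh (u / 2) * Real.exp (-(c * Real.cosh u)) := by
    have hI := hiint.1 hkint
    have hle : ∀ u : ℝ, Real.exp (u / 2) ≤ 2 * Real.cosh (u / 2) := fun u ↦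
      (Real.exp_le_exp.2 (le_abs_self _)).trans (exp_abs_le_two_mul_cosh _)
    have h1 : Integrable fun u : ℝ ↦ Real.exp (u / 2) * Real.exp (-(c * Real.cosh u)) := by
      refine (hI.const_mul 2).mono' (by fun_prop) (Eventually.of_forall fun u ↦ ?_)
      rw [Real.norm_of_nonneg (by positivity), ← mul_assoc]
      gcongr
      exact hle u
    have h2 := integral_neg_eq_self
      (fun u : ℝ ↦ Real.exp (u / 2) * Real.exp (-(c * Real.cosh u))) volume
    have h3 := h1.comp_neg
    have h4 := integral_add h1 h3
    rw [h2] at h4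
    have h5 : ∀ u : ℝ, Real.exp (u / 2) * Real.exp (-(c * Real.cosh u)) +
        Real.exp (-u / 2) * Real.exp (-(c * Real.cosh (-u))) =
        2 * (Real.cosh (u / 2) * Real.exp (-(c * Real.cosh u))) := by
      intro u
      rw [Real.cosh_neg, Real.cosh_eq (u / 2), neg_div]
      ring
    simp_rw [h5] at h4
    rw [integral_const_mul] at h4
    linarith
  rw [hsym, ← key, integral_const_mul, integral_gaussian]
  have : Real.sqrt (2 * Real.pi / c) = 2 * Real.sqrt (Real.pi / (2 * c)) := by
    rw [show 2 * Real.pi / c = 2 ^ 2 * (Real.pi / (2 * c)) by field_simp,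
      Real.sqrt_mul (by positivity), Real.sqrt_sq (by norm_num)]
  rw [this]
  ring

/-- Integrating over `u` first produces a factor `t^(-1/2)`, which lowers the parameter `p + 1/2` of
the Laplace integral to `p`. -/
theorem coshTransform_half {p : ℂ} (hp : 0 < p.re) (τ : ℝ) :
    coshTransform (1 / 2) (laplaceG (p + 1 / 2)) τ =
      (Real.sqrt (2 * Real.pi) * Real.exp (-(τ / 2)) : ℝ) * laplaceG p (Real.exp τ) := by
  have hre : |(1 / 2 : ℂ).re| < (p + 1 / 2).re := by
    have : (1 / 2 : ℂ).re = 1 / 2 := by norm_num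
    rw [Complex.add_re, this, abs_of_pos (by norm_num)]
    linarith
  have hint := integrable_cexp_mul_lommelKernel hre τ
  rw [coshTransform_laplaceG_eq_integral hre, Measure.volume_eq_prod] at *
  rw [integral_prod_symm _ hint, laplaceG, ← integral_const_mul]
  congr 1
  ext r
  have hK := integral_cexp_half_mul_exp_neg_mul_cosh (c := Real.exp τ * Real.exp r) (by positivity)
  have e1 : ∀ u : ℝ, Complex.exp (1 / 2 * u) * (Complex.exp ((p + 1 / 2) * r) *
      (lommelKernel τ (u, r) : ℝ)) = Complex.exp ((p + 1 / 2) * r) * ((1 + Real.exp (2 * r))⁻¹ : ℝ) *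
      ((Real.exp (u / 2) * Real.exp (-(Real.exp τ * Real.exp r * Real.cosh u)) : ℝ) : ℂ) := by
    intro u
    simp only [lommelKernel]
    rw [show Real.exp τ * Real.cosh u * Real.exp r = Real.exp τ * Real.exp r * Real.cosh u by ring,
      show (1 / 2 * u : ℂ) = ((u / 2 : ℝ) : ℂ) by push_cast; ring, ← Complex.ofReal_exp]
    push_cast
    ring
  simp_rw [e1]
  rw [integral_const_mul, integral_complex_ofReal, hK]
  have e2 : Real.sqrt (2 * Real.pi / (Real.exp τ * Real.exp r)) =
      Real.sqrt (2 * Real.pi) * Real.exp (-(τ / 2)) * Real.exp (-(r / 2)) := by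
    rw [Real.sqrt_div (by positivity), ← Real.exp_add,
      show τ + r = τ / 2 + r / 2 + (τ / 2 + r / 2) by ring, Real.exp_add (τ / 2 + r / 2),
      Real.sqrt_mul_self (Real.exp_pos _).le, div_eq_mul_inv, ← Real.exp_neg, mul_assoc,
      ← Real.exp_add]
    ring_nf
  have e3 : Complex.exp ((p + 1 / 2) * r) * (Real.exp (-(r / 2)) : ℝ) = Complex.exp (p * r) := by
    rw [Complex.ofReal_exp, ← Complex.exp_add]
    congr 1; push_cast; ring
  rw [e2, ← e3]
  push_cast
  ring

/-! ### Integral representation of the Lommel functions -/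

theorem frobeniusSeries_symm (j : ℕ) (a b t : ℂ) :
    frobeniusSeries j a b t = frobeniusSeries j b a t := by
  simp only [frobeniusSeries, frobeniusTerm, frobeniusCoeff, add_comm a b]
  congr 1
  ext k
  ring

theorem cexp_mul_log_sub_log_two (w : ℂ) {z : ℝ} (hz : 0 < z) :
    Complex.exp (w * (Real.log z - Real.log 2)) = (z / 2 : ℂ) ^ w := by
  have h0 : (z / 2 : ℂ) ≠ 0 := by
    have : (z : ℂ) ≠ 0 := by exact_mod_cast hz.ne'
    exact div_ne_zero this two_ne_zero
  rw [Complex.cpow_def_of_ne_zero h0, ← Complex.ofReal_sub,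
    ← Real.log_div hz.ne' two_ne_zero, Complex.ofReal_log (by positivity)]
  push_cast
  ring_nf

theorem cexp_two_mul_nat_mul_log_sub_log_two (k : ℕ) {z : ℝ} (hz : 0 < z) :
    Complex.exp (2 * k * (Real.log z - Real.log 2)) = ((z : ℂ) ^ 2 / 4) ^ k := by
  rw [cexp_mul_log_sub_log_two _ hz, show (2 * k : ℂ) = ((2 * k : ℕ) : ℂ) by push_cast; ring,
    Complex.cpow_natCast, pow_mul, div_pow]
  norm_num

theorem besselJ_eq_frobeniusSeries (ν : ℂ) {z : ℝ} (hz : 0 < z) :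
    besselJ ν z = frobeniusSeries 0 0 ν (Real.log z) := by
  rw [besselJ, frobeniusSeries, ← tsum_mul_left]
  congr 1
  ext k
  rw [frobeniusTerm, frobeniusCoeff, zero_add, zero_add, Complex.Gamma_nat_eq_factorial, add_mul,
    Complex.exp_add, cexp_mul_log_sub_log_two ν hz, cexp_two_mul_nat_mul_log_sub_log_two k hz,
    pow_zero, one_mul, ← mul_inv, div_eq_mul_inv]
  ring

/-- The numerator parameter `1` of the hypergeometric series has `(1)_k = k!`, which cancels the
factorial and leaves only the two reciprocal Gammas. -/
theorem lommels_eq_frobeniusSeries {μ ν : ℂ} {z : ℝ} (hz : 0 < z)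
    (ha : (μ - ν + 1) / 2 ≠ 0) (hb : (μ + ν + 1) / 2 ≠ 0) :
    lommels μ ν z = 2 ^ (μ - 1) * (Complex.Gamma ((μ - ν + 1) / 2) *
      Complex.Gamma ((μ + ν + 1) / 2)) *
      frobeniusSeries 0 ((μ - ν + 1) / 2) ((μ + ν + 1) / 2) (Real.log z) := by
  have hz' : (z : ℂ) ≠ 0 := by exact_mod_cast hz.ne'
  rw [lommels, hyp1F2, show (μ - ν + 3) / 2 = (μ - ν + 1) / 2 + 1 by ring,
    show (μ + ν + 3) / 2 = (μ + ν + 1) / 2 + 1 by ring, Complex.Gamma_add_one _ ha,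
    Complex.Gamma_add_one _ hb]
  have hsum : Complex.regularizedHGFun {1} {(μ - ν + 1) / 2 + 1, (μ + ν + 1) / 2 + 1}
      (-(1 / 4) * (z : ℂ) ^ 2) = ∑' k : ℕ, frobeniusCoeff ((μ - ν + 1) / 2) ((μ + ν + 1) / 2) k *
        Complex.exp (2 * k * (Real.log z - Real.log 2)) := by
    rw [Complex.regularizedHGFun, Complex.regularizedHGFunSeries]
    change FormalMultilinearSeries.ofScalarsSum _ _ = _
    rw [FormalMultilinearSeries.ofScalarsSum_eq_tsum]
    refine tsum_congr fun k ↦ ?_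
    have hk : (k.factorial : ℂ) ≠ 0 := by exact_mod_cast k.factorial_ne_zero
    rw [cexp_two_mul_nat_mul_log_sub_log_two k hz, Complex.regularizedHGFunCoeff, frobeniusCoeff]
    simp only [Multiset.map_singleton, Multiset.prod_singleton, Multiset.insert_eq_cons,
      Multiset.map_cons, Multiset.prod_cons, ascPochhammer_eval_one, smul_eq_mul]
    rw [show -(1 / 4) * (z : ℂ) ^ 2 = (-1) * ((z : ℂ) ^ 2 / 4) by ring, mul_pow,
      show (μ - ν + 1) / 2 + 1 + (k : ℂ) = (μ - ν + 1) / 2 + k + 1 by ring,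
      show (μ + ν + 1) / 2 + 1 + (k : ℂ) = (μ + ν + 1) / 2 + k + 1 by ring,
      div_mul_cancel_left₀ hk, mul_inv]
    ring
  have hser : frobeniusSeries 0 ((μ - ν + 1) / 2) ((μ + ν + 1) / 2) (Real.log z) =
      (z / 2 : ℂ) ^ (μ + 1) *
      ∑' k : ℕ, frobeniusCoeff ((μ - ν + 1) / 2) ((μ + ν + 1) / 2) k *
        Complex.exp (2 * k * (Real.log z - Real.log 2)) := by
    rw [frobeniusSeries, ← tsum_mul_left]
    congr 1
    ext k
    rw [frobeniusTerm, show (μ - ν + 1) / 2 + (μ + ν + 1) / 2 + 2 * (k : ℂ) = μ + 1 + 2 * k by ring,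
      add_mul (μ + 1), Complex.exp_add, cexp_mul_log_sub_log_two _ hz]
    ring
  have hpow : (2 : ℂ) ^ (μ - 1) * (z / 2 : ℂ) ^ (μ + 1) = (z : ℂ) ^ (μ + 1) / 4 := by
    have e1 : (z : ℂ) ^ (μ + 1) = (2 : ℂ) ^ (μ + 1) * (z / 2 : ℂ) ^ (μ + 1) := by
      have := Complex.mul_cpow_ofReal_nonneg (a := 2) (b := z / 2) (by norm_num) (by positivity) (μ + 1)
      rw [← Complex.ofReal_mul, mul_div_cancel₀ z two_ne_zero] at this
      simpa using this
    have e2 : (2 : ℂ) ^ (μ + 1) = 2 ^ (μ - 1) * 4 := by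
      rw [show μ + 1 = μ - 1 + 2 by ring, Complex.cpow_add _ _ two_ne_zero]
      norm_num
    rw [e1, e2]; ring
  rw [hsum, hser]
  generalize (∑' k : ℕ, frobeniusCoeff ((μ - ν + 1) / 2) ((μ + ν + 1) / 2) k *
    Complex.exp (2 * k * (Real.log z - Real.log 2))) = S
  have ha' : μ - ν + 1 ≠ 0 := fun h ↦ ha (by rw [h, zero_div])
  have hb' : μ + ν + 1 ≠ 0 := fun h ↦ hb (by rw [h, zero_div])
  field_simp
  linear_combination (-4 * Complex.Gamma ((μ - ν + 1) / 2) * Complex.Gamma ((μ + ν + 1) / 2) *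
    S) * hpow

/-- `Complex.Gamma` takes the value `0` exactly at its poles, so nonvanishing expresses that the
coefficients of the defining formula are regular. -/
theorem not_lommelExceptional_iff {μ ν : ℂ} : ¬LommelExceptional μ ν ↔
    Complex.Gamma ((μ - ν + 1) / 2) ≠ 0 ∧ Complex.Gamma ((μ + ν + 1) / 2) ≠ 0 := by
  rw [← not_or, not_iff_not, LommelExceptional, Complex.Gamma_eq_zero_iff,
    Complex.Gamma_eq_zero_iff, ← exists_or]
  refine exists_congr fun k ↦ ?_
  rw [or_comm]
  refine or_congr ?_ ?_ <;> constructor <;> intro h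
  · linear_combination (1 / 2 : ℂ) * h
  · linear_combination 2 * h
  · linear_combination (1 / 2 : ℂ) * h
  · linear_combination 2 * h

theorem ne_zero_of_Gamma_ne_zero {s : ℂ} (h : Complex.Gamma s ≠ 0) : s ≠ 0 := by
  rintro rfl
  exact h Complex.Gamma_zero

theorem Gamma_mul_sin_pi_mul_Gamma {s : ℂ} (h : Complex.Gamma s ≠ 0)
    (h' : Complex.Gamma (1 - s) ≠ 0) :
    Complex.sin (Real.pi * s) * (Complex.Gamma s * Complex.Gamma (1 - s)) = Real.pi := by
  have key := Complex.Gamma_mul_Gamma_one_sub s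
  have hs : Complex.sin (Real.pi * s) ≠ 0 := by
    intro hs
    rw [hs, div_zero] at key
    exact mul_ne_zero h h' key
  rw [key]
  field_simp

theorem sin_pi_mul_one_sub (s : ℂ) :
    Complex.sin (Real.pi * (1 - s)) = Complex.sin (Real.pi * s) := by
  rw [mul_sub, mul_one, Complex.sin_pi_sub]

theorem sin_pi_mul_ne_zero_of_forall_ne_int {ν : ℂ} (h : ∀ n : ℤ, ν ≠ n) :
    Complex.sin (Real.pi * ν) ≠ 0 := by
  rw [Ne, Complex.sin_eq_zero_iff]
  rintro ⟨n, hn⟩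
  refine h n (mul_left_cancel₀ (Complex.ofReal_ne_zero.2 Real.pi_ne_zero) ?_)
  rw [hn, mul_comm]

theorem Gamma_one_sub_ne_zero {μ ν : ℂ} (h : |ν.re| < (1 - μ).re) :
    Complex.Gamma ((1 - μ + ν) / 2) ≠ 0 ∧ Complex.Gamma ((1 - μ - ν) / 2) ≠ 0 := by
  obtain ⟨h1, h2⟩ := abs_lt.1 h
  constructor
  · apply Complex.Gamma_ne_zero_of_re_pos
    have : ((1 - μ + ν) / 2).re = ((1 - μ).re + ν.re) / 2 := by simp
    linarith
  · apply Complex.Gamma_ne_zero_of_re_pos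
    have : ((1 - μ - ν) / 2).re = ((1 - μ).re - ν.re) / 2 := by simp
    linarith

/-- The defining formula of the Lommel function, for non-integral order, as an integral. -/
theorem lommelSAux_mul_of_not_int {μ ν : ℂ} {z : ℝ} (hz : 0 < z) (h : |ν.re| < (1 - μ).re)
    (hν : ∀ n : ℤ, ν ≠ n) (he : ¬LommelExceptional μ ν) :
    lommelSAux μ ν z * (Complex.Gamma ((1 - μ + ν) / 2) * Complex.Gamma ((1 - μ - ν) / 2)) =
      2 ^ μ * coshTransform ν (laplaceG (1 - μ)) (Real.log z) := by
  obtain ⟨ha, hb⟩ := not_lommelExceptional_iff.1 he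
  obtain ⟨ha', hb'⟩ := Gamma_one_sub_ne_zero h
  have hs := sin_pi_mul_ne_zero_of_forall_ne_int hν
  have core := coshTransform_laplaceG_eq_lommelComb h (Real.log z)
  rw [lommelSAux, if_neg (by push Not; exact hν), lommels_eq_frobeniusSeries hz
    (ne_zero_of_Gamma_ne_zero ha) (ne_zero_of_Gamma_ne_zero hb), besselJ_eq_frobeniusSeries _ hz,
    besselJ_eq_frobeniusSeries _ hz]
  have c1 : Complex.cos ((μ - ν) * Real.pi / 2) = Complex.sin (Real.pi * ((1 - μ + ν) / 2)) := by
    rw [← Complex.sin_pi_div_two_sub]; congr 1; ring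
  have c2 : Complex.cos ((μ + ν) * Real.pi / 2) = Complex.sin (Real.pi * ((1 - μ - ν) / 2)) := by
    rw [← Complex.sin_pi_div_two_sub]; congr 1; ring
  have r1 := Gamma_mul_sin_pi_mul_Gamma ha
    (by rwa [show 1 - (μ - ν + 1) / 2 = (1 - μ + ν) / 2 by ring])
  have r2 := Gamma_mul_sin_pi_mul_Gamma hb
    (by rwa [show 1 - (μ + ν + 1) / 2 = (1 - μ - ν) / 2 by ring])
  rw [← sin_pi_mul_one_sub, show 1 - (μ - ν + 1) / 2 = (1 - μ + ν) / 2 by ring] at r1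
  rw [← sin_pi_mul_one_sub, show 1 - (μ + ν + 1) / 2 = (1 - μ - ν) / 2 by ring] at r2
  rw [lommelComb, show (2 - (1 - μ) - ν) / 2 = (μ - ν + 1) / 2 by ring,
    show (2 - (1 - μ) + ν) / 2 = (μ + ν + 1) / 2 by ring, frobeniusSeries_symm 0 (-ν) 0] at core
  rw [c1, c2]
  have hp : (2 : ℂ) ^ μ = 2 ^ (μ - 1) * 2 := by
    rw [show μ = μ - 1 + 1 by ring, Complex.cpow_add _ _ two_ne_zero, Complex.cpow_one]
    ring_nf
  rw [hp]
  set s1 := Complex.sin (Real.pi * ((1 - μ + ν) / 2)) with hs1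
  set s2 := Complex.sin (Real.pi * ((1 - μ - ν) / 2)) with hs2
  have hs1' : s1 ≠ 0 := by
    intro h0
    rw [h0, zero_mul] at r1
    exact Complex.ofReal_ne_zero.2 Real.pi_ne_zero r1.symm
  have hs2' : s2 ≠ 0 := by
    intro h0
    rw [h0, zero_mul] at r2
    exact Complex.ofReal_ne_zero.2 Real.pi_ne_zero r2.symm
  -- Two reflection formulas combined: they exchange the Gammas in the definition of `S` for those
  -- of the integral representation.
  have r12 : s1 * s2 * ((Complex.Gamma ((μ - ν + 1) / 2) * Complex.Gamma ((μ + ν + 1) / 2)) *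
      (Complex.Gamma ((1 - μ + ν) / 2) * Complex.Gamma ((1 - μ - ν) / 2))) = Real.pi ^ 2 := by
    linear_combination r1 * (s2 * (Complex.Gamma ((μ + ν + 1) / 2) *
      Complex.Gamma ((1 - μ - ν) / 2))) + Real.pi * r2
  refine mul_left_cancel₀ (mul_ne_zero hs (mul_ne_zero hs1' hs2')) ?_
  set F0 := frobeniusSeries 0 ((μ - ν + 1) / 2) ((μ + ν + 1) / 2) (Real.log z)
  set F1 := frobeniusSeries 0 0 (-ν) (Real.log z)
  set F2 := frobeniusSeries 0 0 ν (Real.log z)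
  set s := Complex.sin (Real.pi * ν)
  set Ga := Complex.Gamma ((μ - ν + 1) / 2)
  set Gb := Complex.Gamma ((μ + ν + 1) / 2)
  set Ha := Complex.Gamma ((1 - μ + ν) / 2)
  set Hb := Complex.Gamma ((1 - μ - ν) / 2)
  have e : s * (s1 * s2) * ((2 ^ (μ - 1) * (Ga * Gb) * F0 + 2 ^ (μ - 1) * Ga * Gb / s *
      (s1 * F1 - s2 * F2)) * (Ha * Hb)) =
      2 ^ (μ - 1) * (s * F0 + s1 * F1 - s2 * F2) * (s1 * s2 * ((Ga * Gb) * (Ha * Hb))) := by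
    field_simp
    ring
  rw [e, r12]
  linear_combination -(2 : ℂ) ^ (μ - 1) * core

theorem differentiable_besselJ_order {z : ℝ} (hz : 0 < z) :
    Differentiable ℂ fun ν ↦ besselJ ν z := by
  rw [funext fun ν ↦ besselJ_eq_frobeniusSeries ν hz]
  exact differentiable_frobeniusSeries_param (differentiable_const _) differentiable_id _

/-- Numerator and denominator both vanish at order `0` and are differentiable there, so the quotient
of slopes converges. Hence the `limUnder` in `besselY` is a genuine limit. -/
theorem tendsto_besselYAux_zero {z : ℝ} (hz : 0 < z) :
    Tendsto (fun w ↦ besselYAux w z) (𝓝[≠] 0) (𝓝 (besselY 0 z)) := by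
  have hJ := differentiable_besselJ_order hz
  have hf : DifferentiableAt ℂ
      (fun w ↦ besselJ w z * Complex.cos (Real.pi * w) - besselJ (-w) z) 0 := by
    have h2 : Differentiable ℂ fun w : ℂ ↦ besselJ (-w) z := hJ.comp differentiable_neg
    exact Differentiable.differentiableAt (by fun_prop)
  have hg : HasDerivAt (fun w : ℂ ↦ Complex.sin (Real.pi * w)) Real.pi 0 := by
    simpa using ((hasDerivAt_id (0 : ℂ)).const_mul (Real.pi : ℂ)).csin
  have t := (hasDerivAt_iff_tendsto_slope.1 hf.hasDerivAt).div (hasDerivAt_iff_tendsto_slope.1 hg)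
    (Complex.ofReal_ne_zero.2 Real.pi_ne_zero)
  have t' : ∃ L, Tendsto (fun w ↦ besselYAux w z) (𝓝[≠] 0) (𝓝 L) := by
    refine ⟨_, t.congr' ?_⟩
    filter_upwards [self_mem_nhdsWithin] with w hw
    have hw' : w ≠ 0 := hw
    simp only [Pi.div_apply, slope_def_field, besselYAux, neg_zero, mul_zero, Complex.cos_zero,
      Complex.sin_zero, mul_one, sub_self, sub_zero]
    rw [div_div_div_cancel_right₀ hw']
  rw [besselY, if_pos ⟨0, by simp⟩]
  exact tendsto_nhds_limUnder t'

theorem ne_int_of_norm_lt_one {w : ℂ} (h0 : w ≠ 0) (h1 : ‖w‖ < 1) (n : ℤ) : w ≠ n := by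
  rintro rfl
  rw [Complex.norm_intCast] at h1
  have h2 : |n| < 1 := by exact_mod_cast h1
  rw [Int.abs_lt_one_iff.1 h2] at h0
  simp at h0

/-- Expanding `cos((μ+ν)π/2)` about `(μ-ν)π/2` gives the non-integral formula the shape of the
integral one, so that `ν → 0` can be taken term by term. -/
theorem lommelSAux_eq_of_not_int {μ ν z : ℂ} (hν : ∀ n : ℤ, ν ≠ n) :
    lommelSAux μ ν z = lommels μ ν z +
      2 ^ (μ - 1) * Complex.Gamma ((μ - ν + 1) / 2) * Complex.Gamma ((μ + ν + 1) / 2) *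
        (Complex.sin ((μ - ν) * Real.pi / 2) * besselJ ν z -
          Complex.cos ((μ - ν) * Real.pi / 2) * besselYAux ν z) := by
  have hs := sin_pi_mul_ne_zero_of_forall_ne_int hν
  rw [lommelSAux, if_neg (by push Not; exact hν), besselYAux,
    show (μ + ν) * Real.pi / 2 = (μ - ν) * Real.pi / 2 + Real.pi * ν by ring, Complex.cos_add]
  generalize Complex.sin (Real.pi * ν) = s at hs
  generalize Complex.cos (Real.pi * ν) = c
  generalize Complex.sin ((μ - ν) * Real.pi / 2) = s'
  generalize Complex.cos ((μ - ν) * Real.pi / 2) = c'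
  field_simp
  ring

theorem tendsto_lommelSAux_order_zero {μ : ℂ} {z : ℝ} (hz : 0 < z)
    (he : ¬LommelExceptional μ 0) :
    Tendsto (fun w ↦ lommelSAux μ w z) (𝓝[≠] 0) (𝓝 (lommelSAux μ 0 z)) := by
  obtain ⟨ha, hb⟩ := not_lommelExceptional_iff.1 he
  have hGa : ContinuousAt (fun w : ℂ ↦ Complex.Gamma ((μ - w + 1) / 2)) 0 := by
    refine ContinuousAt.comp (g := Complex.Gamma) (Complex.continuousAt_Gamma _ fun m hm ↦ ?_)
      (by fun_prop)
    exact ha ((Complex.Gamma_eq_zero_iff _).2 ⟨m, hm⟩)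
  have hGb : ContinuousAt (fun w : ℂ ↦ Complex.Gamma ((μ + w + 1) / 2)) 0 := by
    refine ContinuousAt.comp (g := Complex.Gamma) (Complex.continuousAt_Gamma _ fun m hm ↦ ?_)
      (by fun_prop)
    exact hb ((Complex.Gamma_eq_zero_iff _).2 ⟨m, hm⟩)
  have hF : Continuous fun w : ℂ ↦
      frobeniusSeries 0 ((μ - w + 1) / 2) ((μ + w + 1) / 2) (Real.log z) :=
    (differentiable_frobeniusSeries_param (by fun_prop) (by fun_prop) _).continuous
  have ea : ∀ᶠ w : ℂ in 𝓝 0, (μ - w + 1) / 2 ≠ 0 :=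
    (by fun_prop : ContinuousAt (fun w : ℂ ↦ (μ - w + 1) / 2) 0).eventually_ne
      (ne_zero_of_Gamma_ne_zero ha)
  have eb : ∀ᶠ w : ℂ in 𝓝 0, (μ + w + 1) / 2 ≠ 0 :=
    (by fun_prop : ContinuousAt (fun w : ℂ ↦ (μ + w + 1) / 2) 0).eventually_ne
      (ne_zero_of_Gamma_ne_zero hb)
  have hs : ContinuousAt (fun w : ℂ ↦ lommels μ w z) 0 := by
    refine ContinuousAt.congr (f := fun w ↦ 2 ^ (μ - 1) * (Complex.Gamma ((μ - w + 1) / 2) *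
      Complex.Gamma ((μ + w + 1) / 2)) *
      frobeniusSeries 0 ((μ - w + 1) / 2) ((μ + w + 1) / 2) (Real.log z))
      ((continuousAt_const.mul (hGa.mul hGb)).mul hF.continuousAt) ?_
    filter_upwards [ea, eb] with w h1 h2
    exact (lommels_eq_frobeniusSeries hz h1 h2).symm
  have hJ := (differentiable_besselJ_order hz).continuous
  have hsin : Continuous fun w : ℂ ↦ Complex.sin ((μ - w) * Real.pi / 2) * besselJ w z := by
    fun_prop
  have hcos : Continuous fun w : ℂ ↦ Complex.cos ((μ - w) * Real.pi / 2) := by fun_prop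
  have l : 𝓝[≠] (0 : ℂ) ≤ 𝓝 0 := nhdsWithin_le_nhds
  have t := (hs.tendsto.mono_left l).add
    ((((hGa.tendsto.mono_left l).const_mul ((2 : ℂ) ^ (μ - 1))).mul (hGb.tendsto.mono_left l)).mul
    (((hsin.tendsto 0).mono_left l).sub
      (((hcos.tendsto 0).mono_left l).mul (tendsto_besselYAux_zero hz))))
  have e0 : lommelSAux μ 0 z = lommels μ 0 z +
      2 ^ (μ - 1) * Complex.Gamma ((μ - 0 + 1) / 2) * Complex.Gamma ((μ + 0 + 1) / 2) *
        (Complex.sin ((μ - 0) * Real.pi / 2) * besselJ 0 z -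
          Complex.cos ((μ - 0) * Real.pi / 2) * besselY 0 z) := by
    rw [lommelSAux, if_pos ⟨0, by simp⟩]
  rw [e0]
  refine t.congr' ?_
  filter_upwards [self_mem_nhdsWithin, l (Metric.ball_mem_nhds (0 : ℂ) one_pos)] with w hw hw1
  exact (lommelSAux_eq_of_not_int
    (ne_int_of_norm_lt_one hw (by simpa using hw1))).symm

theorem lommelSAux_mul {μ ν : ℂ} {z : ℝ} (hz : 0 < z) (h : |ν.re| < (1 - μ).re)
    (hν : ν = 0 ∨ ∀ n : ℤ, ν ≠ n) (he : ¬LommelExceptional μ ν) :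
    lommelSAux μ ν z * (Complex.Gamma ((1 - μ + ν) / 2) * Complex.Gamma ((1 - μ - ν) / 2)) =
      2 ^ μ * coshTransform ν (laplaceG (1 - μ)) (Real.log z) := by
  rcases hν with rfl | hν
  swap
  · exact lommelSAux_mul_of_not_int hz h hν he
  obtain ⟨ha, hb⟩ := not_lommelExceptional_iff.1 he
  obtain ⟨ha', hb'⟩ := Gamma_one_sub_ne_zero h
  have l : 𝓝[≠] (0 : ℂ) ≤ 𝓝 0 := nhdsWithin_le_nhds
  have hinv : ∀ {f : ℂ → ℂ}, Continuous f → Complex.Gamma (f 0) ≠ 0 →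
      ContinuousAt (fun w ↦ Complex.Gamma (f w)) 0 := by
    intro f hf h0
    refine ContinuousAt.comp (g := Complex.Gamma) (Complex.continuousAt_Gamma _ fun m hm ↦ ?_)
      hf.continuousAt
    exact h0 ((Complex.Gamma_eq_zero_iff _).2 ⟨m, hm⟩)
  have t1 := (tendsto_lommelSAux_order_zero hz he).mul
    (((hinv (f := fun w ↦ (1 - μ + w) / 2) (by fun_prop) ha').mul
      (hinv (f := fun w ↦ (1 - μ - w) / 2) (by fun_prop) hb')).tendsto.mono_left l)
  have t2 := ((differentiableAt_coshTransform_right h (Real.log z)).continuousAt.tendsto.mono_left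
    l).const_mul ((2 : ℂ) ^ μ)
  refine tendsto_nhds_unique (t1.congr' ?_) t2
  have e1 := (hinv (f := fun w ↦ (μ - w + 1) / 2) (by fun_prop) ha).eventually_ne ha
  have e2 := (hinv (f := fun w ↦ (μ + w + 1) / 2) (by fun_prop) hb).eventually_ne hb
  have e3 : ∀ᶠ w : ℂ in 𝓝 0, |w.re| < (1 - μ).re :=
    (by fun_prop : Continuous fun w : ℂ ↦ |w.re|).continuousAt.eventually_lt continuousAt_const h
  filter_upwards [self_mem_nhdsWithin, l (Metric.ball_mem_nhds (0 : ℂ) one_pos), l e1, l e2, l e3]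
    with w hw hw1 h1 h2 h3
  exact lommelSAux_mul_of_not_int hz h3 (ne_int_of_norm_lt_one hw (by simpa using hw1))
    (not_lommelExceptional_iff.2 ⟨h1, h2⟩)

/-- The zeros of the entire function `1/Γ` are isolated, since it is not identically zero. -/
theorem eventually_Gamma_ne_zero (s : ℂ) : ∀ᶠ w in 𝓝[≠] s, Complex.Gamma w ≠ 0 := by
  have hd := Complex.differentiable_one_div_Gamma
  have han : AnalyticOnNhd ℂ (fun w ↦ (Complex.Gamma w)⁻¹) univ :=
    hd.differentiableOn.analyticOnNhd isOpen_univ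
  rcases (han s (mem_univ s)).eventually_eq_zero_or_eventually_ne_zero with h | h
  · have := han.eqOn_zero_of_preconnected_of_eventuallyEq_zero isPreconnected_univ (mem_univ s) h
      (mem_univ 1)
    simp at this
  · exact h.mono fun w hw h0 ↦ hw (by simp [h0])

theorem eventually_not_lommelExceptional (μ ν : ℂ) :
    ∀ᶠ m in 𝓝[≠] μ, ¬LommelExceptional m ν := by
  have key : ∀ c : ℂ, ∀ᶠ m in 𝓝[≠] μ, Complex.Gamma ((m + c + 1) / 2) ≠ 0 := by
    intro c
    have ht : Tendsto (fun m : ℂ ↦ (m + c + 1) / 2) (𝓝[≠] μ) (𝓝[≠] ((μ + c + 1) / 2)) := by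
      refine tendsto_nhdsWithin_iff.2 ⟨((by fun_prop :
        Continuous fun m : ℂ ↦ (m + c + 1) / 2).tendsto μ).mono_left nhdsWithin_le_nhds, ?_⟩
      filter_upwards [self_mem_nhdsWithin] with m hm h
      refine hm ?_
      have h' : (m + c + 1) / 2 = (μ + c + 1) / 2 := h
      have : m = μ := by linear_combination 2 * h'
      exact this
    exact ht.eventually (eventually_Gamma_ne_zero _)
  filter_upwards [key ν, key (-ν)] with m h1 h2
  rw [← sub_eq_add_neg] at h2
  exact not_lommelExceptional_iff.2 ⟨h2, h1⟩

/-- The Lommel function as an integral. -/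
theorem lommelS_mul {μ ν : ℂ} {z : ℝ} (hz : 0 < z) (h : |ν.re| < (1 - μ).re)
    (hν : ν = 0 ∨ ∀ n : ℤ, ν ≠ n) :
    lommelS μ ν z * (Complex.Gamma ((1 - μ + ν) / 2) * Complex.Gamma ((1 - μ - ν) / 2)) =
      2 ^ μ * coshTransform ν (laplaceG (1 - μ)) (Real.log z) := by
  rw [lommelS]
  split_ifs with he
  swap
  · exact lommelSAux_mul hz h hν he
  obtain ⟨ha', hb'⟩ := Gamma_one_sub_ne_zero h
  have l : 𝓝[≠] μ ≤ 𝓝 μ := nhdsWithin_le_nhds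
  have hinv : ∀ {f : ℂ → ℂ}, Continuous f →
      ContinuousAt (fun w ↦ (Complex.Gamma (f w))⁻¹) μ := fun hf ↦
    (Complex.differentiable_one_div_Gamma.continuous.comp hf).continuousAt
  have hΦ : ContinuousAt (fun m ↦ coshTransform ν (laplaceG (1 - m)) (Real.log z)) μ :=
    ContinuousAt.comp (g := fun p ↦ coshTransform ν (laplaceG p) (Real.log z))
      (differentiableAt_coshTransform_left h (Real.log z)).continuousAt (by fun_prop)
  have hpow : ContinuousAt (fun m : ℂ ↦ (2 : ℂ) ^ m) μ :=
    continuousAt_const_cpow two_ne_zero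
  have t := ((hpow.mul hΦ).mul ((hinv (f := fun m ↦ (1 - m + ν) / 2) (by fun_prop)).mul
    (hinv (f := fun m ↦ (1 - m - ν) / 2) (by fun_prop)))).tendsto.mono_left l
  -- Divided by the Gamma factors, the integral side is continuous in `m` even at an exceptional
  -- `μ`. So the limit defining `lommelS` exists and has the expected value.
  have t' : Tendsto (fun m ↦ lommelSAux m ν z) (𝓝[≠] μ)
      (𝓝 (2 ^ μ * coshTransform ν (laplaceG (1 - μ)) (Real.log z) *
        ((Complex.Gamma ((1 - μ + ν) / 2))⁻¹ * (Complex.Gamma ((1 - μ - ν) / 2))⁻¹))) := by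
    refine t.congr' ?_
    have e3 : ∀ᶠ m : ℂ in 𝓝 μ, |ν.re| < (1 - m).re :=
      continuousAt_const.eventually_lt
        (by fun_prop : Continuous fun m : ℂ ↦ (1 - m).re).continuousAt h
    filter_upwards [eventually_not_lommelExceptional μ ν, l e3] with m h1 h2
    obtain ⟨g1, g2⟩ := Gamma_one_sub_ne_zero h2
    simp only [Pi.mul_apply]
    rw [← lommelSAux_mul hz h2 hν h1]
    field_simp
  rw [t'.limUnder_eq]
  field_simp

/-- For order `1/2` the two Gamma factors have arguments differing by `1/2`, and the duplication
formula merges them into `Γ(1-μ)`. -/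
theorem lommelS_half {μ : ℝ} {z : ℝ} (hz : 0 < z) (hμ : μ < 1) :
    lommelS (μ - 1 / 2) (1 / 2) z = laplaceG (1 - μ) z / (Real.sqrt z * Real.Gamma (1 - μ) : ℝ) := by
  have hhalf : (1 / 2 : ℂ).re = 1 / 2 := by norm_num
  have hν : ∀ n : ℤ, (1 / 2 : ℂ) ≠ n := by
    intro n hn
    have h2 : (1 : ℂ) = 2 * n := by linear_combination 2 * hn
    have h3 : (1 : ℤ) = 2 * n := by exact_mod_cast h2
    omega
  have hre : (1 - (μ - 1 / 2 : ℂ)).re = 1 - μ + 1 / 2 := by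
    simp only [Complex.sub_re, Complex.one_re, Complex.ofReal_re, hhalf]; ring
  have key := lommelS_mul (μ := μ - 1 / 2) (ν := 1 / 2) hz
    (by rw [hre, hhalf, abs_of_pos (by norm_num)]; linarith) (Or.inr hν)
  rw [show (1 - (μ - 1 / 2 : ℂ)) = 1 - μ + 1 / 2 by ring, coshTransform_half (by simpa using hμ),
    Real.exp_log hz] at key
  have hdup := Real.Gamma_mul_Gamma_add_half ((1 - μ) / 2)
  have hG1 : Complex.Gamma ((1 - (μ : ℂ) + 1 / 2 + 1 / 2) / 2) =
      (Real.Gamma ((1 - μ) / 2 + 1 / 2) : ℝ) := by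
    rw [← Complex.Gamma_ofReal]; congr 1; push_cast; ring
  have hG2 : Complex.Gamma ((1 - (μ : ℂ) + 1 / 2 - 1 / 2) / 2) =
      (Real.Gamma ((1 - μ) / 2) : ℝ) := by
    rw [← Complex.Gamma_ofReal]; congr 1; push_cast; ring
  have hexp : Real.exp (-(Real.log z / 2)) = (Real.sqrt z)⁻¹ := by
    rw [Real.exp_neg, Real.exp_half, Real.exp_log hz]
  have h2 : (2 : ℂ) ^ ((μ : ℂ) - 1 / 2) = ((2 : ℝ) ^ (μ - 1 / 2) : ℝ) := by
    rw [Complex.ofReal_cpow two_pos.le]; push_cast; rfl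
  rw [hG1, hG2, ← Complex.ofReal_mul, mul_comm (Real.Gamma ((1 - μ) / 2 + 1 / 2)), hdup, hexp,
    h2, mul_div_cancel₀ _ two_ne_zero] at key
  have hpow : (2 : ℝ) ^ (μ - 1 / 2) * Real.sqrt (2 * Real.pi) =
      2 ^ (1 - (1 - μ)) * Real.sqrt Real.pi := by
    rw [Real.sqrt_mul two_pos.le, ← mul_assoc, Real.sqrt_eq_rpow 2, ← Real.rpow_add two_pos]
    ring_nf
  have hΓ : 0 < Real.Gamma (1 - μ) := Real.Gamma_pos_of_pos (by linarith)
  have hsz : 0 < Real.sqrt z := Real.sqrt_pos.2 hz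
  have hne : ((2 ^ (1 - (1 - μ)) * Real.sqrt Real.pi : ℝ) : ℂ) ≠ 0 := by
    have : 0 < Real.sqrt Real.pi := Real.sqrt_pos.2 Real.pi_pos
    exact_mod_cast (by positivity : (2 : ℝ) ^ (1 - (1 - μ)) * Real.sqrt Real.pi ≠ 0)
  have hden : ((Real.sqrt z * Real.Gamma (1 - μ) : ℝ) : ℂ) ≠ 0 := by
    exact_mod_cast (by positivity : Real.sqrt z * Real.Gamma (1 - μ) ≠ 0)
  rw [eq_div_iff hden]
  have hszc : ((Real.sqrt z : ℝ) : ℂ) ≠ 0 := by exact_mod_cast hsz.ne'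
  have hpowc : ((2 : ℝ) ^ (μ - 1 / 2) : ℝ) * (Real.sqrt (2 * Real.pi) : ℂ) =
      ((2 ^ (1 - (1 - μ)) * Real.sqrt Real.pi : ℝ) : ℂ) := by
    exact_mod_cast congrArg Complex.ofReal hpow
  refine mul_left_cancel₀ hne ?_
  have hinv : ((Real.sqrt z : ℝ) : ℂ) * ((Real.sqrt z : ℝ) : ℂ)⁻¹ = 1 := mul_inv_cancel₀ hszc
  push_cast at key hpowc hinv ⊢
  generalize lommelS (μ - 1 / 2) (1 / 2) z = L at key ⊢
  generalize laplaceG (1 - μ) z = G at key ⊢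
  linear_combination (Real.sqrt z : ℂ) * key + G * hpowc +
    (((2 : ℝ) ^ (μ - 1 / 2) : ℝ) : ℂ) * Real.sqrt (2 * Real.pi) * G * hinv

/-! ### Poisson summation -/

theorem summable_int_and_tsum_of_even {f : ℤ → ℂ} (hf : ∀ n, f (-n) = f n)
    (hs : Summable fun n : ℕ ↦ f (n + 1)) :
    Summable f ∧ ∑' n, f n = f 0 + 2 * ∑' n : ℕ, f (n + 1) := by
  have h1 : Summable fun n : ℕ ↦ f n := by
    refine (summable_nat_add_iff 1).1 ?_
    simpa using hs
  have h2 : Summable fun n : ℕ ↦ f (-(n + 1)) := by simpa only [hf] using hs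
  refine ⟨h1.of_nat_of_neg_add_one h2, ?_⟩
  rw [tsum_of_nat_of_neg_add_one h1 h2, h1.tsum_eq_zero_add]
  simp only [hf, Nat.cast_add, Nat.cast_one, Nat.cast_zero]
  ring

theorem coshTransform_neg (ν : ℂ) (g : ℝ → ℂ) (τ : ℝ) :
    coshTransform (-ν) g τ = coshTransform ν g τ := by
  rw [coshTransform, coshTransform, ← integral_neg_eq_self]
  simp

theorem summable_coshTransform_laplaceG {p : ℂ} (hp : 0 < p.re) {α : ℝ} (hα : 0 < α) (τ : ℝ) :
    Summable fun n : ℕ ↦ coshTransform (Complex.I * α * (n + 1)) (laplaceG p) τ := by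
  obtain ⟨C, hC⟩ := exists_norm_sq_mul_coshTransform_le hp τ
  have hs : Summable fun n : ℕ ↦ C / α ^ 2 * (1 / ((n + 1 : ℕ) : ℝ) ^ 2) :=
    ((summable_nat_add_iff 1).2 (Real.summable_one_div_nat_pow.2 one_lt_two)).mul_left _
  refine Summable.of_norm_bounded hs fun n ↦ ?_
  have h := hC (Complex.I * α * (n + 1)) (by simp)
  have hn : ‖(n + 1 : ℂ)‖ = ((n + 1 : ℕ) : ℝ) := by
    rw [← Nat.cast_succ, Complex.norm_natCast]
  rw [norm_mul, norm_pow, norm_mul, norm_mul, Complex.norm_I, one_mul, hn, Complex.norm_real,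
    Real.norm_of_nonneg hα.le, mul_comm, ← le_div_iff₀ (by positivity)] at h
  refine h.trans_eq ?_
  field_simp

/-- The decay is in fact exponential in `|u|`; the power `-2` is a form accepted by the Poisson
summation theorem. -/
theorem isBigO_laplaceG_cosh {p : ℂ} (hp : 0 < p.re) {β : ℝ} (hβ : 0 < β) (τ : ℝ) :
    (fun u : ℝ ↦ laplaceG p (Real.exp τ * Real.cosh (β * u))) =O[cocompact ℝ]
      fun u ↦ |u| ^ (-2 : ℝ) := by
  have h1 : (fun u : ℝ ↦ laplaceG p (Real.exp τ * Real.cosh (β * u))) =O[cocompact ℝ]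
      fun u ↦ Real.exp (-(p.re * β) * |u|) := by
    refine .of_bound (Real.Gamma p.re * Real.exp (-(p.re * τ)) * Real.exp (p.re * Real.log 2))
      (Eventually.of_forall fun u ↦ ?_)
    refine (norm_comp_exp_mul_cosh_le (fun c hc ↦ norm_laplaceG_le hp hc) τ (β * u)).trans ?_
    have h := exp_mul_exp_neg_mul_log_cosh_le (s := 0) hp.le (β * u)
    rw [zero_mul, Real.exp_zero, one_mul, abs_zero, sub_zero, abs_mul, abs_of_pos hβ] at h
    have hΓ : 0 < Real.Gamma p.re := Real.Gamma_pos_of_pos hp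
    rw [Real.norm_of_nonneg (Real.exp_pos _).le, mul_assoc _ (Real.exp (p.re * Real.log 2)),
      show -(p.re * β) * |u| = -(p.re * (β * |u|)) by ring]
    gcongr
  exact h1.trans ((isLittleO_exp_neg_mul_rpow_atTop (mul_pos hp hβ) (-2)).isBigO.comp_tendsto
    (tendsto_norm_cocompact_atTop (E := ℝ)))

theorem continuous_laplaceG_cosh {p : ℂ} (hp : 0 < p.re) (β τ : ℝ) :
    Continuous fun u : ℝ ↦ laplaceG p (Real.exp τ * Real.cosh (β * u)) :=
  (continuous_comp_exp_mul_cosh (continuousOn_laplaceG hp) τ).comp (continuous_const_mul β)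

theorem summable_laplaceG_cosh {p : ℂ} (hp : 0 < p.re) {β : ℝ} (hβ : 0 < β) (τ : ℝ) :
    Summable fun n : ℤ ↦ laplaceG p (Real.exp τ * Real.cosh (β * n)) :=
  summable_of_isBigO (Real.summable_abs_int_rpow one_lt_two)
    ((isBigO_laplaceG_cosh hp hβ τ).comp_tendsto Int.tendsto_coe_cofinite)

open FourierTransform in
-- The dilation by `2π/α` turns the Fourier frequency `w` into the order `iαw`; its sign is
-- immaterial because `cosh` is even.
theorem fourier_laplaceG_cosh (p : ℂ) {α : ℝ} (hα : 0 < α) (τ w : ℝ) :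
    𝓕 (fun u : ℝ ↦ laplaceG p (Real.exp τ * Real.cosh (2 * Real.pi / α * u))) w =
      (α / (2 * Real.pi) : ℝ) * coshTransform (Complex.I * α * w) (laplaceG p) τ := by
  have hβ : 0 < 2 * Real.pi / α := by positivity
  have h := Measure.integral_comp_mul_left (fun u : ℝ ↦
    Complex.exp (-(Complex.I * α * w) * u) * laplaceG p (Real.exp τ * Real.cosh u))
    (2 * Real.pi / α)
  rw [← coshTransform, coshTransform_neg, abs_of_pos (inv_pos.2 hβ), inv_div] at h
  rw [Real.fourier_real_eq_integral_exp_smul, ← Complex.real_smul, ← h]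
  refine integral_congr_ae (Eventually.of_forall fun u ↦ ?_)
  have hα' : (α : ℂ) ≠ 0 := Complex.ofReal_ne_zero.2 hα.ne'
  simp only [smul_eq_mul]
  congr 2
  push_cast
  field_simp

/-- Poisson summation for `u ↦ laplaceG p (e^τ cosh u)`. -/
theorem tsum_coshTransform_laplaceG {p : ℂ} (hp : 0 < p.re) {α : ℝ} (hα : 0 < α) (τ : ℝ) :
    coshTransform 0 (laplaceG p) τ +
        2 * ∑' n : ℕ, coshTransform (Complex.I * α * (n + 1)) (laplaceG p) τ =
      (2 * Real.pi / α : ℝ) * (laplaceG p (Real.exp τ) +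
        2 * ∑' n : ℕ, laplaceG p (Real.exp τ * Real.cosh (2 * Real.pi * (n + 1) / α))) := by
  have hβ : 0 < 2 * Real.pi / α := by positivity
  have hG := summable_int_and_tsum_of_even
    (f := fun n : ℤ ↦ laplaceG p (Real.exp τ * Real.cosh (2 * Real.pi / α * n)))
    (fun n ↦ by push_cast; rw [mul_neg, Real.cosh_neg])
    ((summable_laplaceG_cosh hp hβ τ).comp_injective
      (i := fun n : ℕ ↦ (n + 1 : ℤ)) fun a b h ↦ by simpa using h)
  have hT := summable_int_and_tsum_of_even
    (f := fun n : ℤ ↦ coshTransform (Complex.I * α * n) (laplaceG p) τ)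
    (fun n ↦ by push_cast; rw [mul_neg, coshTransform_neg])
    (by simpa using summable_coshTransform_laplaceG hp hα τ)
  -- Poisson summation at the point `0`, where all the characters equal `1`.
  have hP := Real.tsum_eq_tsum_fourier_of_rpow_decay_of_summable
    (continuous_laplaceG_cosh hp (2 * Real.pi / α) τ) one_lt_two (isBigO_laplaceG_cosh hp hβ τ)
    (by simpa only [fourier_laplaceG_cosh p hα, Complex.ofReal_intCast] using hT.1.mul_left _) 0
  simp only [fourier_laplaceG_cosh p hα, Complex.ofReal_intCast, zero_add, QuotientAddGroup.mk_zero,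
    fourier_eval_zero, mul_one, tsum_mul_left] at hP
  rw [hG.2, hT.2] at hP
  simp only [Int.cast_zero, mul_zero, Real.cosh_zero, mul_one, Int.cast_add, Int.cast_natCast,
    Int.cast_one] at hP
  have hne : ((α / (2 * Real.pi) : ℝ) : ℂ) ≠ 0 := by
    exact_mod_cast (by positivity : α / (2 * Real.pi) ≠ 0)
  refine mul_left_cancel₀ hne ?_
  rw [← hP, ← mul_assoc, ← Complex.ofReal_mul,
    show α / (2 * Real.pi) * (2 * Real.pi / α) = 1 by field_simp, Complex.ofReal_one, one_mul]
  simp only [mul_div_right_comm]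

/-! ### Specialization to the two series -/

/-- For real `μ` and imaginary order the two Gamma factors are complex conjugates, so their product
is a squared modulus. -/
theorem norm_Gamma_sq_mul_lommelS {μ z : ℝ} (hz : 0 < z) (hμ : μ < 1) {t : ℝ} :
    ((‖Complex.Gamma ((1 - μ + Complex.I * t) / 2)‖ ^ 2 : ℝ) : ℂ) *
        lommelS μ (Complex.I * t) z =
      2 ^ (μ : ℂ) * coshTransform (Complex.I * t) (laplaceG (1 - μ)) (Real.log z) := by
  rw [← lommelS_mul hz (by simpa using hμ), mul_comm]
  · congr 1
    rw [Complex.ofReal_pow, ← Complex.mul_conj', ← Complex.Gamma_conj]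
    congr 2
    rw [map_div₀, Complex.conj_ofNat]
    simp [sub_eq_add_neg]
  · rcases eq_or_ne t 0 with rfl | ht
    · simp
    · refine Or.inr fun n hn ↦ ht ?_
      simpa using congrArg Complex.im hn

/-- The weight `cosh^(1/2)` cancels the part of `√(x cosh u)` that depends on `u`, leaving a
constant denominator. -/
theorem cosh_rpow_half_mul_lommelS {μ x : ℝ} (hx : 0 < x) (hμ : μ < 1) (u : ℝ) :
    ((Real.cosh u ^ (1 / 2 : ℝ) : ℝ) : ℂ) *
        lommelS (μ - 1 / 2) (1 / 2) ((x * Real.cosh u : ℝ) : ℂ) =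
      laplaceG (1 - μ) (x * Real.cosh u) / (Real.sqrt x * Real.Gamma (1 - μ) : ℝ) := by
  have hc := Real.cosh_pos u
  have hsc : ((Real.sqrt (Real.cosh u) : ℝ) : ℂ) ≠ 0 :=
    Complex.ofReal_ne_zero.2 (Real.sqrt_pos.2 hc).ne'
  rw [lommelS_half (mul_pos hx hc) hμ, ← Real.sqrt_eq_rpow, Real.sqrt_mul hx.le]
  push_cast
  rw [mul_comm (Real.sqrt x : ℂ), mul_assoc (Real.sqrt (Real.cosh u) : ℂ), mul_div_assoc',
    mul_div_mul_left _ _ hsc]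

end

theorem corollary6 (α x μ : ℝ) (hα : 0 < α) (hx : 0 < x) (hμ : μ < 1 / 2) :
    Summable (fun n : ℕ =>
      ((‖Complex.Gamma ((1 - μ + Complex.I * α * (n + 1)) / 2)‖ ^ 2 : ℝ) : ℂ) *
        lommelS μ (Complex.I * α * (n + 1)) x) ∧
    Summable (fun n : ℕ =>
      ((Real.cosh (2 * Real.pi * (n + 1) / α) ^ (1 / 2 : ℝ) : ℝ) : ℂ) *
        lommelS (μ - 1 / 2) (1 / 2) ((x * Real.cosh (2 * Real.pi * (n + 1) / α) : ℝ) : ℂ)) ∧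
    ((Real.Gamma ((1 - μ) / 2) ^ 2 : ℝ) : ℂ) * lommelS μ 0 x +
      2 * ∑' n : ℕ,
        ((‖Complex.Gamma ((1 - μ + Complex.I * α * (n + 1)) / 2)‖ ^ 2 : ℝ) : ℂ) *
          lommelS μ (Complex.I * α * (n + 1)) x =
    ((2 ^ (μ + 1) * Real.pi * Real.Gamma (1 - μ) / α * Real.sqrt x : ℝ) : ℂ) *
      (lommelS (μ - 1 / 2) (1 / 2) x +
        2 * ∑' n : ℕ,
          ((Real.cosh (2 * Real.pi * (n + 1) / α) ^ (1 / 2 : ℝ) : ℝ) : ℂ) *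
            lommelS (μ - 1 / 2) (1 / 2)
              ((x * Real.cosh (2 * Real.pi * (n + 1) / α) : ℝ) : ℂ)) := by
  have hμ1 : μ < 1 := by linarith
  have hp : 0 < (1 - μ : ℂ).re := by simpa using hμ1
  have hβ : 0 < 2 * Real.pi / α := by positivity
  have e1 : ∀ n : ℕ, ((‖Complex.Gamma ((1 - μ + Complex.I * α * (n + 1)) / 2)‖ ^ 2 : ℝ) : ℂ) *
      lommelS μ (Complex.I * α * (n + 1)) x =
      2 ^ (μ : ℂ) * coshTransform (Complex.I * α * (n + 1)) (laplaceG (1 - μ)) (Real.log x) := by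
    intro n
    have h := norm_Gamma_sq_mul_lommelS hx hμ1 (t := α * (n + 1))
    push_cast at h ⊢
    simpa only [mul_assoc] using h
  have e0 : ((Real.Gamma ((1 - μ) / 2) ^ 2 : ℝ) : ℂ) * lommelS μ 0 x =
      2 ^ (μ : ℂ) * coshTransform 0 (laplaceG (1 - μ)) (Real.log x) := by
    rw [← lommelS_mul hx (by simpa using hμ1) (Or.inl rfl), add_zero, sub_zero,
      show ((1 - μ : ℂ) / 2) = ((1 - μ) / 2 : ℝ) by push_cast; rfl, Complex.Gamma_ofReal]
    push_cast
    ring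
  have eh := fun n : ℕ ↦ cosh_rpow_half_mul_lommelS hx hμ1 (2 * Real.pi * (n + 1) / α)
  have hsum1 := summable_coshTransform_laplaceG hp hα (Real.log x)
  have hsum2 : Summable fun n : ℕ ↦
      laplaceG (1 - μ) (x * Real.cosh (2 * Real.pi * (n + 1) / α)) := by
    have h := (summable_laplaceG_cosh hp hβ (Real.log x)).comp_injective
      (i := fun n : ℕ ↦ (n + 1 : ℤ)) fun a b h ↦ by simpa using h
    simpa [Function.comp_def, Real.exp_log hx, mul_div_right_comm] using h
  simp only [e1, eh, e0, lommelS_half hx hμ1]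
  refine ⟨hsum1.mul_left _, hsum2.div_const _, ?_⟩
  have hP := tsum_coshTransform_laplaceG hp hα (Real.log x)
  rw [Real.exp_log hx] at hP
  have hΓ : ((Real.Gamma (1 - μ) : ℝ) : ℂ) ≠ 0 :=
    Complex.ofReal_ne_zero.2 (Real.Gamma_pos_of_pos (by linarith)).ne'
  have hsx : ((Real.sqrt x : ℝ) : ℂ) ≠ 0 := Complex.ofReal_ne_zero.2 (Real.sqrt_pos.2 hx).ne'
  have hα' : (α : ℂ) ≠ 0 := Complex.ofReal_ne_zero.2 hα.ne'
  have h2 : (2 : ℂ) ^ (μ : ℂ) = ((2 : ℝ) ^ μ : ℝ) := by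
    rw [Complex.ofReal_cpow two_pos.le]; push_cast; rfl
  -- The constants agree: `2^μ · 2π/α` is the stated prefactor divided by the common denominator `√x
  -- Γ(1-μ)`.
  rw [tsum_mul_left, tsum_div_const, mul_left_comm, ← mul_add, hP, h2, Real.rpow_add_one two_ne_zero]
  push_cast
  field_simp
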